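/- There is a deterministic algorithm and an absolute constant $K$ such that the following holds. The input consists of an integer $n\ge 1$, a matrix $A=(a_{ik})\in\mathbb{R}^{n\times n}$ and real numbers $C$ and $\epsilon>0$ such that $|a_{ik}|\le C$ for all $i,k$, and such that $\sum_k a_{ik}^2\le n$ for every row $i$ and $\sum_i a_{ik}^2\le n$ for every column $k$. On each such input the algorithm halts after at most $K\max(1,C/\epsilon)^K n^2$ steps, and either - outputs a claim that every singular value of $A$ is at most $\epsilon n$, and this claim is then correct, or - outputs sets $S,T\subseteq\{1,\dots,n\}$ such that $$\Bigl|\sum_{i\in S,\,k\in T}a_{ik}\Bigr|\ge\frac{\epsilon^8}{100}n^2$$ (so that $A$ has a singular value that is at least $\frac{\epsilon^8}{100}n$). The model of computation is a real random access machine: a finite program, independent of the input, works with arrays of exact real numbers and arrays of machine words (natural numbers). Field operations and comparisons of real numbers, arithmetic operations and comparisons of words, conversion of a word to a real number, and accesses to the memory or to the entries of $A$ cost one step each. There is no conversion from real numbers to words, and all words and addresses used in the computation are bounded by $K\max(1,C/\epsilon)^K n^2$. -/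

import Mathlib

/-!
A real random access machine.

The machine has two kinds of memory: machine words (natural numbers, used for counting and
addressing) and exact real numbers.  Each kind of memory is organised in arrays with numerical
names; a program mentions only finitely many of them.  A program is a finite piece of text, it does
not depend on the input, and the only constants occurring in it are natural numbers.  Every
arithmetic operation, comparison, memory access and input access costs one step.  There is no
operation that turns a real number into a word; the only access to real numbers is through exact
field operations and comparisons.  Words are bounded: a run with word bound `W` is illegal, and has
no result, as soon as a word larger than `W` is computed.  Division by zero and reading an entry
outside of the input matrix are illegal as well.
-/

namespace RealRAM

/-- The input: a real square matrix together with two real parameters. -/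
structure Input where
  /-- the number of rows and columns -/
  n : ℕ
  /-- the matrix -/
  A : Matrix (Fin n) (Fin n) ℝ
  /-- the bound on the absolute values of the entries -/
  C : ℝ
  /-- the accuracy -/
  ε : ℝ

/-- Random access to the input matrix by word indices (counted from `0`).  The value `0` outside of
the range is never used, since such an access is illegal. -/
def Input.entry (x : Input) (i k : ℕ) : ℝ :=
  if h : i < x.n ∧ k < x.n then x.A ⟨i, h.1⟩ ⟨k, h.2⟩ else 0

/-- The content of the memory: `word a i` and `real a i` are the cells with index `i` of the word
array and of the real array with name `a`. -/
structure Store where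
  word : ℕ → ℕ → ℕ
  real : ℕ → ℕ → ℝ

/-- The initial memory: all cells are zero. -/
def Store.init : Store := ⟨fun _ _ => 0, fun _ _ => 0⟩

/-- Write the word `v` to the cell with index `i` of the word array `a`. -/
def Store.setWord (s : Store) (a i v : ℕ) : Store :=
  { s with word := Function.update s.word a (Function.update (s.word a) i v) }

/-- Write the real number `v` to the cell with index `i` of the real array `a`. -/
def Store.setReal (s : Store) (a i : ℕ) (v : ℝ) : Store :=
  { s with real := Function.update s.real a (Function.update (s.real a) i v) }

/-- Word expressions. -/
inductive WExp where
  /-- a constant -/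
  | const (c : ℕ)
  /-- the number of rows of the input matrix -/
  | size
  /-- the content of a cell of the word array `a` -/
  | cell (a : ℕ) (i : WExp)
  | add (e f : WExp)
  /-- subtraction, with result `0` if the second argument is larger -/
  | sub (e f : WExp)
  | mul (e f : WExp)
  /-- the quotient of division with remainder -/
  | div (e f : WExp)
  /-- the remainder of division with remainder -/
  | mod (e f : WExp)

/-- Real expressions. -/
inductive RExp where
  /-- a word, regarded as a real number -/
  | cast (e : WExp)
  /-- an entry of the input matrix -/
  | entry (i k : WExp)
  /-- the input parameter `C` -/
  | bound
  /-- the input parameter `ε` -/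
  | accuracy
  /-- the content of a cell of the real array `a` -/
  | cell (a : ℕ) (i : WExp)
  | add (e f : RExp)
  | sub (e f : RExp)
  | mul (e f : RExp)
  | div (e f : RExp)

/-- Tests. -/
inductive Test where
  | wordLE (e f : WExp)
  | realLE (e f : RExp)
  | not (b : Test)
  | and (b c : Test)

/-- Programs. -/
inductive Prog where
  | skip
  /-- assign the value of `e` to the cell with index `i` of the word array `a` -/
  | setWord (a : ℕ) (i : WExp) (e : WExp)
  /-- assign the value of `e` to the cell with index `i` of the real array `a` -/
  | setReal (a : ℕ) (i : WExp) (e : RExp)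
  | seq (p q : Prog)
  | ite (b : Test) (p q : Prog)
  | while (b : Test) (p : Prog)

/-- The value of a word expression. -/
def WExp.eval (x : Input) (s : Store) : WExp → ℕ
  | const c => c
  | size => x.n
  | cell a i => s.word a (i.eval x s)
  | add e f => e.eval x s + f.eval x s
  | sub e f => e.eval x s - f.eval x s
  | mul e f => e.eval x s * f.eval x s
  | div e f => e.eval x s / f.eval x s
  | mod e f => e.eval x s % f.eval x s

/-- The evaluation of a word expression is legal for the word bound `W`: all words that occur are
at most `W`, and there is no division by zero. -/
def WExp.Legal (x : Input) (W : ℕ) (s : Store) : WExp → Prop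
  | const c => c ≤ W
  | size => x.n ≤ W
  | cell a i => i.Legal x W s ∧ s.word a (i.eval x s) ≤ W
  | add e f => e.Legal x W s ∧ f.Legal x W s ∧ e.eval x s + f.eval x s ≤ W
  | sub e f => e.Legal x W s ∧ f.Legal x W s
  | mul e f => e.Legal x W s ∧ f.Legal x W s ∧ e.eval x s * f.eval x s ≤ W
  | div e f => e.Legal x W s ∧ f.Legal x W s ∧ f.eval x s ≠ 0
  | mod e f => e.Legal x W s ∧ f.Legal x W s ∧ f.eval x s ≠ 0

/-- The number of steps for the evaluation of a word expression. -/
def WExp.cost : WExp → ℕ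
  | const _ => 1
  | size => 1
  | cell _ i => i.cost + 1
  | add e f => e.cost + f.cost + 1
  | sub e f => e.cost + f.cost + 1
  | mul e f => e.cost + f.cost + 1
  | div e f => e.cost + f.cost + 1
  | mod e f => e.cost + f.cost + 1

/-- The value of a real expression. -/
noncomputable def RExp.eval (x : Input) (s : Store) : RExp → ℝ
  | cast e => (e.eval x s : ℝ)
  | entry i k => x.entry (i.eval x s) (k.eval x s)
  | bound => x.C
  | accuracy => x.ε
  | cell a i => s.real a (i.eval x s)
  | add e f => e.eval x s + f.eval x s
  | sub e f => e.eval x s - f.eval x s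
  | mul e f => e.eval x s * f.eval x s
  | div e f => e.eval x s / f.eval x s

/-- The evaluation of a real expression is legal for the word bound `W`. -/
def RExp.Legal (x : Input) (W : ℕ) (s : Store) : RExp → Prop
  | cast e => e.Legal x W s
  | entry i k => i.Legal x W s ∧ k.Legal x W s ∧ i.eval x s < x.n ∧ k.eval x s < x.n
  | bound => True
  | accuracy => True
  | cell _ i => i.Legal x W s
  | add e f => e.Legal x W s ∧ f.Legal x W s
  | sub e f => e.Legal x W s ∧ f.Legal x W s
  | mul e f => e.Legal x W s ∧ f.Legal x W s
  | div e f => e.Legal x W s ∧ f.Legal x W s ∧ f.eval x s ≠ 0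

/-- The number of steps for the evaluation of a real expression. -/
def RExp.cost : RExp → ℕ
  | cast e => e.cost + 1
  | entry i k => i.cost + k.cost + 1
  | bound => 1
  | accuracy => 1
  | cell _ i => i.cost + 1
  | add e f => e.cost + f.cost + 1
  | sub e f => e.cost + f.cost + 1
  | mul e f => e.cost + f.cost + 1
  | div e f => e.cost + f.cost + 1

/-- The test succeeds. -/
def Test.Holds (x : Input) (s : Store) : Test → Prop
  | wordLE e f => e.eval x s ≤ f.eval x s
  | realLE e f => e.eval x s ≤ f.eval x s
  | not b => ¬ b.Holds x s
  | and b c => b.Holds x s ∧ c.Holds x s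

/-- The evaluation of a test is legal for the word bound `W`. -/
def Test.Legal (x : Input) (W : ℕ) (s : Store) : Test → Prop
  | wordLE e f => e.Legal x W s ∧ f.Legal x W s
  | realLE e f => e.Legal x W s ∧ f.Legal x W s
  | not b => b.Legal x W s
  | and b c => b.Legal x W s ∧ c.Legal x W s

/-- The number of steps for the evaluation of a test. -/
def Test.cost : Test → ℕ
  | wordLE e f => e.cost + f.cost + 1
  | realLE e f => e.cost + f.cost + 1
  | not b => b.cost + 1
  | and b c => b.cost + c.cost + 1

/-- `Exec x W p s t s'`: on the input `x`, with word bound `W`, the program `p`, started with the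
memory `s`, halts after exactly `t` steps with the memory `s'`, and all of this is legal.  At most
one rule applies in each situation, so `t` and `s'` are determined by `x`, `p` and `s`. -/
inductive Exec (x : Input) (W : ℕ) : Prog → Store → ℕ → Store → Prop
  | skip (s : Store) : Exec x W .skip s 1 s
  | setWord (a : ℕ) (i e : WExp) (s : Store) (hi : i.Legal x W s) (he : e.Legal x W s) :
      Exec x W (.setWord a i e) s (i.cost + e.cost + 1) (s.setWord a (i.eval x s) (e.eval x s))
  | setReal (a : ℕ) (i : WExp) (e : RExp) (s : Store) (hi : i.Legal x W s) (he : e.Legal x W s) :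
      Exec x W (.setReal a i e) s (i.cost + e.cost + 1) (s.setReal a (i.eval x s) (e.eval x s))
  | seq {p q : Prog} {s s' s'' : Store} {t t' : ℕ}
      (hp : Exec x W p s t s') (hq : Exec x W q s' t' s'') :
      Exec x W (.seq p q) s (t + t') s''
  | iteTrue {b : Test} {p q : Prog} {s s' : Store} {t : ℕ}
      (hl : b.Legal x W s) (hb : b.Holds x s) (hp : Exec x W p s t s') :
      Exec x W (.ite b p q) s (b.cost + t) s'
  | iteFalse {b : Test} {p q : Prog} {s s' : Store} {t : ℕ}
      (hl : b.Legal x W s) (hb : ¬ b.Holds x s) (hq : Exec x W q s t s') :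
      Exec x W (.ite b p q) s (b.cost + t) s'
  | whileTrue {b : Test} {p : Prog} {s s' s'' : Store} {t t' : ℕ}
      (hl : b.Legal x W s) (hb : b.Holds x s) (hp : Exec x W p s t s')
      (hw : Exec x W (.while b p) s' t' s'') :
      Exec x W (.while b p) s (b.cost + t + t') s''
  | whileFalse {b : Test} {p : Prog} {s : Store}
      (hl : b.Legal x W s) (hb : ¬ b.Holds x s) :
      Exec x W (.while b p) s b.cost s

/-- Started with empty memory on the input `x`, the program `p` halts with the memory `s`, after at
most `B` steps and using only words (in particular, only addresses) that are at most `B`. -/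
def HaltsWithin (p : Prog) (x : Input) (B : ℝ) (s : Store) : Prop :=
  ∃ W t : ℕ, (W : ℝ) ≤ B ∧ (t : ℝ) ≤ B ∧ Exec x W p Store.init t s

/-- The output flag, found in the first cell of the word array `0`: the program claims that all
singular values are small. -/
def Store.Certifies (s : Store) : Prop := s.word 0 0 = 1

/-- The set of indices that is marked by ones in the first `n` cells of the word array `a`. -/
def Store.outputSet (s : Store) (a n : ℕ) : Finset (Fin n) :=
  Finset.univ.filter fun i => s.word a i = 1

end RealRAM

/-! ### Log-convex sequences and their ratios. -/

section LogConvex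

variable {μ : ℕ → ℝ}

/-! The rows of `A` are streamed into a sketch: `L` weighted vectors whose quadratic form `Q`
satisfies `Q y ≤ ‖A y‖² ≤ Q y + D ‖y‖²`. Every row insertion pays for its contribution to `D` with
trace: `L / 6 * D` is at most the trace lost, hence at most `C² n²` (`IsSketch.succ`). With `L ≥ 60
(C / ε)²` this gives `D ≤ ε² n² / 10`. As `L` depends only on `C / ε`, each row costs `O(n)` steps
up to a power of `C / ε`, and the total is quadratic in `n`.

To insert a row, `L + 1` vectors are compressed to `L` without exact eigenvectors. In each of `L`
rounds, an approximate top eigenvector `x` of the current operator `T` is found and the rank-one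
form `⟪T x, ·⟫² / ⟪x, T x⟫` is split off exactly (`weightedForm_deflate`). The remaining vectors are
orthogonal to `x`. Since `x` is nearly parallel to `T x`, the vectors `u = T x` of different rounds
are nearly orthogonal to each other and satisfy a Bessel inequality with constant 2
(`sum_sq_inner_le_two`). If `δ` is the last Rayleigh quotient, the residual form is at most `2 δ
‖y‖²`. Dropping it and lowering the size of every piece by `δ / 2` costs at most `3 δ ‖y‖²` in the
form, but at least `L δ / 2` in the trace (`Deflated.compress`).

Approximate eigenvectors come from power iteration, deterministically, with the sketch vectors
themselves as starting points. The moments `⟪y, T ^ q y⟫` are log-convex, so Rayleigh quotients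
increase along the iteration, and the largest one reached is within a factor 2 of the top
(`inner_weightedGram_le`). If no iterate in a window of length `L²` were aligned with its image, the
quotient would more than double there, which is impossible (`IsBest.inner_le`).

Finally a top vector `x` of the sketch is computed. A small Rayleigh quotient bounds `‖A y‖` for all
`y`. A large one gives a large `‖A x‖`, and the signs of `A Aᵀ A x`, and then of the column sums
over the chosen rows, give a large cut (`le_abs_sum_cut`).

Each program has a total correctness statement `Runs` with an explicit step bound; `runs_algorithm`
combines them. -/

theorem pos_of_sq_le_mul (h0 : 0 < μ 0) (h1 : 0 < μ 1)
    (hc : ∀ q, μ (q + 1) ^ 2 ≤ μ q * μ (q + 2)) (q : ℕ) : 0 < μ q := by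
  suffices h : 0 < μ q ∧ 0 < μ (q + 1) from h.1
  induction q with
  | zero => exact ⟨h0, h1⟩
  | succ q ih =>
    refine ⟨ih.2, ?_⟩
    have := hc q
    have h2 : 0 < μ q * μ (q + 2) := lt_of_lt_of_le (by have := ih.2; positivity) this
    exact (pos_iff_pos_of_mul_pos h2).1 ih.1

/-- For the moments of `y`, the ratio at `2 * s` is the Rayleigh quotient of the `s`-th iterate of
`y`, so this is the monotonicity of power iteration. -/
theorem ratio_monotone (h : ∀ q, 0 < μ q) (hc : ∀ q, μ (q + 1) ^ 2 ≤ μ q * μ (q + 2)) :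
    Monotone fun q => μ (q + 1) / μ q := by
  refine monotone_nat_of_le_succ fun q => ?_
  rw [div_le_div_iff₀ (h q) (h (q + 1))]
  have := hc q
  nlinarith

theorem le_mul_ratio_pow (h : ∀ q, 0 < μ q) (hc : ∀ q, μ (q + 1) ^ 2 ≤ μ q * μ (q + 2))
    (n : ℕ) {q : ℕ} (hq : q ≤ n) : μ q ≤ μ 0 * (μ (n + 1) / μ n) ^ q := by
  induction q with
  | zero => simp
  | succ q ih =>
    have h1 : μ (q + 1) / μ q ≤ μ (n + 1) / μ n := ratio_monotone h hc (by omega)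
    have h2 : μ (q + 1) ≤ μ (n + 1) / μ n * μ q := by
      rwa [div_le_iff₀ (h q)] at h1
    have hr : 0 ≤ μ (n + 1) / μ n := (div_pos (h _) (h _)).le
    calc μ (q + 1) ≤ μ (n + 1) / μ n * μ q := h2
      _ ≤ μ (n + 1) / μ n * (μ 0 * (μ (n + 1) / μ n) ^ q) :=
        mul_le_mul_of_nonneg_left (ih (by omega)) hr
      _ = _ := by ring

theorem mul_ratio_pow_le (h : ∀ q, 0 < μ q) (hc : ∀ q, μ (q + 1) ^ 2 ≤ μ q * μ (q + 2))
    (q : ℕ) : μ 0 * (μ 1 / μ 0) ^ q ≤ μ q := by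
  induction q with
  | zero => simp
  | succ q ih =>
    have h1 : μ 1 / μ 0 ≤ μ (q + 1) / μ q := ratio_monotone h hc (Nat.zero_le q)
    have h2 : μ 1 / μ 0 * μ q ≤ μ (q + 1) := by
      rwa [le_div_iff₀ (h q)] at h1
    have hr : 0 ≤ μ 1 / μ 0 := (div_pos (h _) (h _)).le
    calc μ 0 * (μ 1 / μ 0) ^ (q + 1) = μ 1 / μ 0 * (μ 0 * (μ 1 / μ 0) ^ q) := by ring
      _ ≤ μ 1 / μ 0 * μ q := mul_le_mul_of_nonneg_left ih hr
      _ ≤ _ := h2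

end LogConvex

/-! ### Weighted Gram operators and power iteration. -/

section Sketch

open Finset
open scoped InnerProductSpace

variable {E : Type*} [NormedAddCommGroup E] [InnerProductSpace ℝ E]

/-- The quadratic form `y ↦ ∑ k < m, c k * ⟪v k, y⟫ ^ 2`. -/
noncomputable def weightedForm (m : ℕ) (c : ℕ → ℝ) (v : ℕ → E) (y : E) : ℝ :=
  ∑ k ∈ range m, c k * ⟪v k, y⟫_ℝ ^ 2

/-- The trace of the quadratic form `weightedForm m c v`. -/
noncomputable def weightedTrace (m : ℕ) (c : ℕ → ℝ) (v : ℕ → E) : ℝ :=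
  ∑ k ∈ range m, c k * ⟪v k, v k⟫_ℝ

/-- The operator `y ↦ ∑ k < m, c k * ⟪v k, y⟫ • v k`. -/
noncomputable def weightedGram (m : ℕ) (c : ℕ → ℝ) (v : ℕ → E) : E →ₗ[ℝ] E :=
  ∑ k ∈ range m, c k • (innerₛₗ ℝ (v k)).smulRight (v k)

variable {m L : ℕ} {c : ℕ → ℝ} {v : ℕ → E}

theorem weightedGram_apply (y : E) :
    weightedGram m c v y = ∑ k ∈ range m, (c k * ⟪v k, y⟫_ℝ) • v k := by
  simp [weightedGram, smul_smul]

theorem inner_weightedGram (x y : E) :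
    ⟪x, weightedGram m c v y⟫_ℝ = ∑ k ∈ range m, c k * ⟪v k, x⟫_ℝ * ⟪v k, y⟫_ℝ := by
  rw [weightedGram_apply, inner_sum]
  refine sum_congr rfl fun k _ => ?_
  rw [inner_smul_right, real_inner_comm (v k) x]; ring

theorem inner_weightedGram_self (x : E) :
    ⟪x, weightedGram m c v x⟫_ℝ = weightedForm m c v x := by
  rw [inner_weightedGram]; exact sum_congr rfl fun k _ => by ring

theorem weightedGram_symm (x y : E) :
    ⟪weightedGram m c v x, y⟫_ℝ = ⟪x, weightedGram m c v y⟫_ℝ := by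
  rw [real_inner_comm, inner_weightedGram, inner_weightedGram]
  exact sum_congr rfl fun k _ => by ring

theorem weightedForm_nonneg (hc : ∀ k < m, 0 ≤ c k) (y : E) : 0 ≤ weightedForm m c v y :=
  sum_nonneg fun k hk => mul_nonneg (hc k (mem_range.1 hk)) (sq_nonneg _)

theorem weightedTrace_nonneg (hc : ∀ k < m, 0 ≤ c k) : 0 ≤ weightedTrace m c v :=
  sum_nonneg fun k hk => mul_nonneg (hc k (mem_range.1 hk)) real_inner_self_nonneg

theorem sq_inner_le_inner_mul_inner (x y : E) : ⟪x, y⟫_ℝ ^ 2 ≤ ⟪x, x⟫_ℝ * ⟪y, y⟫_ℝ := by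
  rw [sq]; exact real_inner_mul_inner_self_le x y

theorem sq_inner_weightedGram_le (hc : ∀ k < m, 0 ≤ c k) (x y : E) :
    ⟪x, weightedGram m c v y⟫_ℝ ^ 2 ≤
      ⟪x, weightedGram m c v x⟫_ℝ * ⟪y, weightedGram m c v y⟫_ℝ := by
  rw [inner_weightedGram, inner_weightedGram, inner_weightedGram]
  refine (sum_sq_le_sum_mul_sum_of_sq_le_mul (range m) ?_ ?_ ?_)
  · intro k hk; have := hc k (mem_range.1 hk); rw [mul_assoc]; exact mul_nonneg this (mul_self_nonneg _)
  · intro k hk; have := hc k (mem_range.1 hk); rw [mul_assoc]; exact mul_nonneg this (mul_self_nonneg _)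
  · intro k _; exact le_of_eq (by ring)

/-- The moments of a vector with respect to a weighted Gram operator. -/
noncomputable def moment (m : ℕ) (c : ℕ → ℝ) (v : ℕ → E) (y : E) (q : ℕ) : ℝ :=
  ⟪y, (weightedGram m c v ^ q) y⟫_ℝ

theorem inner_pow_pow (y z : E) (a b : ℕ) :
    ⟪(weightedGram m c v ^ a) y, (weightedGram m c v ^ b) z⟫_ℝ
      = ⟪y, (weightedGram m c v ^ (a + b)) z⟫_ℝ := by
  induction a generalizing b with
  | zero => simp
  | succ a ih =>
    rw [pow_succ' _ a, Module.End.mul_apply, weightedGram_symm, ← Module.End.mul_apply, ← pow_succ',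
      ih, show a + (b + 1) = a + 1 + b by omega]

theorem moment_even (y : E) (s : ℕ) : moment m c v y (2 * s) =
    ⟪(weightedGram m c v ^ s) y, (weightedGram m c v ^ s) y⟫_ℝ := by
  rw [inner_pow_pow, moment, two_mul]

theorem moment_odd (y : E) (s : ℕ) : moment m c v y (2 * s + 1) =
    ⟪(weightedGram m c v ^ s) y, weightedGram m c v ((weightedGram m c v ^ s) y)⟫_ℝ := by
  rw [← Module.End.mul_apply, ← pow_succ', inner_pow_pow, moment, two_mul, add_assoc]

/-- For even `q` this is Cauchy–Schwarz for the inner product, for odd `q` for the semidefinite form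
`⟪·, T ·⟫`. No spectral decomposition is needed. -/
theorem moment_sq_le (hc : ∀ k < m, 0 ≤ c k) (y : E) (q : ℕ) :
    moment m c v y (q + 1) ^ 2 ≤ moment m c v y q * moment m c v y (q + 2) := by
  obtain ⟨s, rfl | rfl⟩ := Nat.even_or_odd' q
  · rw [show 2 * s + 2 = 2 * (s + 1) by ring, moment_even, moment_even, moment_odd, pow_succ' _ s,
      Module.End.mul_apply]
    exact sq_inner_le_inner_mul_inner _ _
  · rw [show 2 * s + 1 + 2 = 2 * (s + 1) + 1 by ring, moment_odd, moment_odd]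
    have : moment m c v y (2 * s + 1 + 1) = ⟪(weightedGram m c v ^ s) y,
        weightedGram m c v ((weightedGram m c v ^ (s + 1)) y)⟫_ℝ := by
      rw [← Module.End.mul_apply, ← pow_succ', inner_pow_pow, moment]
      congr 3; ring
    rw [this]
    exact sq_inner_weightedGram_le hc _ _

theorem moment_pos (hc : ∀ k < m, 0 ≤ c k) {y : E} (hy : 0 < ⟪y, weightedGram m c v y⟫_ℝ) (q : ℕ) :
    0 < moment m c v y q := by
  refine pos_of_sq_le_mul ?_ ?_ (moment_sq_le hc y) q
  · have : y ≠ 0 := by rintro rfl; simp at hy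
    simp only [moment, pow_zero, Module.End.one_apply, real_inner_self_eq_norm_sq]
    positivity
  · simpa [moment] using hy

/-- If the Rayleigh quotients of the `s`-th iterates of all vectors `v k` are at most `r`, then all
Rayleigh quotients are at most `2 * r`. -/
theorem inner_weightedGram_le (hc : ∀ k < m, 0 ≤ c k) {s : ℕ} (hm : m ≤ 2 ^ (2 * s + 1)) {r : ℝ}
    (hr : 0 ≤ r)
    (h : ∀ k < m, moment m c v (v k) (2 * s + 1) ≤ r * moment m c v (v k) (2 * s)) (y : E) :
    ⟪y, weightedGram m c v y⟫_ℝ ≤ 2 * r * ⟪y, y⟫_ℝ := by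
  have hnn := weightedForm_nonneg (v := v) hc y
  rw [← inner_weightedGram_self] at hnn
  rcases hnn.eq_or_lt with h0 | hpos
  · rw [← h0]; have := real_inner_self_nonneg (x := y); positivity
  have hν := moment_pos (c := c) (v := v) hc hpos
  -- One summand of the form at `v k` already gives `c k * ⟪v k, v k⟫ ≤ μ 1 / μ 0`, hence at most
  -- `r`; log-convexity supplies the other `2 * s` factors `r`.
  have key : ∀ k ∈ range m, c k * moment m c v (v k) (2 * s) ≤ r ^ (2 * s + 1) := by
    intro k hk
    rw [mem_range] at hk
    have hform : c k * ⟪v k, v k⟫_ℝ ^ 2 ≤ ⟪v k, weightedGram m c v (v k)⟫_ℝ := by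
      rw [inner_weightedGram_self]
      exact single_le_sum (f := fun l => c l * ⟪v l, v k⟫_ℝ ^ 2)
        (fun l hl => mul_nonneg (hc l (mem_range.1 hl)) (sq_nonneg _)) (mem_range.2 hk)
    have hnn := weightedForm_nonneg (v := v) hc (v k)
    rw [← inner_weightedGram_self] at hnn
    rcases hnn.eq_or_lt with h0 | hk0
    · have h1 : c k * ⟪v k, v k⟫_ℝ ^ 2 = 0 :=
        le_antisymm (h0 ▸ hform) (mul_nonneg (hc k hk) (sq_nonneg _))
      rcases mul_eq_zero.1 h1 with h2 | h2
      · rw [h2, zero_mul]; positivity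
      · have : v k = 0 := by simpa using h2
        simp [this, moment]; positivity
    · have hμ := moment_pos (c := c) (v := v) hc hk0
      have hlc := moment_sq_le (v := v) hc (v k)
      set r' := moment m c v (v k) (2 * s + 1) / moment m c v (v k) (2 * s) with hr'
      have hr'r : r' ≤ r := by rw [hr', div_le_iff₀ (hμ _)]; exact h k hk
      have hr'0 : 0 ≤ r' := (div_pos (hμ _) (hμ _)).le
      have h1 := le_mul_ratio_pow hμ hlc (2 * s) le_rfl
      have h2 : c k * moment m c v (v k) 0 ≤ r' := by
        refine le_trans ?_ (ratio_monotone hμ hlc (Nat.zero_le (2 * s)))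
        simp only [zero_add]
        rw [le_div_iff₀ (hμ 0)]
        simp only [moment, pow_zero, Module.End.one_apply, pow_one]
        nlinarith
      calc c k * moment m c v (v k) (2 * s) ≤ c k * (moment m c v (v k) 0 * r' ^ (2 * s)) :=
            mul_le_mul_of_nonneg_left h1 (hc k hk)
        _ = c k * moment m c v (v k) 0 * r' ^ (2 * s) := by ring
        _ ≤ r' * r' ^ (2 * s) := mul_le_mul_of_nonneg_right h2 (by positivity)
        _ = r' ^ (2 * s + 1) := by ring
        _ ≤ r ^ (2 * s + 1) := pow_le_pow_left₀ hr'0 hr'r _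
  -- By symmetry the iterates of `y` become iterates of the `v k`, whose norms `key` controls.
  have h1 : moment m c v y (2 * s + 1) ≤ moment m c v y 0 * (m * r ^ (2 * s + 1)) := by
    rw [moment_odd, inner_weightedGram_self]
    calc weightedForm m c v ((weightedGram m c v ^ s) y)
        ≤ ∑ k ∈ range m, moment m c v y 0 * (c k * moment m c v (v k) (2 * s)) := by
          refine sum_le_sum fun k hk => ?_
          have e1 : ⟪v k, (weightedGram m c v ^ s) y⟫_ℝ = ⟪(weightedGram m c v ^ s) (v k), y⟫_ℝ := by
            have := inner_pow_pow (m := m) (c := c) (v := v) (v k) y s 0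
            simpa using this.symm
          rw [e1, moment_even]
          have e2 := sq_inner_le_inner_mul_inner ((weightedGram m c v ^ s) (v k)) y
          have e3 : moment m c v y 0 = ⟪y, y⟫_ℝ := by simp [moment]
          rw [e3]
          calc _ ≤ c k * _ := mul_le_mul_of_nonneg_left e2 (hc k (mem_range.1 hk))
            _ = _ := by ring
      _ ≤ ∑ k ∈ range m, moment m c v y 0 * r ^ (2 * s + 1) :=
          sum_le_sum fun k hk => mul_le_mul_of_nonneg_left (key k hk) (hν 0).le
      _ = _ := by simp; ring
  have h2 := mul_ratio_pow_le hν (moment_sq_le hc y) (2 * s + 1)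
  -- The number `m` of vectors costs only a factor 2 after taking the root of order `2 * s + 1`.
  have h3 : (moment m c v y 1 / moment m c v y 0) ^ (2 * s + 1) ≤ (2 * r) ^ (2 * s + 1) := by
    have h4 := le_of_mul_le_mul_left (h2.trans h1) (hν 0)
    refine h4.trans ?_
    rw [mul_pow]
    exact mul_le_mul_of_nonneg_right (by exact_mod_cast hm) (by positivity)
  have h5 := (pow_le_pow_iff_left₀ (div_pos (hν 1) (hν 0)).le (by positivity) (by omega)).1 h3
  rw [div_le_iff₀ (hν 0)] at h5
  simpa [moment] using h5

/-- `x` is an approximate eigenvector of `T`: the angle between `x` and `T x` is small. -/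
def Aligned (T : E →ₗ[ℝ] E) (L : ℕ) (x : E) : Prop :=
  (L : ℝ) ^ 2 * (⟪T x, T x⟫_ℝ * ⟪x, x⟫_ℝ) ≤ ((L : ℝ) ^ 2 + 1) * ⟪x, T x⟫_ℝ ^ 2

/-- The vector `x`, with Rayleigh quotient `num / den`, is an aligned vector whose Rayleigh quotient
is at least as large as that of any aligned vector among the iterates of the vectors `v k`. -/
structure IsBest (T : E →ₗ[ℝ] E) (v : ℕ → E) (L : ℕ) (x : E) (num den : ℝ) : Prop where
  cases : (x = 0 ∧ num = 0 ∧ den = 1) ∨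
    (0 < num ∧ num = ⟪x, T x⟫_ℝ ∧ den = ⟪x, x⟫_ℝ ∧ Aligned T L x)
  max : ∀ k < L + 1, ∀ s < 2 * L ^ 2, Aligned T L ((T ^ s) (v k)) →
    ⟪(T ^ s) (v k), T ((T ^ s) (v k))⟫_ℝ * den ≤ num * ⟪(T ^ s) (v k), (T ^ s) (v k)⟫_ℝ

theorem IsBest.num_nonneg {T : E →ₗ[ℝ] E} {x : E} {num den : ℝ} (h : IsBest T v L x num den) :
    0 ≤ num := by
  rcases h.cases with h | h
  · exact h.2.1.ge
  · exact h.1.le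

theorem IsBest.num_eq {T : E →ₗ[ℝ] E} {x : E} {num den : ℝ} (h : IsBest T v L x num den) :
    num = ⟪x, T x⟫_ℝ := by
  rcases h.cases with h | h
  · simp [h.1, h.2.1]
  · exact h.2.1

/-- The default value `den = 1` for the zero vector is what keeps the later division `num / den`
legal. -/
theorem IsBest.den_pos {T : E →ₗ[ℝ] E} {x : E} {num den : ℝ} (h : IsBest T v L x num den) :
    0 < den := by
  rcases h.cases with h | h
  · rw [h.2.2]; exact one_pos
  · rw [h.2.2.1]
    have : x ≠ 0 := by
      rintro rfl
      have := h.2.1 ▸ h.1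
      simp at this
    rw [real_inner_self_eq_norm_sq]
    positivity

theorem two_lt_pow_of_one_le (hL : 1 ≤ L) : (2 : ℝ) ≤ (1 + 1 / (L : ℝ) ^ 2) ^ (L ^ 2) := by
  have hL' : (0 : ℝ) < (L : ℝ) ^ 2 := by positivity
  have := one_add_mul_le_pow (a := 1 / (L : ℝ) ^ 2) (by have : 0 < 1 / (L : ℝ) ^ 2 := by positivity
                                                        linarith) (L ^ 2)
  refine le_trans (le_of_eq ?_) this
  push_cast
  field_simp
  norm_num

/-- Let `r` be the largest Rayleigh quotient after `L ^ 2` iterations; all Rayleigh quotients are at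
most `2 * r`. An iterate that is not aligned makes the next quotient larger by a factor above `1 + 1
/ L ^ 2`, so some iterate in the next `L ^ 2` steps is aligned. Its quotient is at least `r`, and
`num / den` is at least as large. -/
theorem IsBest.inner_le (hL : 1 ≤ L) (hc : ∀ k < L + 1, 0 ≤ c k) {x : E} {num den : ℝ}
    (h : IsBest (weightedGram (L + 1) c v) v L x num den) (y : E) :
    ⟪y, weightedGram (L + 1) c v y⟫_ℝ * den ≤ 2 * num * ⟪y, y⟫_ℝ := by
  set μ := fun k => moment (L + 1) c v (v k) with hμdef
  obtain ⟨i, hi, hmax⟩ := exists_max_image (range (L + 1))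
    (fun k => μ k (2 * L ^ 2 + 1) / μ k (2 * L ^ 2)) ⟨0, by simp⟩
  rw [mem_range] at hi
  set r := μ i (2 * L ^ 2 + 1) / μ i (2 * L ^ 2) with hrdef
  have hnn : ∀ z, 0 ≤ ⟪z, weightedGram (L + 1) c v z⟫_ℝ := fun z => by
    rw [inner_weightedGram_self]; exact weightedForm_nonneg hc z
  have hr0 : 0 ≤ r := by
    rw [hrdef, hμdef]; simp only [moment_odd, moment_even]
    exact div_nonneg (hnn _) real_inner_self_nonneg
  have hpow : L + 1 ≤ 2 ^ (2 * L ^ 2 + 1) := by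
    have h1 : L < 2 ^ L := Nat.lt_two_pow_self
    have h2 : 2 ^ L ≤ 2 ^ (2 * L ^ 2 + 1) := Nat.pow_le_pow_right (by norm_num) (by nlinarith)
    omega
  have hbound := inner_weightedGram_le (v := v) hc hpow hr0 (fun k hk => by
    have h1 := hmax k (mem_range.2 hk)
    rcases (hnn (v k)).eq_or_lt with h0 | hpos
    -- A vector on which the semidefinite form vanishes lies in the kernel, so its moments of
    -- positive order vanish.
    · have : weightedGram (L + 1) c v ((weightedGram (L + 1) c v ^ (L ^ 2)) (v k)) = 0 := by
        have e : weightedGram (L + 1) c v (v k) = 0 := by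
          have := sq_inner_weightedGram_le (v := v) hc (weightedGram (L + 1) c v (v k)) (v k)
          rw [← h0, mul_zero] at this
          have := pow_eq_zero_iff (two_ne_zero) |>.1 (le_antisymm this (sq_nonneg _))
          simpa using this
        rw [← Module.End.mul_apply, ← pow_succ', pow_succ, Module.End.mul_apply, e, map_zero]
      rw [moment_odd, this, inner_zero_right, moment_even]
      exact mul_nonneg hr0 real_inner_self_nonneg
    · have hp := moment_pos (v := v) hc hpos
      simp only [hμdef] at h1
      rwa [div_le_iff₀ (hp _)] at h1)
  have hy := hbound y
  have hyy := real_inner_self_nonneg (x := y)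
  have hden := h.den_pos
  have hnum := h.num_nonneg
  suffices hs : r * den ≤ num by
    calc _ ≤ 2 * r * ⟪y, y⟫_ℝ * den := mul_le_mul_of_nonneg_right hy hden.le
      _ = 2 * (r * den) * ⟪y, y⟫_ℝ := by ring
      _ ≤ _ := by gcongr
  rcases hr0.eq_or_lt with h0 | hrpos
  · rw [← h0, zero_mul]; exact hnum
  have hpos : 0 < ⟪v i, weightedGram (L + 1) c v (v i)⟫_ℝ := by
    refine (hnn _).lt_of_ne fun h0 => hrpos.ne' ?_
    have e : weightedGram (L + 1) c v (v i) = 0 := by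
      have := sq_inner_weightedGram_le (v := v) hc (weightedGram (L + 1) c v (v i)) (v i)
      rw [← h0, mul_zero] at this
      have := pow_eq_zero_iff (two_ne_zero) |>.1 (le_antisymm this (sq_nonneg _))
      simpa using this
    rw [hrdef, hμdef]
    simp only [moment, pow_succ, Module.End.mul_apply, e, map_zero, inner_zero_right, zero_div]
  have hp := moment_pos (v := v) hc hpos
  have hlc := moment_sq_le (v := v) hc (v i)
  have hmono := ratio_monotone hp hlc
  obtain ⟨s, hs1, hs2, hal⟩ : ∃ s, L ^ 2 ≤ s ∧ s < 2 * L ^ 2 ∧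
      Aligned (weightedGram (L + 1) c v) L ((weightedGram (L + 1) c v ^ s) (v i)) := by
    by_contra! hcon
    have hL' : (0 : ℝ) < (L : ℝ) ^ 2 := by positivity
    have hgrow : ∀ j ≤ L ^ 2, 1 ≤ j → r * (1 + 1 / (L : ℝ) ^ 2) ^ j <
        μ i (2 * (L ^ 2 + j) + 1) / μ i (2 * (L ^ 2 + j)) := by
      intro j
      have hstep : ∀ s, L ^ 2 ≤ s → s < 2 * L ^ 2 →
          μ i (2 * s + 1) / μ i (2 * s) * (1 + 1 / (L : ℝ) ^ 2) <
          μ i (2 * (s + 1) + 1) / μ i (2 * (s + 1)) := by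
        intro s hs1 hs2
        have hn := hcon s hs1 hs2
        rw [Aligned, not_le, ← moment_odd, ← moment_even, ← Module.End.mul_apply, ← pow_succ',
          ← moment_even] at hn
        -- Failure of alignment compares the ratios at `2 * s` and `2 * s + 1`; monotonicity passes
        -- on to `2 * s + 2`, the quotient of the next iterate.
        have h2 : μ i (2 * (s + 1)) / μ i (2 * s + 1) ≤ _ := hmono (show 2 * s + 1 ≤ 2 * (s + 1) by omega)
        refine lt_of_lt_of_le ?_ h2
        rw [show (1 : ℝ) + 1 / (L : ℝ) ^ 2 = ((L : ℝ) ^ 2 + 1) / (L : ℝ) ^ 2 by field_simp,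
          div_mul_div_comm, div_lt_div_iff₀ (mul_pos (hp _) hL') (hp _)]
        simp only [hμdef]
        nlinarith
      induction j with
      | zero => intro _ h; omega
      | succ j ih =>
        intro hj _
        have h1 := hstep (L ^ 2 + j) (by omega) (by omega)
        rcases Nat.eq_zero_or_pos j with rfl | hj0
        · simpa [hrdef] using h1
        · refine lt_trans ?_ h1
          rw [pow_succ, ← mul_assoc]
          exact mul_lt_mul_of_pos_right (ih (by omega) hj0) (by positivity)
    have h1 := hgrow (L ^ 2) le_rfl (Nat.one_le_pow _ _ hL)
    -- The last iterate of the window would have a quotient above `2 * r`.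
    have h2 := hbound ((weightedGram (L + 1) c v ^ (L ^ 2 + L ^ 2)) (v i))
    rw [← moment_odd, ← moment_even, ← div_le_iff₀ (hp _)] at h2
    have h3 := two_lt_pow_of_one_le hL
    nlinarith
  have h1 := h.max i hi s hs2 hal
  rw [← moment_odd, ← moment_even] at h1
  have h2 : r ≤ _ := hmono (show 2 * L ^ 2 ≤ 2 * s by omega)
  simp only at h2
  rw [le_div_iff₀ (hp _)] at h2
  have h3 := hp (2 * s)
  refine le_of_mul_le_mul_right ?_ h3
  calc r * den * moment (L + 1) c v (v i) (2 * s)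
      = (r * moment (L + 1) c v (v i) (2 * s)) * den := by ring
    _ ≤ _ * den := mul_le_mul_of_nonneg_right h2 hden.le
    _ ≤ _ := h1

end Sketch

/-! ### Deflation and compression of a sketch. -/

section Deflation

open Finset
open scoped InnerProductSpace

variable {E : Type*} [NormedAddCommGroup E] [InnerProductSpace ℝ E]
variable {m L : ℕ} {c : ℕ → ℝ} {v : ℕ → E}

/-- Only the component of `T x` orthogonal to `x` is seen by `z`, and alignment bounds its squared
length by `‖T x‖² / (L² + 1)`. -/
theorem Aligned.sq_inner_le {T : E →ₗ[ℝ] E} {x : E} (h : Aligned T L x) (hx : 0 < ⟪x, x⟫_ℝ)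
    {z : E} (hz : ⟪z, x⟫_ℝ = 0) : (L : ℝ) ^ 2 * ⟪T x, z⟫_ℝ ^ 2 ≤ ⟪T x, T x⟫_ℝ * ⟪z, z⟫_ℝ := by
  set u := T x
  set a := ⟪x, u⟫_ℝ / ⟪x, x⟫_ℝ with ha
  have hax : a * ⟪x, x⟫_ℝ = ⟪x, u⟫_ℝ := by rw [ha]; field_simp
  have h1 : ⟪u - a • x, z⟫_ℝ = ⟪u, z⟫_ℝ := by
    rw [inner_sub_left, real_inner_smul_left, real_inner_comm z x, hz]; ring
  have h2 : ⟪u - a • x, u - a • x⟫_ℝ = ⟪u, u⟫_ℝ - a * ⟪x, u⟫_ℝ := by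
    rw [inner_sub_left, inner_sub_right, inner_sub_right, real_inner_smul_left,
      real_inner_smul_left, real_inner_smul_right, real_inner_smul_right, real_inner_comm x u, hax]
    ring
  have h3 := sq_inner_le_inner_mul_inner (u - a • x) z
  rw [h1, h2] at h3
  have hzz : 0 ≤ ⟪z, z⟫_ℝ := real_inner_self_nonneg
  have huu : 0 ≤ ⟪u, u⟫_ℝ := real_inner_self_nonneg
  have h4 : (L : ℝ) ^ 2 * (⟪u, u⟫_ℝ - a * ⟪x, u⟫_ℝ) ≤ ⟪u, u⟫_ℝ := by
    rw [Aligned] at h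
    have h5 : (L : ℝ) ^ 2 * ⟪u, u⟫_ℝ ≤ ((L : ℝ) ^ 2 + 1) * (a * ⟪x, u⟫_ℝ) := by
      refine le_of_mul_le_mul_right ?_ hx
      calc _ = (L : ℝ) ^ 2 * (⟪u, u⟫_ℝ * ⟪x, x⟫_ℝ) := by ring
        _ ≤ ((L : ℝ) ^ 2 + 1) * ⟪x, u⟫_ℝ ^ 2 := h
        _ = _ := by rw [sq ⟪x, u⟫_ℝ]; nth_rewrite 1 [← hax]; ring
    have hL : (0 : ℝ) ≤ (L : ℝ) ^ 2 := by positivity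
    by_contra hcon
    push Not at hcon
    nlinarith
  calc _ ≤ (L : ℝ) ^ 2 * ((⟪u, u⟫_ℝ - a * ⟪x, u⟫_ℝ) * ⟪z, z⟫_ℝ) := by gcongr
    _ = (L : ℝ) ^ 2 * (⟪u, u⟫_ℝ - a * ⟪x, u⟫_ℝ) * ⟪z, z⟫_ℝ := by ring
    _ ≤ _ := by gcongr

/-- The cross terms sum to `-2 e ⟪u, y⟫²` and the squares to `e² ⟪x, u⟫ ⟪u, y⟫² = e ⟪u, y⟫²`. The
identity is exact for every `x`, so an inexact eigenvector causes no error here. If `⟪x, u⟫ = 0`,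
then `e = 0` by convention and nothing is split off. -/
theorem weightedForm_deflate {x u : E} (hu : u = weightedGram m c v x) {e : ℝ}
    (he : e = (⟪x, u⟫_ℝ)⁻¹) (y : E) :
    weightedForm m c (fun k => v k - (⟪v k, x⟫_ℝ * e) • u) y + e * ⟪u, y⟫_ℝ ^ 2 =
      weightedForm m c v y := by
  have h1 : ⟪x, u⟫_ℝ = ∑ k ∈ range m, c k * ⟪v k, x⟫_ℝ ^ 2 := by
    rw [hu, inner_weightedGram_self]; rfl
  have h2 : ⟪u, y⟫_ℝ = ∑ k ∈ range m, c k * ⟪v k, x⟫_ℝ * ⟪v k, y⟫_ℝ := by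
    rw [hu, weightedGram_symm, inner_weightedGram]
  have h3 : weightedForm m c (fun k => v k - (⟪v k, x⟫_ℝ * e) • u) y =
      weightedForm m c v y - 2 * e * ⟪u, y⟫_ℝ * ⟪u, y⟫_ℝ + e ^ 2 * ⟪u, y⟫_ℝ ^ 2 * ⟪x, u⟫_ℝ := by
    conv_rhs => rw [h1]; enter [1, 2, 2]; rw [h2]
    rw [weightedForm, weightedForm, mul_sum, mul_sum, ← sum_sub_distrib, ← sum_add_distrib]
    refine sum_congr rfl fun k _ => ?_
    rw [inner_sub_left, real_inner_smul_left]
    ring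
  rw [h3]
  by_cases h0 : ⟪x, u⟫_ℝ = 0
  · rw [he, h0]; simp
  · rw [he]; field_simp; ring

theorem weightedTrace_deflate {x u : E} (hu : u = weightedGram m c v x) {e : ℝ}
    (he : e = (⟪x, u⟫_ℝ)⁻¹) :
    weightedTrace m c (fun k => v k - (⟪v k, x⟫_ℝ * e) • u) + e * ⟪u, u⟫_ℝ =
      weightedTrace m c v := by
  have h1 : ⟪x, u⟫_ℝ = ∑ k ∈ range m, c k * ⟪v k, x⟫_ℝ ^ 2 := by
    rw [hu, inner_weightedGram_self]; rfl
  have h2 : ⟪u, u⟫_ℝ = ∑ k ∈ range m, c k * ⟪v k, x⟫_ℝ * ⟪v k, u⟫_ℝ := by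
    nth_rewrite 1 [hu]
    rw [weightedGram_symm, inner_weightedGram]
  have h3 : weightedTrace m c (fun k => v k - (⟪v k, x⟫_ℝ * e) • u) =
      weightedTrace m c v - 2 * e * ⟪u, u⟫_ℝ + e ^ 2 * ⟪u, u⟫_ℝ * ⟪x, u⟫_ℝ := by
    conv_rhs => rw [h1]; enter [1, 2, 2]; rw [h2]
    rw [weightedTrace, weightedTrace, mul_sum, mul_sum, ← sum_sub_distrib, ← sum_add_distrib]
    refine sum_congr rfl fun k _ => ?_
    rw [inner_sub_left, inner_sub_right, inner_sub_right, real_inner_smul_left,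
      real_inner_smul_left, real_inner_smul_right, real_inner_smul_right, real_inner_comm (v k) u]
    ring
  rw [h3]
  by_cases h0 : ⟪x, u⟫_ℝ = 0
  · rw [he, h0]; simp
  · rw [he]; field_simp; ring

/-- The state after `j` rounds of deflation: starting from the form with weights `c` and vectors
`v₀`, the pieces `e t * ⟪u t, ·⟫ ^ 2` have been split off and the vectors `v` are left. -/
structure Deflated (L : ℕ) (c : ℕ → ℝ) (v₀ : ℕ → E) (j : ℕ) (v u : ℕ → E) (e q : ℕ → ℝ) (δ : ℝ) :
    Prop where
  form (y : E) : weightedForm (L + 1) c v y + weightedForm j e u y = weightedForm (L + 1) c v₀ y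
  trace : weightedTrace (L + 1) c v + weightedTrace j e u = weightedTrace (L + 1) c v₀
  coeff_nonneg : ∀ t < j, 0 ≤ e t
  norm : ∀ t < j, e t = 0 ∨ (q t * ⟪u t, u t⟫_ℝ = 1 ∧ 0 < q t)
  orth : ∃ X : ℕ → E, ∀ t < j, (∀ k < L + 1, ⟪v k, X t⟫_ℝ = 0) ∧
    ∀ z, ⟪z, X t⟫_ℝ = 0 → (L : ℝ) ^ 2 * ⟪u t, z⟫_ℝ ^ 2 ≤ ⟪u t, u t⟫_ℝ * ⟪z, z⟫_ℝ
  near : ∀ t < j, ∀ i < t, (L : ℝ) ^ 2 * ⟪u i, u t⟫_ℝ ^ 2 ≤ ⟪u i, u i⟫_ℝ * ⟪u t, u t⟫_ℝ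
  small : ∀ t < j, ∀ y, weightedForm (L + 1) c v y ≤ 2 * (e t * ⟪u t, u t⟫_ℝ) * ⟪y, y⟫_ℝ
  level_nonneg : 0 < j → 0 ≤ δ
  level_le : ∀ t < j, δ ≤ 2 * (e t * ⟪u t, u t⟫_ℝ)
  small_level : 0 < j → ∀ y, weightedForm (L + 1) c v y ≤ 2 * δ * ⟪y, y⟫_ℝ

theorem Deflated.zero (L : ℕ) (c : ℕ → ℝ) (v₀ u : ℕ → E) (e q : ℕ → ℝ) (δ : ℝ) :
    Deflated L c v₀ 0 v₀ u e q δ where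
  form y := by simp [weightedForm]
  trace := by simp [weightedTrace]
  coeff_nonneg := by simp
  norm := by simp
  orth := ⟨fun _ => 0, by simp⟩
  near := by simp
  small := by simp
  level_nonneg := by simp
  level_le := by simp
  small_level := by simp

/-- The witnesses `X` are the approximate eigenvectors of the rounds. All remaining vectors are
orthogonal to them, hence so is every later `u`, and alignment makes it nearly orthogonal to the
earlier ones. The remaining form only decreases, so earlier upper bounds survive. -/
theorem Deflated.succ (hL : 1 ≤ L) (hc : ∀ k < L + 1, 0 ≤ c k) {v₀ u v' u' : ℕ → E}
    {e q e' q' : ℕ → ℝ} {δ δ' : ℝ} {j : ℕ} (h : Deflated L c v₀ j v u e q δ) {x : E} {num den : ℝ}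
    (hb : IsBest (weightedGram (L + 1) c v) v L x num den)
    (hu : ∀ t < j, u' t = u t) (hut : u' j = weightedGram (L + 1) c v x)
    (he : ∀ t < j, e' t = e t) (het : e' j = num⁻¹)
    (hq : ∀ t < j, q' t = q t) (hqt : q' j = (⟪u' j, u' j⟫_ℝ)⁻¹)
    (hδ : δ' = num / den) (hv : ∀ k < L + 1, v' k = v k - (⟪v k, x⟫_ℝ * e' j) • u' j) :
    Deflated L c v₀ (j + 1) v' u' e' q' δ' := by
  have hnum := hb.num_eq
  have hnn := hb.num_nonneg
  have hden := hb.den_pos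
  have hej : e' j = (⟪x, u' j⟫_ℝ)⁻¹ := by rw [het, hnum, hut]
  have hform : ∀ y, weightedForm (L + 1) c v' y + e' j * ⟪u' j, y⟫_ℝ ^ 2 =
      weightedForm (L + 1) c v y := fun y => by
    rw [← weightedForm_deflate hut hej y]
    congr 1
    exact sum_congr rfl fun k hk => by rw [hv k (mem_range.1 hk)]
  have htrace : weightedTrace (L + 1) c v' + e' j * ⟪u' j, u' j⟫_ℝ = weightedTrace (L + 1) c v := by
    rw [← weightedTrace_deflate hut hej]
    congr 1
    exact sum_congr rfl fun k hk => by rw [hv k (mem_range.1 hk)]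
  have he0 : 0 ≤ e' j := by rw [het]; positivity
  have hmono : ∀ y, weightedForm (L + 1) c v' y ≤ weightedForm (L + 1) c v y := fun y => by
    rw [← hform y]; have := mul_nonneg he0 (sq_nonneg ⟪u' j, y⟫_ℝ); linarith
  have hform' : ∀ y, weightedForm j e' u' y = weightedForm j e u y := fun y =>
    sum_congr rfl fun t ht => by rw [hu t (mem_range.1 ht), he t (mem_range.1 ht)]
  have htrace' : weightedTrace j e' u' = weightedTrace j e u :=
    sum_congr rfl fun t ht => by rw [hu t (mem_range.1 ht), he t (mem_range.1 ht)]
  have hu0 : num = 0 → u' j = 0 := fun h0 => by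
    rcases hb.cases with h1 | h1
    · rw [hut, h1.1, map_zero]
    · exact absurd h0 h1.1.ne'
  have hbest := hb.inner_le hL hc
  have hδ2 : ∀ y, weightedForm (L + 1) c v y ≤ 2 * δ' * ⟪y, y⟫_ℝ := fun y => by
    have := hbest y
    rw [inner_weightedGram_self] at this
    rw [hδ]
    have e1 : 2 * (num / den) * ⟪y, y⟫_ℝ = 2 * num * ⟪y, y⟫_ℝ / den := by ring
    rw [e1, le_div_iff₀ hden]; exact this
  -- By Cauchy–Schwarz, the Rayleigh quotient of `x` is at most `‖T x‖² / ⟪x, T x⟫`, the trace of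
  -- the new piece.
  have hcs : δ' ≤ e' j * ⟪u' j, u' j⟫_ℝ := by
    rcases hb.cases with h1 | h1
    · rw [hδ, h1.2.1, zero_div]; exact mul_nonneg he0 real_inner_self_nonneg
    · have h2 := sq_inner_le_inner_mul_inner x (u' j)
      have h3 : ⟪x, u' j⟫_ℝ = num := by rw [hnum, hut]
      rw [h3, ← h1.2.2.1] at h2
      have h4 := h1.1
      rw [hδ, het, div_le_iff₀ hden, inv_mul_eq_div, div_mul_eq_mul_div, le_div_iff₀ h4]
      nlinarith
  have hδ0 : 0 ≤ δ' := by rw [hδ]; positivity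
  obtain ⟨X, hX⟩ := h.orth
  have horthu : ∀ t < j, ⟪u' j, X t⟫_ℝ = 0 := fun t ht => by
    rw [hut, weightedGram_symm, inner_weightedGram]
    refine sum_eq_zero fun k hk => ?_
    rw [(hX t ht).1 k (mem_range.1 hk), mul_zero]
  have hlast : ∀ y, weightedForm (L + 1) c v' y ≤ 2 * (e' j * ⟪u' j, u' j⟫_ℝ) * ⟪y, y⟫_ℝ := fun y =>
    ((hmono y).trans (hδ2 y)).trans (by
      have := real_inner_self_nonneg (x := y); gcongr)
  refine ⟨fun y => ?_, ?_, fun t ht => ?_, fun t ht => ?_, ?_, fun t ht => ?_, fun t ht y => ?_,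
    fun _ => hδ0, fun t ht => ?_, fun _ y => (hmono y).trans (hδ2 y)⟩
  · rw [weightedForm, weightedForm, sum_range_succ (n := j)]
    have := h.form y
    have h1 := hform y
    have h2 := hform' y
    simp only [weightedForm] at this h1 h2 ⊢
    linarith
  · have := h.trace
    have h1 := htrace
    have h2 := htrace'
    have h3 : weightedTrace (j + 1) e' u' = weightedTrace j e' u' + e' j * ⟪u' j, u' j⟫_ℝ :=
      sum_range_succ _ _
    linarith
  · rcases Nat.lt_succ_iff_lt_or_eq.1 ht with ht | rfl
    · rw [he t ht]; exact h.coeff_nonneg t ht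
    · exact he0
  · rcases Nat.lt_succ_iff_lt_or_eq.1 ht with ht | rfl
    · rw [he t ht, hq t ht, hu t ht]; exact h.norm t ht
    · rcases hnn.eq_or_lt with h0 | h0
      · left; rw [het, ← h0, inv_zero]
      · right
        have : 0 < ⟪u' t, u' t⟫_ℝ := by
          rw [real_inner_self_eq_norm_sq]
          have : u' t ≠ 0 := by
            intro h3
            rw [hnum, ← hut, h3, inner_zero_right] at h0
            exact lt_irrefl _ h0
          positivity
        rw [hqt]
        exact ⟨inv_mul_cancel₀ this.ne', inv_pos.2 this⟩
  · refine ⟨fun t => if t = j then x else X t, fun t ht => ?_⟩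
    rcases Nat.lt_succ_iff_lt_or_eq.1 ht with ht | rfl
    · simp only [ht.ne, if_false]
      refine ⟨fun k hk => ?_, ?_⟩
      · rw [hv k hk, inner_sub_left, real_inner_smul_left, (hX t ht).1 k hk, horthu t ht]; ring
      · rw [hu t ht]; exact (hX t ht).2
    · simp only [if_true]
      rcases hb.cases with h1 | h1
      · refine ⟨fun k hk => by rw [h1.1, inner_zero_right], fun z _ => ?_⟩
        rw [hu0 h1.2.1]; simp
      · have hx0 : 0 < ⟪x, x⟫_ℝ := h1.2.2.1 ▸ hden
        refine ⟨fun k hk => ?_, fun z hz => ?_⟩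
        · have h3 : ⟪u' t, x⟫_ℝ = num := by rw [hnum, hut, real_inner_comm]
          rw [hv k hk, inner_sub_left, real_inner_smul_left, h3, het, mul_assoc,
            inv_mul_cancel₀ h1.1.ne']; ring
        · rw [hut]; exact h1.2.2.2.sq_inner_le hx0 hz
  · rcases Nat.lt_succ_iff_lt_or_eq.1 ht with ht | rfl
    · intro i hi
      rw [hu t ht, hu i (hi.trans ht)]; exact h.near t ht i hi
    · intro i hi
      rw [hu i hi]
      exact (hX i hi).2 _ (horthu i hi)
  · rcases Nat.lt_succ_iff_lt_or_eq.1 ht with ht | rfl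
    · rw [he t ht, hu t ht]; exact (hmono y).trans (h.small t ht y)
    · exact hlast y
  · rcases Nat.lt_succ_iff_lt_or_eq.1 ht with ht | rfl
    · rw [he t ht, hu t ht]
      -- The new level is a Rayleigh quotient of the remaining form, which `small` bounds by twice
      -- the size of each earlier piece.
      have h1 := h.small t ht x
      rw [← inner_weightedGram_self, ← hnum] at h1
      rcases hb.cases with h2 | h2
      · rw [hδ, h2.2.1, zero_div]
        exact mul_nonneg zero_le_two (mul_nonneg (h.coeff_nonneg t ht) real_inner_self_nonneg)
      · rw [hδ, div_le_iff₀ hden, h2.2.2.1]; exact h1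
    · have := mul_nonneg he0 (real_inner_self_nonneg (x := u' t))
      linarith

/-- A Bessel type inequality for nearly orthogonal vectors. -/
theorem sum_sq_inner_le_two (hL : 1 ≤ L) {u : ℕ → E} {q : ℕ → ℝ} (hq0 : ∀ t < L, 0 ≤ q t)
    (hq : ∀ t < L, q t * ⟪u t, u t⟫_ℝ = 1)
    (hn : ∀ t < L, ∀ i < t, (L : ℝ) ^ 2 * ⟪u i, u t⟫_ℝ ^ 2 ≤ ⟪u i, u i⟫_ℝ * ⟪u t, u t⟫_ℝ) (y : E) :
    weightedForm L q u y ≤ 2 * ⟪y, y⟫_ℝ := by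
  set S := weightedGram L q u y with hS
  set Z := weightedForm L q u y with hZ
  have hZ0 : 0 ≤ Z := weightedForm_nonneg hq0 y
  have hLpos : (0 : ℝ) < L := by exact_mod_cast hL
  have hn' : ∀ i < L, ∀ t < L, i ≠ t →
      (L : ℝ) ^ 2 * ⟪u i, u t⟫_ℝ ^ 2 ≤ ⟪u i, u i⟫_ℝ * ⟪u t, u t⟫_ℝ := by
    intro i hi t ht hit
    rcases lt_or_gt_of_ne hit with h | h
    · exact hn t ht i h
    · rw [real_inner_comm, mul_comm ⟪u i, u i⟫_ℝ]; exact hn i hi t h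
  set z := fun t => q t * ⟪u t, y⟫_ℝ ^ 2 with hz
  have hz0 : ∀ t < L, 0 ≤ z t := fun t ht => mul_nonneg (hq0 t ht) (sq_nonneg _)
  -- After normalization the off-diagonal Gram entries are at most `1 / L` in absolute value. By the
  -- AM-GM inequality they contribute at most `Z` in total, like the diagonal.
  have hpair : ∀ i ∈ range L, ∀ t ∈ range L,
      (q i * ⟪u i, y⟫_ℝ) * ((q t * ⟪u t, y⟫_ℝ) * ⟪u i, u t⟫_ℝ) ≤
        (if i = t then z i else 0) + (z i + z t) / (2 * L) := by
    intro i hi t ht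
    rw [mem_range] at hi ht
    have hzi := hz0 i hi
    have hzt := hz0 t ht
    by_cases hit : i = t
    · subst hit
      rw [if_pos rfl]
      have h1 : (q i * ⟪u i, y⟫_ℝ) * ((q i * ⟪u i, y⟫_ℝ) * ⟪u i, u i⟫_ℝ) = z i := by
        calc _ = (q i * ⟪u i, y⟫_ℝ ^ 2) * (q i * ⟪u i, u i⟫_ℝ) := by ring
          _ = _ := by rw [hq i hi, mul_one]
      rw [h1]
      have : 0 ≤ (z i + z i) / (2 * L) := by positivity
      linarith
    · rw [if_neg hit, zero_add, le_div_iff₀ (by positivity)]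
      have h1 := hn' i hi t ht hit
      have h2 : ((q i * ⟪u i, y⟫_ℝ) * ((q t * ⟪u t, y⟫_ℝ) * ⟪u i, u t⟫_ℝ) * L) ^ 2 ≤ z i * z t := by
        calc _ = (q i * ⟪u i, y⟫_ℝ * (q t * ⟪u t, y⟫_ℝ)) ^ 2 * ((L : ℝ) ^ 2 * ⟪u i, u t⟫_ℝ ^ 2) := by
              ring
          _ ≤ (q i * ⟪u i, y⟫_ℝ * (q t * ⟪u t, y⟫_ℝ)) ^ 2 * (⟪u i, u i⟫_ℝ * ⟪u t, u t⟫_ℝ) := by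
              gcongr
          _ = z i * z t * (q i * ⟪u i, u i⟫_ℝ) * (q t * ⟪u t, u t⟫_ℝ) := by simp only [hz]; ring
          _ = _ := by rw [hq i hi, hq t ht]; ring
      have h3 : (2 * ((q i * ⟪u i, y⟫_ℝ) * ((q t * ⟪u t, y⟫_ℝ) * ⟪u i, u t⟫_ℝ) * L)) ^ 2
          ≤ (z i + z t) ^ 2 := by nlinarith [sq_nonneg (z i - z t)]
      have := abs_le_of_sq_le_sq h3 (by positivity)
      linarith [le_abs_self (2 * ((q i * ⟪u i, y⟫_ℝ) * ((q t * ⟪u t, y⟫_ℝ) * ⟪u i, u t⟫_ℝ) * L))]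
  have h1 : ⟪S, S⟫_ℝ ≤ 2 * Z := by
    calc ⟪S, S⟫_ℝ = ∑ i ∈ range L, ∑ t ∈ range L,
          (q i * ⟪u i, y⟫_ℝ) * ((q t * ⟪u t, y⟫_ℝ) * ⟪u i, u t⟫_ℝ) := by
          rw [hS, weightedGram_apply, sum_inner]
          refine sum_congr rfl fun i _ => ?_
          rw [inner_sum]
          refine sum_congr rfl fun t _ => ?_
          rw [real_inner_smul_left, real_inner_smul_right]
      _ ≤ ∑ i ∈ range L, ∑ t ∈ range L, ((if i = t then z i else 0) + (z i + z t) / (2 * L)) :=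
          sum_le_sum fun i hi => sum_le_sum fun t ht => hpair i hi t ht
      _ = 2 * Z := by
          have e0 : Z = ∑ i ∈ range L, z i := rfl
          have e1 : ∑ i ∈ range L, ∑ t ∈ range L, (if i = t then z i else 0) = Z := by
            rw [e0]
            refine sum_congr rfl fun i hi => ?_
            rw [sum_ite_eq, if_pos hi]
          have e2 : ∑ i ∈ range L, ∑ t ∈ range L, (z i + z t) / (2 * (L : ℝ)) = Z := by
            simp only [add_div, sum_add_distrib, sum_const, card_range, nsmul_eq_mul, ← sum_div,
              ← mul_sum, ← e0]
            field_simp; norm_num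
          simp only [sum_add_distrib] at e2 ⊢
          rw [e1, e2]; ring
  have h2 : ⟪S, y⟫_ℝ = Z := by
    rw [hS, real_inner_comm, inner_weightedGram_self]
  -- From `Z = ⟪S, y⟫` and `‖S‖² ≤ 2 Z` follows `Z² ≤ 2 Z ‖y‖²`.
  have h3 := sq_inner_le_inner_mul_inner S y
  rw [h2] at h3
  have hy : 0 ≤ ⟪y, y⟫_ℝ := real_inner_self_nonneg
  rcases hZ0.eq_or_lt with h0 | h0
  · rw [← h0]; positivity
  · nlinarith

/-- Since `q t` is the inverse squared norm of `u t`, each weight correction lowers the trace by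
exactly `δ / 2`, and `level_le` keeps the weights nonnegative. In the form, the corrections cost at
most `δ` by the Bessel inequality and the discarded residual at most `2 * δ`. -/
theorem Deflated.compress (hL : 1 ≤ L) (hc : ∀ k < L + 1, 0 ≤ c k) {v₀ u : ℕ → E}
    {e q : ℕ → ℝ} {δ : ℝ} (h : Deflated L c v₀ L v u e q δ) :
    (∀ t < L, 0 ≤ e t - δ / 2 * q t) ∧ 0 ≤ δ ∧
    (∀ y, weightedForm L (fun t => e t - δ / 2 * q t) u y ≤ weightedForm (L + 1) c v₀ y) ∧
    (∀ y, weightedForm (L + 1) c v₀ y ≤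
      weightedForm L (fun t => e t - δ / 2 * q t) u y + 3 * δ * ⟪y, y⟫_ℝ) ∧
    weightedTrace L (fun t => e t - δ / 2 * q t) u + L * (δ / 2) ≤ weightedTrace (L + 1) c v₀ := by
  have hδ0 := h.level_nonneg hL
  have hsub : ∀ y, weightedForm L (fun t => e t - δ / 2 * q t) u y =
      weightedForm L e u y - δ / 2 * weightedForm L q u y := fun y => by
    rw [weightedForm, weightedForm, weightedForm, mul_sum, ← sum_sub_distrib]
    exact sum_congr rfl fun k _ => by ring
  have hsubt : weightedTrace L (fun t => e t - δ / 2 * q t) u =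
      weightedTrace L e u - δ / 2 * weightedTrace L q u := by
    rw [weightedTrace, weightedTrace, weightedTrace, mul_sum, ← sum_sub_distrib]
    exact sum_congr rfl fun k _ => by ring
  have hpos := fun y => weightedForm_nonneg (v := v) hc y
  have htr := weightedTrace_nonneg (v := v) hc
  have hsmall := h.small_level hL
  have hform := h.form
  have htrace := h.trace
  rcases hδ0.eq_or_lt with h0 | h0
  -- For `δ = 0` some pieces may be zero, so that `norm` says nothing about them; but then the
  -- correction is zero and the residual form vanishes.
  · subst h0
    simp only [hsub, hsubt]
    simp only [zero_div, zero_mul, sub_zero, mul_zero, add_zero]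
    refine ⟨h.coeff_nonneg, le_rfl, fun y => ?_, fun y => ?_, ?_⟩
    · linarith [hform y, hpos y]
    · have := hsmall y; simp only [mul_zero, zero_mul] at this; linarith [hform y]
    · linarith
  · have hne : ∀ t < L, e t ≠ 0 := fun t ht h1 => by
      have := h.level_le t ht; rw [h1] at this; linarith
    have hq : ∀ t < L, q t * ⟪u t, u t⟫_ℝ = 1 ∧ 0 < q t := fun t ht =>
      (h.norm t ht).resolve_left (hne t ht)
    have hB := sum_sq_inner_le_two hL (fun t ht => (hq t ht).2.le) (fun t ht => (hq t ht).1) h.near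
    have hqpos := fun y => weightedForm_nonneg (v := u) (fun t ht => (hq t ht).2.le) y
    have hqt : weightedTrace L q u = L := by
      rw [weightedTrace, sum_congr rfl fun t ht => (hq t (mem_range.1 ht)).1]; simp
    refine ⟨fun t ht => ?_, hδ0, fun y => ?_, fun y => ?_, ?_⟩
    · have h1 := h.level_le t ht
      have h2 := (hq t ht).1
      have h3 := (hq t ht).2
      have : δ * q t ≤ 2 * e t := by
        calc δ * q t ≤ 2 * (e t * ⟪u t, u t⟫_ℝ) * q t := by gcongr
          _ = 2 * e t * (q t * ⟪u t, u t⟫_ℝ) := by ring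
          _ = _ := by rw [h2, mul_one]
      linarith
    · rw [hsub]
      have := mul_nonneg (half_pos h0).le (hqpos y)
      linarith [hform y, hpos y]
    · rw [hsub]
      have := mul_le_mul_of_nonneg_left (hB y) (half_pos h0).le
      linarith [hform y, hsmall y]
    · rw [hsubt, hqt]
      linarith

/-- The weighted vectors `(w k, v k)`, `k < L`, are a sketch of the first `i` of the vectors `a`. -/
structure IsSketch (L : ℕ) (a : ℕ → E) (i : ℕ) (w : ℕ → ℝ) (v : ℕ → E) : Prop where
  weight_nonneg : ∀ k < L, 0 ≤ w k
  form_le (y : E) : weightedForm L w v y ≤ weightedForm i 1 a y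
  exists_loss : ∃ D : ℝ, 0 ≤ D ∧ (∀ y, weightedForm i 1 a y ≤ weightedForm L w v y + D * ⟪y, y⟫_ℝ) ∧
    weightedTrace L w v + L / 6 * D ≤ weightedTrace i 1 a

theorem IsSketch.zero (L : ℕ) (a v : ℕ → E) {w : ℕ → ℝ} (hw : ∀ k < L, w k = 0) :
    IsSketch L a 0 w v := by
  have h1 : ∀ y, weightedForm L w v y = 0 := fun y =>
    sum_eq_zero fun k hk => by rw [hw k (mem_range.1 hk), zero_mul]
  have h2 : weightedTrace L w v = 0 :=
    sum_eq_zero fun k hk => by rw [hw k (mem_range.1 hk), zero_mul]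
  refine ⟨fun k hk => (hw k hk).ge, fun y => ?_, 0, le_rfl, fun y => ?_, ?_⟩
  · rw [h1]; simp [weightedForm]
  · rw [h1]; simp [weightedForm]
  · rw [h2]; simp [weightedTrace]

/-- The loss grows by `3 * δ` while the trace drops by at least `L * (δ / 2) = L / 6 * (3 * δ)`,
whence the factor `L / 6` in the invariant. -/
theorem IsSketch.succ (hL : 1 ≤ L) {a : ℕ → E} {i : ℕ} {w w₀ w' e q : ℕ → ℝ}
    {v v₀ v₁ u v' : ℕ → E} {δ : ℝ}
    (h : IsSketch L a i w v) (hw : ∀ k < L, w₀ k = w k) (hwL : w₀ L = 1)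
    (hv : ∀ k < L, v₀ k = v k) (hvL : v₀ L = a i)
    (hd : Deflated L w₀ v₀ L v₁ u e q δ)
    (hw' : ∀ k < L, w' k = e k - δ / 2 * q k) (hv' : ∀ k < L, v' k = u k) :
    IsSketch L a (i + 1) w' v' := by
  have hw0 : ∀ k < L + 1, 0 ≤ w₀ k := fun k hk => by
    rcases Nat.lt_succ_iff_lt_or_eq.1 hk with hk | rfl
    · rw [hw k hk]; exact h.weight_nonneg k hk
    · rw [hwL]; exact zero_le_one
  obtain ⟨h1, hδ, h2, h3, h4⟩ := hd.compress hL hw0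
  have f1 : ∀ y, weightedForm L w' v' y = weightedForm L (fun t => e t - δ / 2 * q t) u y := fun y =>
    sum_congr rfl fun k hk => by rw [hw' k (mem_range.1 hk), hv' k (mem_range.1 hk)]
  have f2 : weightedTrace L w' v' = weightedTrace L (fun t => e t - δ / 2 * q t) u :=
    sum_congr rfl fun k hk => by rw [hw' k (mem_range.1 hk), hv' k (mem_range.1 hk)]
  have f3 : ∀ y, weightedForm (L + 1) w₀ v₀ y = weightedForm L w v y + ⟪a i, y⟫_ℝ ^ 2 := fun y => by
    rw [weightedForm, sum_range_succ, hwL, hvL, one_mul]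
    congr 1
    exact sum_congr rfl fun k hk => by rw [hw k (mem_range.1 hk), hv k (mem_range.1 hk)]
  have f4 : weightedTrace (L + 1) w₀ v₀ = weightedTrace L w v + ⟪a i, a i⟫_ℝ := by
    rw [weightedTrace, sum_range_succ, hwL, hvL, one_mul]
    congr 1
    exact sum_congr rfl fun k hk => by rw [hw k (mem_range.1 hk), hv k (mem_range.1 hk)]
  have f5 : ∀ y, weightedForm (i + 1) 1 a y = weightedForm i 1 a y + ⟪a i, y⟫_ℝ ^ 2 := fun y => by
    rw [weightedForm, sum_range_succ, Pi.one_apply, one_mul]; rfl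
  have f6 : weightedTrace (i + 1) 1 a = weightedTrace i 1 a + ⟪a i, a i⟫_ℝ := by
    rw [weightedTrace, sum_range_succ, Pi.one_apply, one_mul]; rfl
  obtain ⟨D, hD, h5, h6⟩ := h.exists_loss
  refine ⟨fun k hk => (hw' k hk) ▸ h1 k hk, fun y => ?_, D + 3 * δ, by positivity, fun y => ?_, ?_⟩
  · rw [f1, f5]
    linarith [h2 y, f3 y, h.form_le y]
  · rw [f1, f5]
    linarith [h3 y, f3 y, h5 y]
  · rw [f2, f6]
    linarith

end Deflation

/-! ### Singular values and norm bounds. -/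

section SingularValues

open Finset
open scoped InnerProductSpace

variable {E F : Type*} [NormedAddCommGroup E] [InnerProductSpace ℝ E] [FiniteDimensional ℝ E]
  [NormedAddCommGroup F] [InnerProductSpace ℝ F] [FiniteDimensional ℝ F]

theorem LinearMap.singularValues_le_of_forall_norm_sq_le (T : E →ₗ[ℝ] F) {b : ℝ} (hb : 0 ≤ b)
    (h : ∀ y, ‖T y‖ ^ 2 ≤ b ^ 2 * ‖y‖ ^ 2) (j : ℕ) : T.singularValues j ≤ b := by
  rcases lt_or_ge j (Module.finrank ℝ E) with hj | hj
  · obtain ⟨v, hv⟩ := (T.hasEigenvalue_adjoint_comp_self_sq_singularValues hj).exists_hasEigenvector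
    have h1 : ‖T v‖ ^ 2 = T.singularValues j ^ 2 * ‖v‖ ^ 2 := by
      rw [← real_inner_self_eq_norm_sq, ← LinearMap.adjoint_inner_left]
      have := hv.apply_eq_smul
      rw [LinearMap.comp_apply] at this
      rw [this, real_inner_smul_left, real_inner_self_eq_norm_sq]
      rfl
    have h2 : 0 < ‖v‖ ^ 2 := by have := norm_pos_iff.2 hv.2; positivity
    have h3 := h v
    rw [h1] at h3
    exact le_of_sq_le_sq (le_of_mul_le_mul_right h3 h2) hb
  · rw [T.singularValues_of_finrank_le hj]; exact hb

/-- Expand `y` in an eigenbasis of `T* T`: the coefficients of `‖T y‖²` are squared singular values,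
none above that of index `0`. -/
theorem LinearMap.norm_sq_le_singularValues_zero (T : E →ₗ[ℝ] F) (y : E) :
    ‖T y‖ ^ 2 ≤ T.singularValues 0 ^ 2 * ‖y‖ ^ 2 := by
  set hS := T.isSymmetric_adjoint_comp_self
  set b := hS.eigenvectorBasis rfl
  have h1 : ‖T y‖ ^ 2 = ∑ i, hS.eigenvalues rfl i * ⟪b i, y⟫_ℝ ^ 2 := by
    rw [← real_inner_self_eq_norm_sq, ← LinearMap.adjoint_inner_left, ← LinearMap.comp_apply,
      ← b.sum_inner_mul_inner]
    refine sum_congr rfl fun i _ => ?_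
    have h2 := hS.eigenvectorBasis_apply_self_apply rfl y i
    rw [b.repr_apply_apply, b.repr_apply_apply] at h2
    rw [real_inner_comm, h2]
    simp only [RCLike.ofReal_real_eq_id, _root_.id]
    ring
  have h2 : ‖y‖ ^ 2 = ∑ i, ⟪b i, y⟫_ℝ ^ 2 := by
    rw [← real_inner_self_eq_norm_sq, ← b.sum_inner_mul_inner]
    exact sum_congr rfl fun i _ => by rw [real_inner_comm, sq]
  rw [h1, h2, mul_sum]
  refine sum_le_sum fun i _ => mul_le_mul_of_nonneg_right ?_ (sq_nonneg _)
  rw [← T.sq_singularValues_fin rfl i]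
  exact pow_le_pow_left₀ (T.singularValues_nonneg _) (T.singularValues_antitone (Nat.zero_le _)) 2

end SingularValues

/-! ### From a vector with large image to a large cut. -/

section Cut

open Finset

variable {n : ℕ} {A : Matrix (Fin n) (Fin n) ℝ}

theorem norm_toEuclideanLin_sq (A : Matrix (Fin n) (Fin n) ℝ) (y : EuclideanSpace ℝ (Fin n)) :
    ‖Matrix.toEuclideanLin A y‖ ^ 2 = ∑ i, (∑ k, A i k * y k) ^ 2 := by
  rw [EuclideanSpace.real_norm_sq_eq]
  rfl

/-- Apply `A` to the indicator vector of `T`, then use Cauchy–Schwarz over `S`; both sets have at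
most `n` elements. -/
theorem abs_sum_cut_le (A : Matrix (Fin n) (Fin n) ℝ) (S T : Finset (Fin n)) :
    |∑ i ∈ S, ∑ k ∈ T, A i k| ≤ (Matrix.toEuclideanLin A).singularValues 0 * n := by
  set σ := (Matrix.toEuclideanLin A).singularValues 0
  have hσ : 0 ≤ σ := LinearMap.singularValues_nonneg _ _
  let w : EuclideanSpace ℝ (Fin n) := WithLp.toLp 2 fun k => if k ∈ T then 1 else 0
  have h1 := (Matrix.toEuclideanLin A).norm_sq_le_singularValues_zero w
  rw [norm_toEuclideanLin_sq, EuclideanSpace.real_norm_sq_eq] at h1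
  have hw : ∀ i, ∑ k, A i k * w k = ∑ k ∈ T, A i k := fun i => by
    simp [w]
  have hw2 : ∑ k, w k ^ 2 ≤ n := by
    calc ∑ k, w k ^ 2 ≤ ∑ k : Fin n, (1 : ℝ) := sum_le_sum fun k _ => by
          simp only [w]; split_ifs <;> norm_num
      _ = n := by simp
  simp only [hw] at h1
  have h2 : (∑ i ∈ S, ∑ k ∈ T, A i k) ^ 2 ≤ n * ∑ i, (∑ k ∈ T, A i k) ^ 2 := by
    refine (sq_sum_le_card_mul_sum_sq).trans ?_
    have : (#S : ℝ) ≤ n := by exact_mod_cast (card_le_univ S).trans (by simp)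
    refine mul_le_mul this ?_ (sum_nonneg fun i _ => sq_nonneg _) (by positivity)
    exact sum_le_sum_of_subset_of_nonneg (subset_univ _) fun i _ _ => sq_nonneg _
  refine abs_le_of_sq_le_sq ?_ (by positivity)
  calc _ ≤ _ := h2
    _ ≤ n * (σ ^ 2 * n) := by
      refine mul_le_mul_of_nonneg_left (h1.trans ?_) (by positivity)
      exact mul_le_mul_of_nonneg_left hw2 (sq_nonneg _)
    _ = _ := by ring

/-- The main estimate for the rounding of a vector `x` with large image under `A` to a pair of sets
with large cut. -/
theorem le_abs_sum_cut (hn : 1 ≤ n) {ε : ℝ} (hε : 0 < ε)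
    (hrow : ∀ i, ∑ k, A i k ^ 2 ≤ (n : ℝ)) (hcol : ∀ k, ∑ i, A i k ^ 2 ≤ (n : ℝ))
    {x y z f g : Fin n → ℝ} {S T : Finset (Fin n)}
    (hy : ∀ i, y i = ∑ k, A i k * x k) (hz : ∀ k, z k = ∑ i, A i k * y i)
    (hf : ∀ i, f i = ∑ k, A i k * z k) (hS : ∑ i, |f i| ≤ 2 * |∑ i ∈ S, f i|)
    (hg : ∀ k, g k = ∑ i ∈ S, A i k) (hT : ∑ k, |g k| ≤ 2 * |∑ k ∈ T, g k|)
    (hx : 0 < ∑ k, x k ^ 2)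
    (h : 9 * (ε ^ 2 * (n : ℝ) ^ 2 * ∑ k, x k ^ 2) ≤ 20 * ∑ i, y i ^ 2) :
    ε ^ 8 / 100 * (n : ℝ) ^ 2 ≤ |∑ i ∈ S, ∑ k ∈ T, A i k| := by
  have hn0 : (0 : ℝ) < n := by exact_mod_cast hn
  set X := ∑ k, x k ^ 2 with hX
  set Y := ∑ i, y i ^ 2 with hY
  set Z := ∑ k, z k ^ 2 with hZ
  have hYpos : 0 < Y := by
    have : 0 < 9 * (ε ^ 2 * (n : ℝ) ^ 2 * X) := by positivity
    linarith
  have hyb : ∀ i, y i ^ 2 ≤ n * X := fun i => by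
    rw [hy]
    exact (sum_mul_sq_le_sq_mul_sq _ _ _).trans (mul_le_mul_of_nonneg_right (hrow i) hx.le)
  have hzb : ∀ k, z k ^ 2 ≤ n * Y := fun k => by
    rw [hz]
    exact (sum_mul_sq_le_sq_mul_sq _ _ _).trans (mul_le_mul_of_nonneg_right (hcol k) hYpos.le)
  have hYX : Y ≤ n ^ 2 * X := by
    calc Y ≤ ∑ i : Fin n, n * X := sum_le_sum fun i _ => hyb i
      _ = _ := by simp; ring
  have hYzx : Y = ∑ k, z k * x k := by
    simp only [hz, sum_mul]
    rw [sum_comm, hY]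
    refine sum_congr rfl fun i _ => ?_
    rw [sq]; nth_rewrite 1 [hy i]
    rw [sum_mul]
    exact sum_congr rfl fun k _ => by ring
  have hYZ : Y ^ 2 ≤ Z * X := by
    nth_rewrite 1 [hYzx]; exact sum_mul_sq_le_sq_mul_sq _ _ _
  have hZyf : Z = ∑ i, y i * f i := by
    simp only [hf, mul_sum]
    rw [sum_comm, hZ]
    refine sum_congr rfl fun k _ => ?_
    rw [sq]; nth_rewrite 1 [hz k]
    rw [sum_mul]
    exact sum_congr rfl fun i _ => by ring
  have hfg : ∑ i ∈ S, f i = ∑ k, z k * g k := by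
    simp only [hf, hg, mul_sum]
    rw [sum_comm]
    exact sum_congr rfl fun k _ => sum_congr rfl fun i _ => by ring
  have hgc : ∑ k ∈ T, g k = ∑ i ∈ S, ∑ k ∈ T, A i k := by
    simp only [hg]; exact sum_comm
  -- Hölder for the sup norm and the sum norm. The row and column bounds on `A` make `y` and `z`
  -- bounded entrywise, which is what lets signs replace them.
  have hholder : ∀ (a b : Fin n → ℝ) (B : ℝ), 0 ≤ B → (∀ i, a i ^ 2 ≤ B) →
      |∑ i, a i * b i| ≤ √B * ∑ i, |b i| := fun a b B hB hab => by
    rw [mul_sum]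
    refine (abs_sum_le_sum_abs _ _).trans (sum_le_sum fun i _ => ?_)
    rw [abs_mul]
    exact mul_le_mul_of_nonneg_right (Real.abs_le_sqrt (hab i)) (abs_nonneg _)
  set D := |∑ i ∈ S, ∑ k ∈ T, A i k| with hD
  have h1 : Z ≤ √(n * X) * (2 * |∑ i ∈ S, f i|) := by
    calc Z ≤ |∑ i, y i * f i| := by rw [← hZyf]; exact le_abs_self _
      _ ≤ √(n * X) * ∑ i, |f i| := hholder _ _ _ (by positivity) hyb
      _ ≤ _ := by gcongr
  have h2 : |∑ i ∈ S, f i| ≤ √(n * Y) * (2 * D) := by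
    calc |∑ i ∈ S, f i| ≤ √(n * Y) * ∑ k, |g k| := by
          rw [hfg]; exact hholder _ _ _ (by positivity) hzb
      _ ≤ _ := by rw [hD, ← hgc]; gcongr
  set sx := √X with hsx
  set sy := √Y with hsy
  have hsx2 : sx ^ 2 = X := Real.sq_sqrt hx.le
  have hsy2 : sy ^ 2 = Y := Real.sq_sqrt hYpos.le
  have hsx0 : 0 < sx := Real.sqrt_pos.2 hx
  have hsy0 : 0 < sy := Real.sqrt_pos.2 hYpos
  have h3 : Z ≤ 4 * n * (sx * sy) * D := by
    rw [Real.sqrt_mul hn0.le] at h1 h2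
    have e : √(n : ℝ) * √(n : ℝ) = n := Real.mul_self_sqrt hn0.le
    calc Z ≤ √n * sx * (2 * |∑ i ∈ S, f i|) := h1
      _ ≤ √n * sx * (2 * (√n * sy * (2 * D))) := by gcongr
      _ = 4 * (√n * √n) * (sx * sy) * D := by ring
      _ = _ := by rw [e]
  have hD0 : 0 ≤ D := abs_nonneg _
  -- With `x`, `y`, `z` as vectors: `‖y‖⁴ ≤ ‖z‖² ‖x‖²`, and `‖z‖² ≤ 4 n ‖x‖ ‖y‖ D` from the two
  -- roundings.
  have h4 : sy ^ 3 ≤ 4 * n * sx ^ 3 * D := by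
    refine le_of_mul_le_mul_right ?_ hsy0
    calc sy ^ 3 * sy = Y ^ 2 := by rw [← hsy2]; ring
      _ ≤ Z * X := hYZ
      _ ≤ 4 * n * (sx * sy) * D * X := mul_le_mul_of_nonneg_right h3 hx.le
      _ = _ := by rw [← hsx2]; ring
  set t := sy / (n * sx) with ht
  have hty : sy = t * (n * sx) := by rw [ht]; field_simp
  have ht0 : 0 < t := by positivity
  have ht1 : t ≤ 1 := by
    rw [ht, div_le_one (by positivity)]
    refine le_of_sq_le_sq ?_ (by positivity)
    rw [hsy2, mul_pow, hsx2]; exact hYX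
  have h5 : t ^ 3 * (n : ℝ) ^ 2 ≤ 4 * D := by
    have : 0 < (n : ℝ) * sx ^ 3 := by positivity
    refine le_of_mul_le_mul_right ?_ this
    calc _ = sy ^ 3 := by rw [hty]; ring
      _ ≤ _ := h4
      _ = _ := by ring
  have h6 : 9 / 20 * ε ^ 2 ≤ t ^ 2 := by
    rw [ht, div_pow, le_div_iff₀ (by positivity), mul_pow, hsy2, hsx2]
    nlinarith
  -- The bound `t ≤ 1` allows passing from `t ^ 3` to `t ^ 8`; the constant works because `(9 / 20)
  -- ^ 4 ≥ 1 / 25`.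
  have h7 : (9 / 20 * ε ^ 2) ^ 4 ≤ t ^ 3 := by
    calc _ ≤ (t ^ 2) ^ 4 := pow_le_pow_left₀ (by positivity) h6 4
      _ = t ^ 3 * t ^ 5 := by ring
      _ ≤ t ^ 3 * 1 := by gcongr; exact pow_le_one₀ ht0.le ht1
      _ = _ := mul_one _
  have h8 : ε ^ 8 / 25 ≤ t ^ 3 := by
    refine le_trans ?_ h7
    have : (0 : ℝ) ≤ ε ^ 8 := by positivity
    nlinarith
  have h9 : ε ^ 8 / 25 * (n : ℝ) ^ 2 ≤ 4 * D :=
    (mul_le_mul_of_nonneg_right h8 (by positivity)).trans h5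
  linarith

/-- One of the two sets of indices, where `f` is nonnegative and where `f` is negative, captures
at least half of `∑ i, |f i|`. -/
theorem sum_abs_le_two_mul_abs_sum {ι : Type*} [Fintype ι] (f : ι → ℝ) (S : Finset ι)
    (hS : ((∑ i, if 0 ≤ f i then 0 else -f i) ≤ ∑ i, (if 0 ≤ f i then f i else 0) ∧
        ∀ i, i ∈ S ↔ 0 ≤ f i) ∨
      ((∑ i, if 0 ≤ f i then f i else 0) ≤ ∑ i, (if 0 ≤ f i then 0 else -f i) ∧
        ∀ i, i ∈ S ↔ ¬ 0 ≤ f i)) :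
    ∑ i, |f i| ≤ 2 * |∑ i ∈ S, f i| := by
  have h0 : ∑ i, |f i| = (∑ i, if 0 ≤ f i then f i else 0) + ∑ i, if 0 ≤ f i then 0 else -f i := by
    rw [← sum_add_distrib]
    refine sum_congr rfl fun i _ => ?_
    split_ifs with h
    · rw [abs_of_nonneg h, add_zero]
    · rw [abs_of_neg (not_le.1 h), zero_add]
  rcases hS with ⟨h1, h2⟩ | ⟨h1, h2⟩
  · have : ∑ i ∈ S, f i = ∑ i, if 0 ≤ f i then f i else 0 := by
      rw [← sum_filter]; exact sum_congr (by ext i; simp [h2]) fun _ _ => rfl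
    rw [h0, this]
    linarith [le_abs_self (∑ i, if 0 ≤ f i then f i else 0)]
  · have : ∑ i ∈ S, f i = -∑ i, if 0 ≤ f i then 0 else -f i := by
      rw [← sum_neg_distrib, ← sum_subset (subset_univ S)]
      · exact sum_congr rfl fun i hi => by rw [if_neg ((h2 i).1 hi)]; ring
      · intro i _ hi
        rw [h2, not_not] at hi
        rw [if_pos hi, neg_zero]
    rw [h0, this, abs_neg]
    linarith [le_abs_self (∑ i, if 0 ≤ f i then 0 else -f i)]

end Cut

/-! ### Program logic: frame rule, triples with costs, loops and vector operations. -/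

namespace RealRAM

open Finset
open scoped InnerProductSpace

@[simp] theorem Store.setReal_word (s : Store) (a i : ℕ) (v : ℝ) :
    (s.setReal a i v).word = s.word := rfl

theorem Store.setWord_word (s : Store) (a i v b j : ℕ) :
    (s.setWord a i v).word b j = if b = a ∧ j = i then v else s.word b j := by
  simp only [Store.setWord, Function.update_apply]
  split_ifs <;> simp_all

theorem Store.setReal_real (s : Store) (a i : ℕ) (v : ℝ) (b j : ℕ) :
    (s.setReal a i v).real b j = if b = a ∧ j = i then v else s.real b j := by
  simp only [Store.setReal, Function.update_apply]
  split_ifs <;> simp_all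

/-- The names of the word arrays that a program may change. -/
def Prog.words : Prog → List ℕ
  | skip => []
  | setWord a _ _ => [a]
  | setReal _ _ _ => []
  | seq p q => p.words ++ q.words
  | ite _ p q => p.words ++ q.words
  | .while _ p => p.words

/-- The names of the real arrays that a program may change. -/
def Prog.reals : Prog → List ℕ
  | skip => []
  | setWord _ _ _ => []
  | setReal a _ _ => [a]
  | seq p q => p.reals ++ q.reals
  | ite _ p q => p.reals ++ q.reals
  | .while _ p => p.reals

/-- The two stores agree outside of the word arrays `ws` and the real arrays `rs`. -/
structure Same (ws rs : List ℕ) (s s' : Store) : Prop where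
  word : ∀ a, a ∉ ws → s'.word a = s.word a
  real : ∀ a, a ∉ rs → s'.real a = s.real a

theorem Same.refl (ws rs : List ℕ) (s : Store) : Same ws rs s s := ⟨fun _ _ => rfl, fun _ _ => rfl⟩

theorem Same.trans {ws rs : List ℕ} {s s' s'' : Store} (h : Same ws rs s s')
    (h' : Same ws rs s' s'') : Same ws rs s s'' :=
  ⟨fun a ha => (h'.word a ha).trans (h.word a ha), fun a ha => (h'.real a ha).trans (h.real a ha)⟩

theorem Same.mono {ws rs ws' rs' : List ℕ} {s s' : Store} (h : Same ws rs s s')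
    (hw : ws ⊆ ws') (hr : rs ⊆ rs') : Same ws' rs' s s' :=
  ⟨fun a ha => h.word a fun h' => ha (hw h'), fun a ha => h.real a fun h' => ha (hr h')⟩

theorem Same.setWord (s : Store) {a : ℕ} (i v : ℕ) {ws rs : List ℕ} (h : a ∈ ws) :
    Same ws rs s (s.setWord a i v) :=
  ⟨fun b hb => by
    have : b ≠ a := fun e => hb (e ▸ h)
    simp [Store.setWord, this], fun _ _ => rfl⟩

theorem Same.setReal (s : Store) {a : ℕ} (i : ℕ) (v : ℝ) {ws rs : List ℕ} (h : a ∈ rs) :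
    Same ws rs s (s.setReal a i v) :=
  ⟨fun _ _ => rfl, fun b hb => by
    have : b ≠ a := fun e => hb (e ▸ h)
    simp [Store.setReal, this]⟩

variable {x : Input} {W : ℕ}

/-- A syntactic frame rule: for a concrete program, that an array is untouched can be settled by
`decide` or `simp`. -/
theorem Exec.same {p : Prog} {s s' : Store} {t : ℕ} (h : Exec x W p s t s') :
    Same p.words p.reals s s' := by
  induction h with
  | skip => exact Same.refl _ _ _
  | setWord => exact Same.setWord _ _ _ (by simp [Prog.words])
  | setReal => exact Same.setReal _ _ _ (by simp [Prog.reals])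
  | seq _ _ h1 h2 =>
    exact (h1.mono (by simp [Prog.words]) (by simp [Prog.reals])).trans
      (h2.mono (by simp [Prog.words]) (by simp [Prog.reals]))
  | iteTrue _ _ _ h => exact h.mono (by simp [Prog.words]) (by simp [Prog.reals])
  | iteFalse _ _ _ h => exact h.mono (by simp [Prog.words]) (by simp [Prog.reals])
  | whileTrue _ _ _ _ h1 h2 =>
    exact (h1.mono (by simp [Prog.words]) (by simp [Prog.reals])).trans h2
  | whileFalse => exact Same.refl _ _ _

/-- The program `p`, started with the memory `s`, halts after at most `c` steps with a memory that
satisfies `Q`. -/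
def Runs (x : Input) (W : ℕ) (p : Prog) (s : Store) (c : ℕ) (Q : Store → Prop) : Prop :=
  ∃ t s', t ≤ c ∧ Exec x W p s t s' ∧ Q s'

namespace Runs

variable {p q : Prog} {s : Store} {c c' : ℕ} {Q Q' : Store → Prop}

theorem mono (h : Runs x W p s c Q) (hc : c ≤ c') (hQ : ∀ s', Same p.words p.reals s s' → Q s' → Q' s') :
    Runs x W p s c' Q' := by
  obtain ⟨t, s', ht, he, hq⟩ := h
  exact ⟨t, s', ht.trans hc, he, hQ s' he.same hq⟩

theorem seq {d : ℕ} (h : Runs x W p s c Q)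
    (h' : ∀ s', Same p.words p.reals s s' → Q s' → Runs x W q s' d Q') (hc : c + d ≤ c') :
    Runs x W (.seq p q) s c' Q' := by
  obtain ⟨t, s', ht, he, hq⟩ := h
  obtain ⟨t', s'', ht', he', hq'⟩ := h' s' he.same hq
  exact ⟨t + t', s'', by omega, he.seq he', hq'⟩

theorem skip (hQ : Q s) (hc : 1 ≤ c) : Runs x W .skip s c Q := ⟨1, s, hc, .skip s, hQ⟩

theorem setWord {a : ℕ} {i e : WExp} (hi : i.Legal x W s) (he : e.Legal x W s)
    (hQ : Q (s.setWord a (i.eval x s) (e.eval x s))) (hc : i.cost + e.cost + 1 ≤ c) :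
    Runs x W (.setWord a i e) s c Q := ⟨_, _, hc, .setWord a i e s hi he, hQ⟩

theorem setReal {a : ℕ} {i : WExp} {e : RExp} (hi : i.Legal x W s) (he : e.Legal x W s)
    (hQ : Q (s.setReal a (i.eval x s) (e.eval x s))) (hc : i.cost + e.cost + 1 ≤ c) :
    Runs x W (.setReal a i e) s c Q := ⟨_, _, hc, .setReal a i e s hi he, hQ⟩

theorem ite {b : Test} (hl : b.Legal x W s) (h1 : b.Holds x s → Runs x W p s c Q)
    (h2 : ¬ b.Holds x s → Runs x W q s c Q) (hc : b.cost + c ≤ c') :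
    Runs x W (.ite b p q) s c' Q := by
  by_cases hb : b.Holds x s
  · obtain ⟨t, s', ht, he, hq⟩ := h1 hb
    exact ⟨_, s', by omega, .iteTrue hl hb he, hq⟩
  · obtain ⟨t, s', ht, he, hq⟩ := h2 hb
    exact ⟨_, s', by omega, .iteFalse hl hb he, hq⟩

end Runs

/-- The word register `a`. -/
abbrev WExp.reg (a : ℕ) : WExp := .cell a (.const 0)

/-- The real register `a`. -/
abbrev RExp.reg (a : ℕ) : RExp := .cell a (.const 0)

/-- Run `p` for the values `0, 1, …` smaller than `b` of the counter `i`. -/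
def forLoop (i : ℕ) (b : WExp) (p : Prog) : Prog :=
  .seq (.setWord i (.const 0) (.const 0))
    (.while (.wordLE (.add (.reg i) (.const 1)) b)
      (.seq p (.setWord i (.const 0) (.add (.reg i) (.const 1)))))

/-- The bound `b` is evaluated anew at every test, so its value must survive the body. The last test
computes `N + 1`, which must still fit into a word. The overhead per round is `b.cost + 5` for the
test and `6` for the increment. -/
theorem runs_forLoop {i : ℕ} {b : WExp} {p : Prog} {s : Store} (N c : ℕ) (I : ℕ → Store → Prop)
    {c' : ℕ} (hi : i ∉ p.words)
    (hb : ∀ s', Same (i :: p.words) p.reals s s' → b.eval x s' = N ∧ b.Legal x W s')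
    (hN : N + 1 ≤ W) (hI : ∀ k s' v, I k s' → I k (s'.setWord i 0 v)) (h0 : I 0 s)
    (hstep : ∀ k < N, ∀ s', Same (i :: p.words) p.reals s s' → s'.word i 0 = k → I k s' →
      Runs x W p s' c (I (k + 1)))
    (hc : N * (c + b.cost + 11) + b.cost + 8 ≤ c') :
    Runs x W (forLoop i b p) s c' (I N) := by
  have key : ∀ d k s', k + d = N → Same (i :: p.words) p.reals s s' → s'.word i 0 = k → I k s' →
      Runs x W (.while (.wordLE (.add (.reg i) (.const 1)) b)
        (.seq p (.setWord i (.const 0) (.add (.reg i) (.const 1))))) s'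
        (d * (c + b.cost + 11) + b.cost + 5) (I N) := by
    intro d
    induction d with
    | zero =>
      intro k s' hk hs hki hIk
      obtain ⟨hb1, hb2⟩ := hb s' hs
      obtain rfl : k = N := by omega
      refine ⟨_, s', ?_, .whileFalse ?_ ?_, hIk⟩
      · simp [Test.cost, WExp.cost]; omega
      · simp [Test.Legal, WExp.Legal, WExp.eval, hki, hb2]; omega
      · simp [Test.Holds, WExp.eval, hki, hb1]
    | succ d ih =>
      intro k s' hk hs hki hIk
      obtain ⟨hb1, hb2⟩ := hb s' hs
      obtain ⟨t, s₁, ht, he, hI1⟩ := hstep k (by omega) s' hs hki hIk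
      have hsame := he.same
      have hs1 : s₁.word i 0 = k := by rw [hsame.word i hi, hki]
      obtain ⟨t', s₂, ht', he', hI2⟩ := ih (k + 1) (s₁.setWord i 0 (k + 1)) (by omega)
        ((hs.trans (hsame.mono (List.subset_cons_self _ _) (List.Subset.refl _))).trans
          (Same.setWord _ _ _ (by simp))) (by simp [Store.setWord_word]) (hI _ _ _ hI1)
      have hset := Exec.setWord (x := x) (W := W) i (.const 0) (.add (.reg i) (.const 1)) s₁
        (by simp [WExp.Legal]) (by simp [WExp.Legal, WExp.eval, hs1]; omega)
      simp only [WExp.eval, hs1] at hset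
      refine ⟨_, s₂, ?_, .whileTrue ?_ ?_ (he.seq hset) he', hI2⟩
      · simp only [Test.cost, WExp.cost]
        rw [Nat.succ_mul]; omega
      · simp [Test.Legal, WExp.Legal, WExp.eval, hki, hb2]; omega
      · simp [Test.Holds, WExp.eval, hki, hb1]; omega
  refine Runs.seq (Q := fun s' => s' = s.setWord i 0 0)
    (Runs.setWord (by simp [WExp.Legal]) (by simp [WExp.Legal]) (by simp [WExp.eval]) le_rfl) ?_
    (d := N * (c + b.cost + 11) + b.cost + 5) (by simp [WExp.cost]; omega)
  rintro s' - rfl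
  exact key N 0 _ (by omega) (Same.setWord _ _ _ (by simp)) (by simp [Store.setWord_word])
    (hI _ _ _ h0)

/-- Assign `e` to the cells `o + c`, `c < n`, of the real array `a`; here `e` may depend on the
counter `i`, which takes the values `c`. -/
def fill (i a : ℕ) (o : WExp) (e : RExp) : Prog :=
  forLoop i .size (.setReal a (.add o (.reg i)) e)

/-- The expression may read the target cell, which still has its old value when it is about to be
overwritten. This permits updates in place. -/
theorem runs_fill {i a : ℕ} {o : WExp} {e : RExp} {s : Store} (ov : ℕ) (g : ℕ → ℝ) {c' : ℕ}
    (hW : ov + x.n + 1 ≤ W)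
    (ho : ∀ s', Same [i] [a] s s' → o.eval x s' = ov ∧ o.Legal x W s')
    (he : ∀ c < x.n, ∀ s', Same [i] [a] s s' → s'.word i 0 = c →
      s'.real a (ov + c) = s.real a (ov + c) → e.eval x s' = g c ∧ e.Legal x W s')
    (hc : x.n * (o.cost + e.cost + 16) + 9 ≤ c') :
    Runs x W (fill i a o e) s c' fun s' => (∀ c < x.n, s'.real a (ov + c) = g c) ∧
      ∀ j, (j < ov ∨ ov + x.n ≤ j) → s'.real a j = s.real a j := by
  refine (runs_forLoop x.n (o.cost + e.cost + 4)
    (fun k s' => (∀ c < k, s'.real a (ov + c) = g c) ∧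
      ∀ j, (j < ov ∨ ov + k ≤ j) → s'.real a j = s.real a j) (by simp [Prog.words]) ?_ (by omega)
      (fun k s' v h => h) (by simp) ?_ ?_)
  · intro s' _; simp [WExp.eval, WExp.Legal]; omega
  · rintro k hk s' hs hki ⟨h1, h2⟩
    obtain ⟨ho1, ho2⟩ := ho s' hs
    obtain ⟨he1, he2⟩ := he k hk s' hs hki (h2 _ (Or.inr le_rfl))
    refine Runs.setReal ?_ he2 ?_ (by simp [WExp.cost]; omega)
    · simp [WExp.Legal, WExp.eval, ho1, ho2, hki]; omega
    · simp only [WExp.eval, ho1, hki, he1, Store.setReal_real]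
      refine ⟨fun c hc => ?_, fun j hj => ?_⟩
      · rcases Nat.lt_succ_iff_lt_or_eq.1 hc with hc | rfl
        · rw [if_neg (by omega)]; exact h1 c hc
        · simp
      · rw [if_neg (by omega)]; exact h2 j (by omega)
  · simp only [WExp.cost]; refine le_trans (le_of_eq ?_) hc; ring

/-- Store the sum of the values of `e` for the values `0, 1, …` smaller than `b` of the counter `i`
in the real register `a`. -/
def sumLoop (i a : ℕ) (b : WExp) (e : RExp) : Prog :=
  .seq (.setReal a (.const 0) (.cast (.const 0)))
    (forLoop i b (.setReal a (.const 0) (.add (.reg a) e)))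

theorem runs_sumLoop {i a : ℕ} {b : WExp} {e : RExp} {s : Store} (N : ℕ) (g : ℕ → ℝ) {c' : ℕ}
    (hN : N + 1 ≤ W)
    (hb : ∀ s', Same [i] [a] s s' → b.eval x s' = N ∧ b.Legal x W s')
    (he : ∀ c < N, ∀ s', Same [i] [a] s s' → s'.word i 0 = c →
      e.eval x s' = g c ∧ e.Legal x W s')
    (hc : N * (b.cost + e.cost + 16) + b.cost + 12 ≤ c') :
    Runs x W (sumLoop i a b e) s c' fun s' => s'.real a 0 = ∑ c ∈ range N, g c := by
  refine Runs.seq (c := 4) (Q := fun s' => s' = s.setReal a 0 0)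
    (d := N * (b.cost + e.cost + 16) + b.cost + 8)
    (Runs.setReal (by simp [WExp.Legal]) (by simp [RExp.Legal, WExp.Legal])
      (by simp [RExp.eval, WExp.eval]) (by simp [WExp.cost, RExp.cost])) ?_ (by omega)
  rintro s₀ - rfl
  have hs0 : Same [i] [a] s (s.setReal a 0 0) := Same.setReal _ _ _ (by simp)
  refine (runs_forLoop N (e.cost + 5) (fun k s' => s'.real a 0 = ∑ c ∈ range k, g c)
    (by simp [Prog.words]) (fun s' hs => hb s' (hs0.trans hs)) hN (fun k s' v h => h)
    (by simp [Store.setReal_real]) ?_ ?_)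
  · intro k hk s' hs hki h1
    obtain ⟨he1, he2⟩ := he k hk s' (hs0.trans hs) hki
    refine Runs.setReal (by simp [WExp.Legal]) ?_ ?_ (by simp [WExp.cost, RExp.cost]; omega)
    · simp [RExp.Legal, WExp.Legal, he2]
    · simp [RExp.eval, WExp.eval, Store.setReal_real, he1, h1, sum_range_succ]
  · refine le_of_eq ?_; ring

/-- The vector formed by `n` cells, beginning with the cell `o`. -/
noncomputable def vec (n : ℕ) (f : ℕ → ℝ) (o : ℕ) : EuclideanSpace ℝ (Fin n) :=
  WithLp.toLp 2 fun i => f (o + i)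

@[simp] theorem vec_apply (n : ℕ) (f : ℕ → ℝ) (o : ℕ) (i : Fin n) : vec n f o i = f (o + i) := rfl

theorem vec_congr {n : ℕ} {f g : ℕ → ℝ} {o o' : ℕ} (h : ∀ c < n, f (o + c) = g (o' + c)) :
    vec n f o = vec n g o' := by
  ext i; exact h i i.2

theorem inner_vec (n : ℕ) (f g : ℕ → ℝ) (o o' : ℕ) :
    ⟪vec n f o, vec n g o'⟫_ℝ = ∑ c ∈ range n, f (o + c) * g (o' + c) := by
  rw [← Fin.sum_univ_eq_sum_range (fun c => f (o + c) * g (o' + c))]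
  simp only [PiLp.inner_apply, vec_apply]
  exact sum_congr rfl fun i _ => by simp [mul_comm]

/-- The row `k` of a matrix with `n` columns that is stored in an array. -/
noncomputable abbrev row (n : ℕ) (f : ℕ → ℝ) (k : ℕ) : EuclideanSpace ℝ (Fin n) := vec n f (k * n)

theorem row_congr {n : ℕ} {f g : ℕ → ℝ} {k l : ℕ} (hkl : l ≠ k)
    (h : ∀ j, (j < k * n ∨ k * n + n ≤ j) → f j = g j) : row n f l = row n g l := by
  refine vec_congr fun c hc => h _ ?_
  rcases lt_or_gt_of_ne hkl with h1 | h1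
  · left; nlinarith
  · right; nlinarith

/-- Store the inner product of a vector in the real array `a` and a vector in the real array `b` in
the real register `r`. -/
def dot (i r a : ℕ) (oa : WExp) (b : ℕ) (ob : WExp) : Prog :=
  sumLoop i r .size (.mul (.cell a (.add oa (.reg i))) (.cell b (.add ob (.reg i))))

theorem runs_dot {i r a b : ℕ} {oa ob : WExp} {s : Store} (va vb : ℕ) {c' : ℕ}
    (ha : a ≠ r) (hb : b ≠ r) (hWa : va + x.n + 1 ≤ W) (hWb : vb + x.n + 1 ≤ W)
    (hoa : ∀ s', Same [i] [r] s s' → oa.eval x s' = va ∧ oa.Legal x W s')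
    (hob : ∀ s', Same [i] [r] s s' → ob.eval x s' = vb ∧ ob.Legal x W s')
    (hca : oa.cost ≤ 4) (hcb : ob.cost ≤ 4) (hc : 36 * x.n + 13 ≤ c') :
    Runs x W (dot i r a oa b ob) s c' fun s' =>
      s'.real r 0 = ⟪vec x.n (s.real a) va, vec x.n (s.real b) vb⟫_ℝ := by
  rw [inner_vec]
  refine runs_sumLoop x.n _ (by omega) ?_ ?_ ?_
  · intro s' _; simp [WExp.eval, WExp.Legal]; omega
  · intro c hc s' hs hci
    obtain ⟨h1, h2⟩ := hoa s' hs
    obtain ⟨h3, h4⟩ := hob s' hs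
    constructor
    · simp [RExp.eval, WExp.eval, h1, h3, hci, hs.real a (by simpa using ha),
        hs.real b (by simpa using hb)]
    · simp [RExp.Legal, WExp.Legal, WExp.eval, h1, h2, h3, h4, hci]; omega
  · simp only [WExp.cost, RExp.cost]; nlinarith

/-- Copy a vector from the real array `b` to the real array `a`. -/
def copy (i a : ℕ) (oa : WExp) (b : ℕ) (ob : WExp) : Prog := fill i a oa (.cell b (.add ob (.reg i)))

theorem runs_copy {i a b : ℕ} {oa ob : WExp} {s : Store} (va vb : ℕ) {c' : ℕ} (hab : b ≠ a)
    (hWa : va + x.n + 1 ≤ W) (hWb : vb + x.n + 1 ≤ W)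
    (hoa : ∀ s', Same [i] [a] s s' → oa.eval x s' = va ∧ oa.Legal x W s')
    (hob : ∀ s', Same [i] [a] s s' → ob.eval x s' = vb ∧ ob.Legal x W s')
    (hca : oa.cost ≤ 4) (hcb : ob.cost ≤ 4) (hc : 28 * x.n + 9 ≤ c') :
    Runs x W (copy i a oa b ob) s c' fun s' =>
      vec x.n (s'.real a) va = vec x.n (s.real b) vb ∧
      ∀ j, (j < va ∨ va + x.n ≤ j) → s'.real a j = s.real a j := by
  refine (runs_fill va (fun c => s.real b (vb + c)) hWa hoa ?_ (c' := c') ?_).mono le_rfl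
    fun s' _ h => ⟨vec_congr h.1, h.2⟩
  · intro c hc s' hs hci _
    obtain ⟨h3, h4⟩ := hob s' hs
    constructor
    · simp [RExp.eval, WExp.eval, h3, hci, hs.real b (by simpa using hab)]
    · simp [RExp.Legal, WExp.Legal, WExp.eval, h3, h4, hci]; omega
  · simp only [WExp.cost, RExp.cost]; nlinarith

end RealRAM

/-! ### Running maximum of Rayleigh quotients. -/

section BestOf

open scoped InnerProductSpace

variable {E : Type*} [NormedAddCommGroup E] [InnerProductSpace ℝ E]

/-- Like `IsBest`, with the maximum taken over the aligned vectors among those that satisfy `P`. -/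
structure BestOf (T : E →ₗ[ℝ] E) (L : ℕ) (P : E → Prop) (x : E) (num den : ℝ) : Prop where
  cases : (x = 0 ∧ num = 0 ∧ den = 1) ∨
    (0 < num ∧ num = ⟪x, T x⟫_ℝ ∧ den = ⟪x, x⟫_ℝ ∧ Aligned T L x)
  max : ∀ z, P z → Aligned T L z → ⟪z, T z⟫_ℝ * den ≤ num * ⟪z, z⟫_ℝ

variable {T : E →ₗ[ℝ] E} {L : ℕ} {P P' : E → Prop} {x x' : E} {num den num' den' : ℝ}

/-- Quotients are compared by cross-multiplication, so `z = 0` needs no special treatment: a strict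
improvement forces `⟪z, T z⟫ > 0`. -/
theorem BestOf.step (h : BestOf T L P x num den) (z : E) (hP : ∀ y, P' y → P y ∨ y = z)
    (h' : (num * ⟪z, z⟫_ℝ < ⟪z, T z⟫_ℝ * den ∧ Aligned T L z ∧ x' = z ∧ num' = ⟪z, T z⟫_ℝ ∧
        den' = ⟪z, z⟫_ℝ) ∨
      (¬ (num * ⟪z, z⟫_ℝ < ⟪z, T z⟫_ℝ * den ∧ Aligned T L z) ∧ x' = x ∧ num' = num ∧ den' = den)) :
    BestOf T L P' x' num' den' := by
  have hnd : 0 ≤ num ∧ 0 < den := by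
    rcases h.cases with h | h
    · rw [h.2.1, h.2.2]; exact ⟨le_rfl, one_pos⟩
    · refine ⟨h.1.le, ?_⟩
      have : x ≠ 0 := by
        rintro rfl
        have := h.2.1 ▸ h.1
        simp at this
      rw [h.2.2.1, real_inner_self_eq_norm_sq]
      positivity
  obtain ⟨hnum, hden⟩ := hnd
  rcases h' with ⟨h1, h2, rfl, rfl, rfl⟩ | ⟨h1, rfl, rfl, rfl⟩
  · have hzz := real_inner_self_nonneg (x := x')
    have hpos : 0 < ⟪x', T x'⟫_ℝ :=
      pos_of_mul_pos_left (lt_of_le_of_lt (mul_nonneg hnum hzz) h1) hden.le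
    refine ⟨Or.inr ⟨hpos, rfl, rfl, h2⟩, fun y hy hal => ?_⟩
    rcases hP y hy with hy | rfl
    · have h3 := h.max y hy hal
      have hyy := real_inner_self_nonneg (x := y)
      refine le_of_mul_le_mul_right ?_ hden
      calc _ = ⟪y, T y⟫_ℝ * den * ⟪x', x'⟫_ℝ := by ring
        _ ≤ num * ⟪y, y⟫_ℝ * ⟪x', x'⟫_ℝ := mul_le_mul_of_nonneg_right h3 hzz
        _ = num * ⟪x', x'⟫_ℝ * ⟪y, y⟫_ℝ := by ring
        _ ≤ ⟪x', T x'⟫_ℝ * den * ⟪y, y⟫_ℝ := mul_le_mul_of_nonneg_right h1.le hyy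
        _ = _ := by ring
    · exact le_rfl
  · refine ⟨h.cases, fun y hy hal => ?_⟩
    rcases hP y hy with hy | rfl
    · exact h.max y hy hal
    · by_contra hcon
      exact h1 ⟨not_le.1 hcon, hal⟩

end BestOf

/-! ### Programs for power iteration. -/

namespace RealRAM

open Finset
open scoped InnerProductSpace

variable {x : Input} {W L : ℕ} {s : Store}

/-- The words needed by the algorithm with parameter `L` are at most `W`. -/
structure Fits (x : Input) (W L : ℕ) : Prop where
  one_le_n : 1 ≤ x.n
  one_le_L : 1 ≤ L
  room : (L + 2) * (x.n + 2) + 2 * L ^ 2 + 100 ≤ W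

theorem Fits.row_le (h : Fits x W L) {k : ℕ} (hk : k ≤ L) : k * x.n + x.n + 1 ≤ W := by
  have h1 := h.room
  have : k * x.n ≤ L * x.n := Nat.mul_le_mul_right _ hk
  nlinarith

theorem Fits.n_le (h : Fits x W L) : x.n + 100 ≤ W := by
  have h1 := h.room
  nlinarith

theorem Fits.L_le (h : Fits x W L) : L + 100 ≤ W := by
  have h1 := h.room
  nlinarith

theorem Fits.sq_le (h : Fits x W L) : 2 * (L * L) + 100 ≤ W := by
  have h1 := h.room
  nlinarith

/-- The address of the row whose number is in the word register `r`. -/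
abbrev WExp.rowOf (r : ℕ) : WExp := .mul (.reg r) .size

theorem Fits.rowOf (h : Fits x W L) {r k : ℕ} (hr : s.word r 0 = k) (hk : k ≤ L) :
    (WExp.rowOf r).eval x s = k * x.n ∧ (WExp.rowOf r).Legal x W s := by
  have h1 := h.row_le hk
  have h2 := h.n_le
  have h3 := h.L_le
  simp [WExp.eval, WExp.Legal, hr]
  omega

theorem const_zero_spec (s : Store) :
    (WExp.const 0).eval x s = 0 ∧ (WExp.const 0).Legal x W s := by
  simp [WExp.eval, WExp.Legal]

/-- The operator represented by the weights in the real array `1` and the rows of the real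
array `0`. -/
noncomputable abbrev Store.op (s : Store) (n L : ℕ) :
    EuclideanSpace ℝ (Fin n) →ₗ[ℝ] EuclideanSpace ℝ (Fin n) :=
  weightedGram (L + 1) (s.real 1) (row n (s.real 0))

theorem Store.op_congr {s s' : Store} (n L : ℕ) (h0 : s'.real 0 = s.real 0)
    (h1 : s'.real 1 = s.real 1) : s'.op n L = s.op n L := by
  rw [Store.op, Store.op, h0, h1]

/-- Apply the operator to the vector in the real array `2`; the result goes to the real
array `3`. -/
def applyOp : Prog :=
  .seq (fill 9 3 (.const 0) (.cast (.const 0)))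
    (forLoop 8 (.add (.reg 3) (.const 1))
      (.seq (dot 9 7 0 (.rowOf 8) 2 (.const 0))
        (fill 9 3 (.const 0) (.add (.cell 3 (.reg 9))
          (.mul (.mul (.cell 1 (.reg 8)) (.reg 7)) (.cell 0 (.add (.rowOf 8) (.reg 9))))))))

theorem runs_applyOp (hF : Fits x W L) (hs : s.word 3 0 = L) {c' : ℕ}
    (hc : 130 * (L + 1) * x.n ≤ c') :
    Runs x W applyOp s c' fun s' => vec x.n (s'.real 3) 0 = s.op x.n L (vec x.n (s.real 2) 0) := by
  have hn := hF.n_le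
  have hL := hF.L_le
  have hn1 := hF.one_le_n
  have hL1 := hF.one_le_L
  refine Runs.seq (c := 19 * x.n + 9) (d := (L + 1) * (72 * x.n + 22 + 15) + 12)
    (runs_fill 0 (fun _ => 0) (by omega) (fun s' _ => const_zero_spec s')
      (fun c _ s' _ _ _ => by simp [RExp.eval, WExp.eval, RExp.Legal, WExp.Legal])
      (by simp only [WExp.cost, RExp.cost]; omega)) ?_ (by nlinarith)
  rintro s₁ hS1 ⟨h1, -⟩
  have hs1 : s₁.word 3 0 = L := by rw [hS1.word 3 (by decide), hs]
  refine (runs_forLoop (L + 1) (72 * x.n + 22) (fun k s' => vec x.n (s'.real 3) 0 =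
      weightedGram k (s.real 1) (row x.n (s.real 0)) (vec x.n (s.real 2) 0))
    (by decide) ?_ (by omega) (fun k s' v h => h) ?_ ?_ ?_)
  · intro s' hS
    have : s'.word 3 0 = L := by rw [hS.word 3 (by decide), hs1]
    simp [WExp.eval, WExp.Legal, this]; omega
  · ext i
    simpa [weightedGram] using h1 i i.2
  · intro k hk s₂ hS2 hk2 hI
    have hA : ∀ a, a ∉ [3, 7] → s₂.real a = s.real a := fun a ha => by
      rw [hS2.real a (by simp at ha; simp [Prog.reals, dot, fill, sumLoop, forLoop, ha]),
        hS1.real a (by simp at ha; simp [Prog.reals, fill, forLoop, ha])]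
    have hrow : ∀ s', Same [9] [7] s₂ s' →
        (WExp.rowOf 8).eval x s' = k * x.n ∧ (WExp.rowOf 8).Legal x W s' := fun s' h =>
      hF.rowOf (by rw [h.word 8 (by decide), hk2]) (by omega)
    have hkn := hF.row_le (k := k) (by omega)
    refine Runs.seq (c := 36 * x.n + 13) (d := 36 * x.n + 9)
      (runs_dot (k * x.n) 0 (by decide) (by decide) (by omega) (by omega) hrow
        (fun s' _ => const_zero_spec s') (by decide) (by decide) le_rfl) ?_ (by omega)
    intro s₃ hS3 h3
    have hk3 : s₃.word 8 0 = k := by rw [hS3.word 8 (by decide), hk2]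
    have h30 : s₃.real 0 = s.real 0 := by rw [hS3.real 0 (by decide : 0 ∉ [7, 7]), hA 0 (by decide)]
    have h31 : s₃.real 1 = s.real 1 := by rw [hS3.real 1 (by decide : 1 ∉ [7, 7]), hA 1 (by decide)]
    have h33 : s₃.real 3 = s₂.real 3 := hS3.real 3 (by decide : 3 ∉ [7, 7])
    rw [hA 0 (by decide), hA 2 (by decide)] at h3
    refine (runs_fill 0 (fun c => s₃.real 3 (0 + c) + s.real 1 k * s₃.real 7 0 * s.real 0 (k * x.n + c))
      (by omega) (fun s' _ => const_zero_spec s') ?_ ?_).mono le_rfl ?_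
    · intro c hc s' hS' hc9 hsame
      have h8 : s'.word 8 0 = k := by rw [hS'.word 8 (by decide), hk3]
      obtain ⟨r1, r2⟩ := hF.rowOf (s := s') h8 (by omega)
      constructor
      · simp only [RExp.eval, WExp.eval] at r1 ⊢
        rw [zero_add] at hsame ⊢
        rw [r1, hc9, h8, hsame, hS'.real 1 (by decide), hS'.real 7 (by decide),
          hS'.real 0 (by decide), h30, h31]
      · simp [RExp.Legal, WExp.Legal, WExp.eval, h8, hc9]
        omega
    · simp only [WExp.cost, RExp.cost]; omega
    · intro s₄ _ h4
      ext i
      have e1 := h4.1 i i.2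
      have e2 : vec x.n (s₂.real 3) 0 i = _ := congrArg (fun v => v i) hI
      rw [weightedGram_apply] at e2
      rw [weightedGram_apply, sum_range_succ, PiLp.add_apply, vec_apply, e1, h33]
      simp only [vec_apply] at e2
      rw [e2, h3, PiLp.smul_apply, vec_apply, smul_eq_mul]
  · simp only [WExp.cost]; exact le_of_eq (by ring)

/-- One step of the power iteration: the vector `v` in the real array `2` becomes the new best
vector if this is an improvement, and is then replaced by its image under the operator. -/
def iterate : Prog :=
  .seq applyOp <| .seq (dot 9 8 2 (.const 0) 3 (.const 0)) <|
  .seq (dot 9 9 2 (.const 0) 2 (.const 0)) <| .seq (dot 9 10 3 (.const 0) 3 (.const 0)) <|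
  .seq (.ite (.and (.not (.realLE (.mul (.reg 8) (.reg 6)) (.mul (.reg 5) (.reg 9))))
      (.realLE (.mul (.cast (.mul (.reg 3) (.reg 3))) (.mul (.reg 10) (.reg 9)))
        (.mul (.cast (.add (.mul (.reg 3) (.reg 3)) (.const 1))) (.mul (.reg 8) (.reg 8)))))
    (.seq (copy 9 4 (.const 0) 2 (.const 0)) <|
      .seq (.setReal 5 (.const 0) (.reg 8)) (.setReal 6 (.const 0) (.reg 9)))
    .skip) <|
  copy 9 2 (.const 0) 3 (.const 0)

/-- The real registers `8`, `9`, `10` receive `⟪v, T v⟫`, `⟪v, v⟫` and `⟪T v, T v⟫`, all that the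
tests for improvement and alignment need. -/
theorem runs_iterate (hF : Fits x W L) (hs : s.word 3 0 = L) {c' : ℕ}
    {P P' : EuclideanSpace ℝ (Fin x.n) → Prop}
    (hP : ∀ y, P' y → P y ∨ y = vec x.n (s.real 2) 0)
    (hb : BestOf (s.op x.n L) L P (vec x.n (s.real 4) 0) (s.real 5 0) (s.real 6 0))
    (hc : 300 * (L + 1) * x.n ≤ c') :
    Runs x W iterate s c' fun s' =>
      vec x.n (s'.real 2) 0 = s.op x.n L (vec x.n (s.real 2) 0) ∧
      BestOf (s.op x.n L) L P' (vec x.n (s'.real 4) 0) (s'.real 5 0) (s'.real 6 0) := by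
  have hn := hF.n_le
  have hL := hF.L_le
  have hLL := hF.sq_le
  have hn1 := hF.one_le_n
  have hL1 := hF.one_le_L
  have hLn : L ≤ L * x.n := Nat.le_mul_of_pos_right _ hn1
  set v := vec x.n (s.real 2) 0 with hv
  refine Runs.seq (d := 164 * x.n + 125) (runs_applyOp hF hs le_rfl) ?_ (by nlinarith)
  intro s₁ hS1 h1
  have w1 : s₁.word 3 = s.word 3 := hS1.word 3 (by decide)
  have r1 : ∀ a ∈ [0, 1, 2, 4, 5, 6], s₁.real a = s.real a := fun a ha => hS1.real a (by
    have : ∀ a ∈ [0, 1, 2, 4, 5, 6], a ∉ applyOp.reals := by decide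
    exact this a ha)
  refine Runs.seq (c := 36 * x.n + 13) (d := 128 * x.n + 112)
    (runs_dot 0 0 (by decide) (by decide) (by omega) (by omega) (fun s' _ => const_zero_spec s')
      (fun s' _ => const_zero_spec s') (by decide) (by decide) le_rfl) ?_ (by omega)
  intro s₂ hS2 h2
  have w2 : s₂.word 3 = s.word 3 := by rw [hS2.word 3 (by decide), w1]
  have r2 : ∀ a ∉ [8], s₂.real a = s₁.real a := fun a ha => hS2.real a (by
    simpa [Prog.reals, dot, sumLoop, forLoop] using ha)
  refine Runs.seq (c := 36 * x.n + 13) (d := 92 * x.n + 99)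
    (runs_dot 0 0 (by decide) (by decide) (by omega) (by omega) (fun s' _ => const_zero_spec s')
      (fun s' _ => const_zero_spec s') (by decide) (by decide) le_rfl) ?_ (by omega)
  intro s₃ hS3 h3
  have w3 : s₃.word 3 = s.word 3 := by rw [hS3.word 3 (by decide), w2]
  have r3 : ∀ a ∉ [9], s₃.real a = s₂.real a := fun a ha => hS3.real a (by
    simpa [Prog.reals, dot, sumLoop, forLoop] using ha)
  refine Runs.seq (c := 36 * x.n + 13) (d := 56 * x.n + 86)
    (runs_dot 0 0 (by decide) (by decide) (by omega) (by omega) (fun s' _ => const_zero_spec s')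
      (fun s' _ => const_zero_spec s') (by decide) (by decide) le_rfl) ?_ (by omega)
  intro s₄ hS4 h4
  have w4 : s₄.word 3 0 = L := by rw [hS4.word 3 (by decide), w3, hs]
  have r4 : ∀ a ∉ [10], s₄.real a = s₃.real a := fun a ha => hS4.real a (by
    simpa [Prog.reals, dot, sumLoop, forLoop] using ha)
  have r41 : ∀ a ∉ [8, 9, 10], s₄.real a = s₁.real a := fun a ha => by
    simp at ha
    rw [r4 a (by simp [ha]), r3 a (by simp [ha]), r2 a (by simp [ha])]
  have e3 : vec x.n (s₁.real 3) 0 = s.op x.n L v := h1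
  have e8 : s₄.real 8 0 = ⟪v, s.op x.n L v⟫_ℝ := by
    rw [r4 8 (by decide), r3 8 (by decide), h2, r1 2 (by decide), e3]
  have e9 : s₄.real 9 0 = ⟪v, v⟫_ℝ := by
    rw [r4 9 (by decide), h3, r2 2 (by decide), r1 2 (by decide)]
  have e10 : s₄.real 10 0 = ⟪s.op x.n L v, s.op x.n L v⟫_ℝ := by
    rw [h4, r3 3 (by decide), r2 3 (by decide), e3]
  have e5 : s₄.real 5 = s.real 5 := by rw [r41 5 (by decide), r1 5 (by decide)]
  have e6 : s₄.real 6 = s.real 6 := by rw [r41 6 (by decide), r1 6 (by decide)]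
  have e4 : s₄.real 4 = s.real 4 := by rw [r41 4 (by decide), r1 4 (by decide)]
  have e2 : vec x.n (s₄.real 2) 0 = v := by rw [r41 2 (by decide), r1 2 (by decide)]
  refine Runs.seq (c := 28 * x.n + 9 + 8 + 40) (d := 28 * x.n + 9) (Q := fun s' =>
      BestOf (s.op x.n L) L P' (vec x.n (s'.real 4) 0) (s'.real 5 0) (s'.real 6 0))
    (Runs.ite (c := 28 * x.n + 9 + 8) ?_ ?_ ?_ (by simp [Test.cost, RExp.cost, WExp.cost]; omega))
    ?_ (by omega)
  · simp [Test.Legal, RExp.Legal, WExp.Legal, WExp.eval, w4]; omega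
  · intro hh
    simp only [Test.Holds, RExp.eval, WExp.eval, e8, e9, e10, e5, e6, w4, not_le] at hh
    push_cast at hh
    refine Runs.seq (c := 28 * x.n + 9) (d := 8) (runs_copy 0 0 (by decide) (by omega) (by omega)
      (fun s' _ => const_zero_spec s') (fun s' _ => const_zero_spec s') (by decide) (by decide)
      le_rfl) ?_ (by omega)
    rintro s₅ hS5 ⟨h5, -⟩
    have r5 : ∀ a ∉ [4], s₅.real a = s₄.real a := fun a ha => hS5.real a (by
      simpa [Prog.reals, copy, fill, forLoop] using ha)
    refine Runs.seq (c := 4) (d := 4) (Q := fun s' => s' = s₅.setReal 5 0 (s₅.real 8 0))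
      (Runs.setReal (by simp [WExp.Legal]) (by simp [RExp.Legal, WExp.Legal])
        (by simp [RExp.eval, WExp.eval]) (by simp [WExp.cost, RExp.cost])) ?_ (by omega)
    rintro s₆ - rfl
    refine Runs.setReal (by simp [WExp.Legal]) (by simp [RExp.Legal, WExp.Legal]) ?_
      (by simp [WExp.cost, RExp.cost])
    refine hb.step v hP (Or.inl ⟨hh.1, ?_, ?_, ?_, ?_⟩)
    · rw [Aligned, sq, sq]; exact hh.2
    · rw [← e2, ← h5]
      exact vec_congr fun c hc => by simp [Store.setReal_real]
    · simp [Store.setReal_real, WExp.eval, r5, e8]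
    · simp [Store.setReal_real, WExp.eval, RExp.eval, r5, e9]
  · intro hh
    simp only [Test.Holds, RExp.eval, WExp.eval, e8, e9, e10, e5, e6, w4, not_le] at hh
    push_cast at hh
    refine Runs.skip (hb.step v hP (Or.inr ⟨?_, by rw [e4], by rw [e5], by rw [e6]⟩)) (by omega)
    rintro ⟨g1, g2⟩
    refine hh ⟨g1, ?_⟩
    rw [Aligned] at g2
    rw [sq, sq] at g2
    linarith
  · intro s₅ hS5 h5
    refine (runs_copy 0 0 (by decide) (by omega) (by omega)
      (fun s' _ => const_zero_spec s') (fun s' _ => const_zero_spec s') (by decide) (by decide)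
      le_rfl).mono le_rfl ?_
    rintro s₆ hS6 ⟨h6, -⟩
    have r6 : ∀ a ∉ [2], s₆.real a = s₅.real a := fun a ha => hS6.real a (by
      simpa [Prog.reals, copy, fill, forLoop] using ha)
    have r53 : s₅.real 3 = s₄.real 3 := hS5.real 3 (by decide)
    refine ⟨by rw [h6, r53, r41 3 (by decide), e3], ?_⟩
    rw [r6 4 (by decide), r6 5 (by decide), r6 6 (by decide)]
    exact h5

/-- Find an approximate top eigenvector of the operator; it goes to the real array `4`, and the
numerator and the denominator of its Rayleigh quotient to the real registers `5` and `6`. -/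
def findBest : Prog :=
  .seq (fill 9 4 (.const 0) (.cast (.const 0))) <|
  .seq (.setReal 5 (.const 0) (.cast (.const 0))) <|
  .seq (.setReal 6 (.const 0) (.cast (.const 1))) <|
  forLoop 6 (.add (.reg 3) (.const 1)) <|
  .seq (copy 9 2 (.const 0) 0 (.rowOf 6)) <|
  forLoop 7 (.mul (.const 2) (.mul (.reg 3) (.reg 3))) iterate

theorem runs_findBest (hF : Fits x W L) (hs : s.word 3 0 = L) {c' : ℕ}
    (hc : 1000 * (L ^ 2 * (L + 1) ^ 2 * x.n) ≤ c') :
    Runs x W findBest s c' fun s' =>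
      IsBest (s.op x.n L) (row x.n (s.real 0)) L (vec x.n (s'.real 4) 0) (s'.real 5 0)
        (s'.real 6 0) := by
  have hn := hF.n_le
  have hL := hF.L_le
  have hLL := hF.sq_le
  have hn1 := hF.one_le_n
  have hL1 := hF.one_le_L
  set T := s.op x.n L with hT
  set v := row x.n (s.real 0) with hv
  set cI := 300 * (L + 1) * x.n with hcI
  set cK := 28 * x.n + 9 + (2 * (L * L) * (cI + 18) + 15) with hcK
  have hbound : 19 * x.n + 9 + (4 + (4 + ((L + 1) * (cK + 15) + 12))) ≤ c' := by
    refine le_trans ?_ hc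
    -- Written in the predecessors of `L` and `n`, both sides are polynomials with nonnegative
    -- coefficients that can be compared termwise.
    obtain ⟨l, rfl⟩ : ∃ l, L = l + 1 := ⟨L - 1, by omega⟩
    obtain ⟨m, hm⟩ : ∃ m, x.n = m + 1 := ⟨x.n - 1, by omega⟩
    rw [hcK, hcI, hm]
    ring_nf
    nlinarith [Nat.zero_le (l * m), Nat.zero_le (l ^ 2 * m), Nat.zero_le (l ^ 3 * m),
      Nat.zero_le (l ^ 4 * m), Nat.zero_le l, Nat.zero_le (l ^ 2), Nat.zero_le (l ^ 3),
      Nat.zero_le (l ^ 4), Nat.zero_le m]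
  refine Runs.seq (c := 19 * x.n + 9)
    (runs_fill 0 (fun _ => 0) (by omega) (fun s' _ => const_zero_spec s')
      (fun c _ s' _ _ _ => by simp [RExp.eval, WExp.eval, RExp.Legal, WExp.Legal])
      (by simp only [WExp.cost, RExp.cost]; omega)) ?_ hbound
  rintro s₁ hS1 ⟨h1, -⟩
  refine Runs.seq (c := 4) (Q := fun s' => s' = s₁.setReal 5 0 0)
    (Runs.setReal (by simp [WExp.Legal]) (by simp [RExp.Legal, WExp.Legal])
      (by simp [RExp.eval, WExp.eval]) (by simp [WExp.cost, RExp.cost])) ?_ le_rfl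
  rintro s₂ - hs2
  refine Runs.seq (c := 4) (Q := fun s' => s' = s₂.setReal 6 0 1)
    (Runs.setReal (by simp [WExp.Legal]) (by simp [RExp.Legal, WExp.Legal]; omega)
      (by simp [RExp.eval, WExp.eval]) (by simp [WExp.cost, RExp.cost])) ?_ le_rfl
  rintro s₃ - hs3
  have w3 : s₃.word 3 0 = L := by
    rw [hs3, hs2]; simp only [Store.setReal_word]
    rw [hS1.word 3 (by decide), hs]
  have r3 : ∀ a ∉ [4, 5, 6], s₃.real a = s.real a := fun a ha => by
    simp at ha
    rw [hs3, hs2]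
    funext j
    simp only [Store.setReal_real, ha, false_and, if_false]
    rw [hS1.real a (by simp [Prog.reals, fill, forLoop, ha])]
  have hbest : BestOf T L (fun z => ∃ k' s', (k' < 0 ∧ s' < 2 * (L * L)) ∧ z = (T ^ s') (v k'))
      (vec x.n (s₃.real 4) 0) (s₃.real 5 0) (s₃.real 6 0) := by
    refine ⟨Or.inl ⟨?_, ?_, ?_⟩, ?_⟩
    · ext i
      have := h1 i i.2
      simpa [hs3, hs2, Store.setReal_real] using this
    · simp [hs3, hs2, Store.setReal_real]
    · simp [hs3, Store.setReal_real]
    · rintro z ⟨k', s', ⟨h, -⟩, -⟩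
      omega
  refine (runs_forLoop (L + 1) cK (fun k s' =>
      BestOf T L (fun z => ∃ k' t, (k' < k ∧ t < 2 * (L * L)) ∧ z = (T ^ t) (v k'))
      (vec x.n (s'.real 4) 0) (s'.real 5 0) (s'.real 6 0))
    (by decide) ?_ (by omega) (fun k s' v h => h) hbest ?_
    (by simp only [WExp.cost]; exact le_of_eq (by ring))).mono
    le_rfl ?_
  · intro s' hS
    have : s'.word 3 0 = L := by rw [hS.word 3 (by decide), w3]
    simp [WExp.eval, WExp.Legal, this]; omega
  · intro k hk s₄ hS4 hk4 hI
    have w4 : s₄.word 3 0 = L := by rw [hS4.word 3 (by decide), w3]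
    have r4 : ∀ a ∈ [0, 1], s₄.real a = s.real a := fun a ha => by
      have h1 : ∀ a ∈ [0, 1], a ∉ (Prog.seq (copy 9 2 (.const 0) 0 (.rowOf 6)) <|
        forLoop 7 (.mul (.const 2) (.mul (.reg 3) (.reg 3))) iterate).reals := by decide
      have h2 : ∀ a ∈ [0, 1], a ∉ [4, 5, 6] := by decide
      rw [hS4.real a (h1 a ha), r3 a (h2 a ha)]
    have hkn := hF.row_le (k := k) (by omega)
    refine Runs.seq (c := 28 * x.n + 9) (runs_copy 0 (k * x.n) (by decide) (by omega) (by omega)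
      (fun s' _ => const_zero_spec s')
      (fun s' h => hF.rowOf (by rw [h.word 6 (by decide), hk4]) (by omega)) (by decide) (by decide)
      le_rfl) ?_ le_rfl
    rintro s₅ hS5 ⟨h5, -⟩
    have w5 : s₅.word 3 0 = L := by rw [hS5.word 3 (by decide), w4]
    have r5 : ∀ a ∉ [2], s₅.real a = s₄.real a := fun a ha => hS5.real a (by
      simpa [Prog.reals, copy, fill, forLoop] using ha)
    rw [r4 0 (by decide)] at h5
    -- The pairs (starting vector, number of iterations) are exhausted in lexicographic order.
    refine (runs_forLoop (2 * (L * L)) cI (fun t s' => vec x.n (s'.real 2) 0 = (T ^ t) (v k) ∧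
      BestOf T L (fun z => ∃ k' t', (k' < k ∧ t' < 2 * (L * L) ∨ k' = k ∧ t' < t) ∧
        z = (T ^ t') (v k')) (vec x.n (s'.real 4) 0) (s'.real 5 0) (s'.real 6 0))
      (by decide) ?_ (by omega) (fun k s' v h => h) ?_ ?_
      (by simp only [WExp.cost]; exact le_of_eq (by ring))).mono le_rfl ?_
    · intro s' hS
      have : s'.word 3 0 = L := by rw [hS.word 3 (by decide), w5]
      simp [WExp.eval, WExp.Legal, this]; omega
    · refine ⟨by simpa using h5, ?_⟩
      rw [r5 4 (by decide), r5 5 (by decide), r5 6 (by decide)]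
      refine ⟨hI.cases, ?_⟩
      rintro z ⟨k', t', h | h, rfl⟩
      · exact hI.max _ ⟨k', t', h, rfl⟩
      · omega
    · rintro t ht s₆ hS6 - ⟨h6, hb6⟩
      have w6 : s₆.word 3 0 = L := by rw [hS6.word 3 (by decide), w5]
      have hop : s₆.op x.n L = T := Store.op_congr x.n L
        (by rw [hS6.real 0 (by decide), r5 0 (by decide), r4 0 (by decide)])
        (by rw [hS6.real 1 (by decide), r5 1 (by decide), r4 1 (by decide)])
      refine (runs_iterate (P := fun z => ∃ k' t', (k' < k ∧ t' < 2 * (L * L) ∨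
        k' = k ∧ t' < t) ∧ z = (T ^ t') (v k')) (P' := fun z => ∃ k' t', (k' < k ∧
        t' < 2 * (L * L) ∨ k' = k ∧ t' < t + 1) ∧ z = (T ^ t') (v k')) hF w6 ?_
        (by rw [hop]; exact hb6) le_rfl).mono le_rfl ?_
      · rintro y ⟨k', t', h | ⟨rfl, h⟩, rfl⟩
        · exact Or.inl ⟨k', t', Or.inl h, rfl⟩
        · rcases Nat.lt_succ_iff_lt_or_eq.1 h with h | rfl
          · exact Or.inl ⟨k', t', Or.inr ⟨rfl, h⟩, rfl⟩
          · exact Or.inr h6.symm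
      · rintro s₇ - ⟨h7, hb7⟩
        rw [hop, h6] at h7
        rw [hop] at hb7
        exact ⟨by rw [h7, pow_succ', Module.End.mul_apply], hb7⟩
    · rintro s₆ - ⟨-, hb6⟩
      refine ⟨hb6.cases, ?_⟩
      rintro z ⟨k', t', ⟨h, h'⟩, rfl⟩
      rcases Nat.lt_succ_iff_lt_or_eq.1 h with h | rfl
      · exact hb6.max _ ⟨k', t', Or.inl ⟨h, h'⟩, rfl⟩
      · exact hb6.max _ ⟨k', t', Or.inr ⟨rfl, h'⟩, rfl⟩
  · intro s₄ _ h4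
    exact ⟨h4.cases, fun k hk t ht hal => h4.max _ ⟨k, t, ⟨hk, by rwa [sq] at ht⟩, rfl⟩ hal⟩

end RealRAM

/-! ### Program for one round of deflation. -/

namespace RealRAM

open Finset
open scoped InnerProductSpace

variable {x : Input} {W L : ℕ} {s : Store}

/-- Write the reciprocal of the real register `b` to the cell of the real array `a` given by the
word register `5`; write `0` instead if the real register `5` is not positive. -/
def invert (a b : ℕ) : Prog :=
  .ite (.realLE (.reg 5) (.cast (.const 0))) (.setReal a (.reg 5) (.cast (.const 0)))
    (.setReal a (.reg 5) (.div (.cast (.const 1)) (.reg b)))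

/-- The machine must avoid division by zero; the `0` stored instead agrees with `v⁻¹` for `v = 0`.
The sign of real register `5`, the numerator of the best vector, decides for both quantities
inverted. -/
theorem runs_invert {a b j : ℕ} {v : ℝ} (hj : s.word 5 0 = j) (hjW : j ≤ W) (hW : 1 ≤ W)
    (hv : s.real b 0 = v) (hrv : 0 < s.real 5 0 → v ≠ 0) (hrv' : ¬ 0 < s.real 5 0 → v = 0)
    {c' : ℕ} (hc : 13 ≤ c') :
    Runs x W (invert a b) s c' fun s' =>
      s'.real a j = v⁻¹ ∧ ∀ t, t ≠ j → s'.real a t = s.real a t := by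
  refine Runs.ite (c := 8) (by simp [Test.Legal, RExp.Legal, WExp.Legal]) ?_ ?_
    (by simp [Test.cost, RExp.cost, WExp.cost]; omega)
  · intro hh
    simp only [Test.Holds, RExp.eval, WExp.eval, Nat.cast_zero] at hh
    refine Runs.setReal (by simp [WExp.Legal, WExp.eval, hj, hjW])
      (by simp [RExp.Legal, WExp.Legal]) ⟨?_, ?_⟩ (by simp [WExp.cost, RExp.cost])
    · simp [Store.setReal_real, WExp.eval, RExp.eval, hj, hrv' (not_lt.2 hh)]
    · intro t ht
      simp [Store.setReal_real, WExp.eval, hj, ht]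
  · intro hh
    simp only [Test.Holds, RExp.eval, WExp.eval, Nat.cast_zero, not_le] at hh
    refine Runs.setReal (by simp [WExp.Legal, WExp.eval, hj, hjW])
      (by simp [RExp.Legal, WExp.Legal, RExp.eval, WExp.eval, hv, hrv hh, hW]) ⟨?_, ?_⟩
      (by simp [WExp.cost, RExp.cost])
    · simp [Store.setReal_real, WExp.eval, RExp.eval, hj, hv]
    · intro t ht
      simp [Store.setReal_real, WExp.eval, hj, ht]

/-- One round of deflation. -/
def deflate : Prog :=
  .seq findBest <| .seq (copy 9 2 (.const 0) 4 (.const 0)) <| .seq applyOp <|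
  .seq (copy 9 11 (.rowOf 5) 3 (.const 0)) <| .seq (dot 9 10 3 (.const 0) 3 (.const 0)) <|
  .seq (invert 12 5) <| .seq (invert 13 10) <|
  .seq (.setReal 14 (.const 0) (.div (.reg 5) (.reg 6))) <|
  forLoop 8 (.add (.reg 3) (.const 1)) <|
  .seq (dot 9 7 0 (.rowOf 8) 4 (.const 0)) <|
  fill 9 0 (.rowOf 8) (.sub (.cell 0 (.add (.rowOf 8) (.reg 9)))
    (.mul (.mul (.reg 7) (.cell 12 (.reg 5))) (.cell 3 (.reg 9))))

/-- Real arrays: `0` remaining vectors, `1` original weights, `11` pieces `u`, `12` coefficients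
`e`, `13` inverse squared norms `q`, `14` level `δ`. Finding the best vector dominates the cost. -/
theorem runs_deflate (hF : Fits x W L) (hs : s.word 3 0 = L) {j : ℕ} (hsj : s.word 5 0 = j)
    (hj : j < L) {v₀ : ℕ → EuclideanSpace ℝ (Fin x.n)} (hw : ∀ k < L + 1, 0 ≤ s.real 1 k)
    (hd : Deflated L (s.real 1) v₀ j (row x.n (s.real 0)) (row x.n (s.real 11)) (s.real 12)
      (s.real 13) (s.real 14 0)) {c' : ℕ} (hc : 1500 * (L ^ 2 * (L + 1) ^ 2 * x.n) ≤ c') :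
    Runs x W deflate s c' fun s' =>
      Deflated L (s.real 1) v₀ (j + 1) (row x.n (s'.real 0)) (row x.n (s'.real 11)) (s'.real 12)
      (s'.real 13) (s'.real 14 0) := by
  have hn := hF.n_le
  have hL := hF.L_le
  have hn1 := hF.one_le_n
  have hL1 := hF.one_le_L
  have hjn := hF.row_le (k := j) (by omega)
  set B := L ^ 2 * (L + 1) ^ 2 * x.n with hB
  have hbound : 1000 * B + (28 * x.n + 9 + (130 * (L + 1) * x.n + (28 * x.n + 9 + (36 * x.n + 13 +
      (13 + (13 + (7 + ((L + 1) * (75 * x.n + 37) + 12)))))))) ≤ c' := by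
    refine le_trans ?_ hc
    have h1 : 2 * ((L + 1) * x.n) ≤ B := by
      have e : L ^ 2 * (L + 1) ^ 2 * x.n = (L ^ 2 * (L + 1)) * ((L + 1) * x.n) := by ring
      rw [hB, e]
      exact Nat.mul_le_mul_right _ (by nlinarith)
    have h2 : x.n ≤ L * x.n := Nat.le_mul_of_pos_left _ hL1
    have h3 : L ≤ L * x.n := Nat.le_mul_of_pos_right _ hn1
    have h4 : (L + 1) * (75 * x.n + 37) = 75 * (L * x.n) + 37 * L + 75 * x.n + 37 := by ring
    have h5 : (L + 1) * x.n = L * x.n + x.n := by ring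
    have h6 : 130 * (L + 1) * x.n = 130 * (L * x.n) + 130 * x.n := by ring
    omega
  refine Runs.seq (runs_findBest hF hs le_rfl) ?_ hbound
  intro s₁ hS1 hbest
  set v := row x.n (s.real 0) with hv
  set b := vec x.n (s₁.real 4) 0 with hb
  have w1 : s₁.word 3 = s.word 3 := hS1.word 3 (by decide)
  have w1' : s₁.word 5 = s.word 5 := hS1.word 5 (by decide)
  have r1 : ∀ a ∈ [0, 1, 11, 12, 13], s₁.real a = s.real a := fun a ha => hS1.real a (by
    have : ∀ a ∈ [0, 1, 11, 12, 13], a ∉ findBest.reals := by decide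
    exact this a ha)
  refine Runs.seq (c := 28 * x.n + 9) (runs_copy 0 0 (by decide) (by omega) (by omega)
    (fun s' _ => const_zero_spec s') (fun s' _ => const_zero_spec s') (by decide) (by decide)
    le_rfl) ?_ le_rfl
  rintro s₂ hS2 ⟨h2, -⟩
  have w2 : s₂.word 3 0 = L := by rw [hS2.word 3 (by decide), w1, hs]
  have w2' : s₂.word 5 0 = j := by rw [hS2.word 5 (by decide), w1', hsj]
  have r2 : ∀ a ∉ [2], s₂.real a = s₁.real a := fun a ha => hS2.real a (by
    simpa [Prog.reals, copy, fill, forLoop] using ha)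
  have hop : s₂.op x.n L = s.op x.n L := Store.op_congr x.n L
    (by rw [r2 0 (by decide), r1 0 (by decide)]) (by rw [r2 1 (by decide), r1 1 (by decide)])
  refine Runs.seq (runs_applyOp hF w2 le_rfl) ?_ le_rfl
  intro s₃ hS3 h3
  rw [hop, h2] at h3
  have w3 : s₃.word 3 0 = L := by rw [hS3.word 3 (by decide), w2]
  have w3' : s₃.word 5 0 = j := by rw [hS3.word 5 (by decide), w2']
  have r3 : ∀ a ∉ [3, 7], s₃.real a = s₂.real a := fun a ha => hS3.real a (by
    simp at ha; simp [Prog.reals, applyOp, dot, sumLoop, fill, forLoop, ha])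
  refine Runs.seq (c := 28 * x.n + 9) (runs_copy (j * x.n) 0 (by decide) (by omega) (by omega)
    (fun s' h => hF.rowOf (by rw [h.word 5 (by decide), w3']) (by omega))
    (fun s' _ => const_zero_spec s') (by decide) (by decide) le_rfl) ?_ le_rfl
  rintro s₄ hS4 ⟨h4, h4'⟩
  have w4 : s₄.word 3 0 = L := by rw [hS4.word 3 (by decide), w3]
  have w4' : s₄.word 5 0 = j := by rw [hS4.word 5 (by decide), w3']
  have r4 : ∀ a ∉ [11], s₄.real a = s₃.real a := fun a ha => hS4.real a (by
    simpa [Prog.reals, copy, fill, forLoop] using ha)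
  refine Runs.seq (c := 36 * x.n + 13)
    (runs_dot 0 0 (by decide) (by decide) (by omega) (by omega) (fun s' _ => const_zero_spec s')
      (fun s' _ => const_zero_spec s') (by decide) (by decide) le_rfl) ?_ le_rfl
  intro s₅ hS5 h5
  have w5 : s₅.word 3 0 = L := by rw [hS5.word 3 (by decide), w4]
  have w5' : s₅.word 5 0 = j := by rw [hS5.word 5 (by decide), w4']
  have r5 : ∀ a ∉ [10], s₅.real a = s₄.real a := fun a ha => hS5.real a (by
    simpa [Prog.reals, dot, sumLoop, forLoop] using ha)
  set u := s.op x.n L b with hu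
  set num := s₁.real 5 0 with hnum
  set den := s₁.real 6 0 with hden
  have r51 : ∀ a ∉ [2, 3, 7, 10, 11], s₅.real a = s₁.real a := fun a ha => by
    simp at ha
    rw [r5 a (by simp [ha]), r4 a (by simp [ha]), r3 a (by simp [ha]), r2 a (by simp [ha])]
  have e5 : s₅.real 5 0 = num := by rw [r51 5 (by decide)]
  have e6 : s₅.real 6 0 = den := by rw [r51 6 (by decide)]
  have e4 : vec x.n (s₅.real 4) 0 = b := by rw [r51 4 (by decide)]
  have e3 : vec x.n (s₅.real 3) 0 = u := by rw [r5 3 (by decide), r4 3 (by decide), h3]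
  have e10 : s₅.real 10 0 = ⟪u, u⟫_ℝ := by rw [h5, r4 3 (by decide), h3]
  have hnn := hbest.num_nonneg
  have hne := hbest.num_eq
  have hu0 : ¬ 0 < num → u = 0 := fun h => by
    rcases hbest.cases with h1 | h1
    · rw [hu, h1.1, map_zero]
    · exact absurd h1.1 h
  have hu1 : 0 < num → ⟪u, u⟫_ℝ ≠ 0 := fun h h0 => by
    have : u = 0 := by simpa using h0
    rw [hne, ← hu, this, inner_zero_right] at h
    exact lt_irrefl _ h
  refine Runs.seq (c := 13) (runs_invert (v := num) w5' (by omega) (by omega) e5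
    (fun h => (e5 ▸ h).ne') (fun h => le_antisymm (not_lt.1 (e5 ▸ h)) hnn) le_rfl) ?_
    le_rfl
  rintro s₆ hS6 ⟨h6, h6'⟩
  have w6 : s₆.word 3 0 = L := by rw [hS6.word 3 (by decide), w5]
  have w6' : s₆.word 5 0 = j := by rw [hS6.word 5 (by decide), w5']
  have r6 : ∀ a ∉ [12], s₆.real a = s₅.real a := fun a ha => hS6.real a (by
    simpa [Prog.reals, invert] using ha)
  refine Runs.seq (c := 13) (runs_invert (v := ⟪u, u⟫_ℝ) w6' (by omega) (by omega)
    (by rw [r6 10 (by decide), e10])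
    (fun h => hu1 (by rwa [r6 5 (by decide), e5] at h))
    (fun h => by rw [hu0 (by rwa [r6 5 (by decide), e5] at h), inner_zero_left]) le_rfl)
    ?_ le_rfl
  rintro s₇ hS7 ⟨h7, h7'⟩
  have w7 : s₇.word 3 0 = L := by rw [hS7.word 3 (by decide), w6]
  have w7' : s₇.word 5 0 = j := by rw [hS7.word 5 (by decide), w6']
  have r7 : ∀ a ∉ [13], s₇.real a = s₆.real a := fun a ha => hS7.real a (by
    simpa [Prog.reals, invert] using ha)
  refine Runs.seq (c := 7) (Q := fun s' => s' = s₇.setReal 14 0 (num / den))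
    (Runs.setReal (by simp [WExp.Legal]) ?_ ?_ (by simp [WExp.cost, RExp.cost])) ?_ le_rfl
  · simp only [RExp.Legal, WExp.Legal, RExp.eval, WExp.eval, Nat.zero_le, true_and]
    rw [r7 6 (by decide), r6 6 (by decide), e6]
    exact hbest.den_pos.ne'
  · simp only [RExp.eval, WExp.eval]
    rw [r7 6 (by decide), r6 6 (by decide), e6, r7 5 (by decide), r6 5 (by decide), e5]
  rintro s₈ - hs8
  have r8 : ∀ a ∉ [14], s₈.real a = s₇.real a := fun a ha => by
    funext t
    simp at ha
    rw [hs8, Store.setReal_real, if_neg (by simp [ha])]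
  have w8 : s₈.word 3 0 = L := by rw [hs8, Store.setReal_word, w7]
  have w8' : s₈.word 5 0 = j := by rw [hs8, Store.setReal_word, w7']
  have r85 : ∀ a ∉ [12, 13, 14], s₈.real a = s₅.real a := fun a ha => by
    simp at ha
    rw [r8 a (by simp [ha]), r7 a (by simp [ha]), r6 a (by simp [ha])]
  have f0 : s₈.real 0 = s.real 0 := by
    rw [r85 0 (by decide), r51 0 (by decide), r1 0 (by decide)]
  have f12 : s₈.real 12 j = num⁻¹ := by rw [r8 12 (by decide), r7 12 (by decide), h6]
  have f3 : vec x.n (s₈.real 3) 0 = u := by rw [r85 3 (by decide), e3]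
  have f4 : vec x.n (s₈.real 4) 0 = b := by rw [r85 4 (by decide), e4]
  -- The rows are overwritten one at a time, while `b` and `u` stay in real arrays `4` and `3`; so
  -- each new row depends only on its own old value.
  refine (runs_forLoop (L + 1) (75 * x.n + 22) (fun k s' =>
      (∀ p < k, row x.n (s'.real 0) p = v p - (⟪v p, b⟫_ℝ * num⁻¹) • u) ∧
      ∀ p, k ≤ p → row x.n (s'.real 0) p = v p) (by decide) ?_ (by omega) (fun k s' v h => h)
      ⟨fun p hp => absurd hp (Nat.not_lt_zero _), fun p _ => by rw [f0]⟩ ?_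
      (by simp only [WExp.cost]; exact le_of_eq (by ring))).mono le_rfl ?_
  · intro s' hS
    have : s'.word 3 0 = L := by rw [hS.word 3 (by decide), w8]
    simp [WExp.eval, WExp.Legal, this]; omega
  · rintro k hk t₁ hT1 hk1 ⟨hI1, hI2⟩
    have hkn := hF.row_le (k := k) (by omega)
    have q1 : ∀ a ∉ [0, 7], t₁.real a = s₈.real a := fun a ha => hT1.real a (by
      simp at ha; simp [Prog.reals, dot, sumLoop, fill, forLoop, ha])
    have hw1 : t₁.word 5 0 = j := by rw [hT1.word 5 (by decide), w8']
    refine Runs.seq (c := 36 * x.n + 13) (d := 39 * x.n + 9)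
      (runs_dot (k * x.n) 0 (by decide) (by decide) (by omega) (by omega)
        (fun s' h => hF.rowOf (by rw [h.word 8 (by decide), hk1]) (by omega))
        (fun s' _ => const_zero_spec s') (by decide) (by decide) le_rfl) ?_ (by omega)
    intro t₂ hT2 g2
    rw [show vec x.n (t₁.real 0) (k * x.n) = v k from hI2 k le_rfl, q1 4 (by decide), f4] at g2
    have q2 : ∀ a ∉ [7], t₂.real a = t₁.real a := fun a ha => hT2.real a (by
      simpa [Prog.reals, dot, sumLoop, forLoop] using ha)
    have hk2 : t₂.word 8 0 = k := by rw [hT2.word 8 (by decide), hk1]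
    have hw2 : t₂.word 5 0 = j := by rw [hT2.word 5 (by decide), hw1]
    refine (runs_fill (k * x.n) (fun c => t₂.real 0 (k * x.n + c) -
        t₂.real 7 0 * t₂.real 12 j * t₂.real 3 c) (by omega)
      (fun s' h => hF.rowOf (by rw [h.word 8 (by decide), hk2]) (by omega)) ?_ ?_).mono le_rfl ?_
    · intro c hc s' hS' hc9 hsame
      have h8 : s'.word 8 0 = k := by rw [hS'.word 8 (by decide), hk2]
      have h5 : s'.word 5 0 = j := by rw [hS'.word 5 (by decide), hw2]
      obtain ⟨p1, p2⟩ := hF.rowOf (s := s') h8 (by omega)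
      constructor
      · simp only [RExp.eval, WExp.eval] at p1 ⊢
        rw [p1, hc9, h5, hsame, hS'.real 7 (by decide), hS'.real 12 (by decide),
          hS'.real 3 (by decide)]
      · simp [RExp.Legal, WExp.Legal, WExp.eval, h8, hc9, h5]
        omega
    · simp only [WExp.cost, RExp.cost]; omega
    · rintro t₃ - ⟨g3, g3'⟩
      refine ⟨fun p hp => ?_, fun p hp => ?_⟩
      · rcases Nat.lt_succ_iff_lt_or_eq.1 hp with hp | rfl
        · rw [row_congr hp.ne g3', q2 0 (by decide), hI1 p hp]
        · ext i
          have e := g3 i i.2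
          have hI2' := congrArg (fun y => y i) (hI2 p le_rfl)
          have f3' := congrArg (fun y => y i) f3
          simp only [vec_apply, zero_add] at hI2' f3'
          rw [vec_apply, e, g2, q2 0 (by decide), q2 12 (by decide), q2 3 (by decide),
            q1 12 (by decide), q1 3 (by decide), f12, hI2', f3']
          simp
      · rw [row_congr (by omega) g3', q2 0 (by decide), hI2 p (by omega)]
  · rintro s₉ hS9 ⟨h9, -⟩
    have r9 : ∀ a ∉ [0, 7], s₉.real a = s₈.real a := fun a ha => hS9.real a (by
      simp at ha; simp [Prog.reals, dot, sumLoop, fill, forLoop, ha])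
    have f11 : s₉.real 11 = s₄.real 11 := by
      rw [r9 11 (by decide), r85 11 (by decide), r5 11 (by decide)]
    have f12' : s₉.real 12 = s₆.real 12 := by
      rw [r9 12 (by decide), r8 12 (by decide), r7 12 (by decide)]
    have f13 : s₉.real 13 = s₇.real 13 := by
      rw [r9 13 (by decide), r8 13 (by decide)]
    have g11 : row x.n (s₉.real 11) j = u := by rw [f11]; exact h4.trans h3
    refine hd.succ hL1 hw hbest (fun t ht => ?_) g11 (fun t ht => ?_) (by rw [f12', h6])
      (fun t ht => ?_) (by rw [f13, h7, g11]) ?_ (fun k hk => ?_)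
    · rw [f11, row_congr ht.ne h4', r3 11 (by decide), r2 11 (by decide), r1 11 (by decide)]
    · rw [f12', h6' t ht.ne, r51 12 (by decide), r1 12 (by decide)]
    · rw [f13, h7' t ht.ne, r6 13 (by decide), r51 13 (by decide), r1 13 (by decide)]
    · rw [r9 14 (by decide), hs8]; simp [Store.setReal_real]
    · rw [h9 k hk, f12', h6, g11]

end RealRAM

/-! ### Program for the insertion of a row. -/

namespace RealRAM

open Finset
open scoped InnerProductSpace

variable {x : Input} {W L : ℕ} {s : Store}

/-- The row `i` of the input matrix. -/
noncomputable def Input.row (x : Input) (i : ℕ) : EuclideanSpace ℝ (Fin x.n) :=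
  WithLp.toLp 2 fun k => x.entry i k

/-- Insert the row of the input matrix given by the word register `4` into the sketch. -/
def insertRow : Prog :=
  .seq (fill 9 0 (.rowOf 3) (.entry (.reg 4) (.reg 9))) <|
  .seq (.setReal 1 (.reg 3) (.cast (.const 1))) <|
  .seq (forLoop 5 (.reg 3) deflate) <|
  forLoop 5 (.reg 3) <|
  .seq (copy 9 0 (.rowOf 5) 11 (.rowOf 5)) <|
  .setReal 1 (.reg 5) (.sub (.cell 12 (.reg 5))
    (.mul (.div (.reg 14) (.cast (.const 2))) (.cell 13 (.reg 5))))

/-- The new row occupies slot `L` with weight `1`. Values left in arrays `11` to `14` by earlier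
rows are harmless, as `Deflated.zero` asks nothing of them. -/
theorem runs_insertRow (hF : Fits x W L) (hs : s.word 3 0 = L) {i : ℕ} (hsi : s.word 4 0 = i)
    (hi : i < x.n) (hd : IsSketch L x.row i (s.real 1) (row x.n (s.real 0))) {c' : ℕ}
    (hc : 2000 * (L * (L ^ 2 * (L + 1) ^ 2 * x.n)) ≤ c') :
    Runs x W insertRow s c' fun s' =>
      IsSketch L x.row (i + 1) (s'.real 1) (row x.n (s'.real 0)) := by
  have hn := hF.n_le
  have hL := hF.L_le
  have hn1 := hF.one_le_n
  have hL1 := hF.one_le_L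
  have hLn := hF.row_le (k := L) le_rfl
  set B := L ^ 2 * (L + 1) ^ 2 * x.n with hB
  have hbound : 25 * x.n + 9 + (5 + (L * (1500 * B + 13) + 10 + (L * (28 * x.n + 38) + 10))) ≤
      c' := by
    refine le_trans ?_ hc
    have h1 : 4 * x.n ≤ B := Nat.mul_le_mul_right _ (le_trans (by norm_num)
      (Nat.mul_le_mul (Nat.pow_le_pow_left hL1 2) (Nat.pow_le_pow_left (by omega : 2 ≤ L + 1) 2)))
    have h2 : x.n ≤ L * x.n := Nat.le_mul_of_pos_left _ hL1
    have h3 : L ≤ L * x.n := Nat.le_mul_of_pos_right _ hn1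
    have h4 : L * (4 * x.n) ≤ L * B := Nat.mul_le_mul_left _ h1
    have h5 : L * (1500 * B + 13) = 1500 * (L * B) + 13 * L := by ring
    have h6 : L * (28 * x.n + 38) = 28 * (L * x.n) + 38 * L := by ring
    have h7 : L * (4 * x.n) = 4 * (L * x.n) := by ring
    omega
  refine Runs.seq (c := 25 * x.n + 9) (runs_fill (L * x.n) (fun c => x.entry i c) (by omega)
    (fun s' h => hF.rowOf (by rw [h.word 3 (by decide), hs]) le_rfl) ?_
    (by simp only [WExp.cost, RExp.cost]; omega)) ?_ hbound
  · intro c hc s' hS' hc9 _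
    have h4 : s'.word 4 0 = i := by rw [hS'.word 4 (by decide), hsi]
    constructor
    · simp [RExp.eval, WExp.eval, h4, hc9]
    · simp [RExp.Legal, WExp.Legal, WExp.eval, h4, hc9]; omega
  rintro s₁ hS1 ⟨h1, h1'⟩
  have w1 : s₁.word 3 0 = L := by rw [hS1.word 3 (by decide), hs]
  have r1 : s₁.real 1 = s.real 1 := hS1.real 1 (by decide)
  refine Runs.seq (c := 5) (Q := fun s' => s' = s₁.setReal 1 L 1)
    (Runs.setReal (by simp [WExp.Legal, WExp.eval, w1]; omega)
      (by simp [RExp.Legal, WExp.Legal]; omega)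
      (by simp [RExp.eval, WExp.eval, w1]) (by simp [WExp.cost, RExp.cost])) ?_ le_rfl
  rintro s₂ - hs2
  have w2 : s₂.word 3 0 = L := by rw [hs2, Store.setReal_word, w1]
  have f0 : s₂.real 0 = s₁.real 0 := by
    funext t; rw [hs2, Store.setReal_real, if_neg (by simp)]
  have f1L : s₂.real 1 L = 1 := by rw [hs2, Store.setReal_real, if_pos (by simp)]
  have f1 : ∀ k < L, s₂.real 1 k = s.real 1 k := fun k hk => by
    rw [hs2, Store.setReal_real, if_neg (by simp; omega), r1]
  have hw : ∀ k < L + 1, 0 ≤ s₂.real 1 k := fun k hk => by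
    rcases Nat.lt_succ_iff_lt_or_eq.1 hk with hk | rfl
    · rw [f1 k hk]; exact hd.weight_nonneg k hk
    · rw [f1L]; exact zero_le_one
  refine Runs.seq (c := L * (1500 * B + 13) + 10)
    (runs_forLoop L (1500 * B) (fun j s' => Deflated L (s₂.real 1) (row x.n (s₂.real 0)) j
      (row x.n (s'.real 0)) (row x.n (s'.real 11)) (s'.real 12) (s'.real 13) (s'.real 14 0))
      (by decide) ?_ (by omega) (fun k s' v h => h) (Deflated.zero _ _ _ _ _ _ _) ?_
      (by simp only [WExp.cost]; exact le_of_eq (by ring))) ?_ le_rfl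
  · intro s' hS
    have : s'.word 3 0 = L := by rw [hS.word 3 (by decide), w2]
    simp [WExp.eval, WExp.Legal, this]; omega
  · intro j hj s₃ hS3 hj3 hd3
    have w3 : s₃.word 3 0 = L := by rw [hS3.word 3 (by decide), w2]
    have r3 : s₃.real 1 = s₂.real 1 := hS3.real 1 (by decide)
    rw [← r3] at hd3
    refine (runs_deflate hF w3 hj3 hj (r3 ▸ hw) hd3 le_rfl).mono le_rfl fun s' _ h => ?_
    rwa [r3] at h
  intro s₃ hS3 hd3
  have w3 : s₃.word 3 0 = L := by rw [hS3.word 3 (by decide), w2]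
  refine (runs_forLoop L (28 * x.n + 25) (fun j s' =>
      (∀ k < j, s'.real 1 k = s₃.real 12 k - s₃.real 14 0 / 2 * s₃.real 13 k) ∧
      ∀ k < j, row x.n (s'.real 0) k = row x.n (s₃.real 11) k) (by decide) ?_ (by omega)
      (fun k s' v h => h) ⟨fun k hk => absurd hk (Nat.not_lt_zero _),
        fun k hk => absurd hk (Nat.not_lt_zero _)⟩ ?_
      (by simp only [WExp.cost]; exact le_of_eq (by ring))).mono le_rfl ?_
  · intro s' hS
    have : s'.word 3 0 = L := by rw [hS.word 3 (by decide), w3]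
    simp [WExp.eval, WExp.Legal, this]; omega
  · rintro j hj s₄ hS4 hj4 ⟨hI1, hI2⟩
    have hjn := hF.row_le (k := j) (by omega)
    have r4 : ∀ a ∉ [0, 1], s₄.real a = s₃.real a := fun a ha => hS4.real a (by
      simp at ha; simp [Prog.reals, copy, fill, forLoop, ha])
    refine Runs.seq (c := 28 * x.n + 9) (d := 16) (runs_copy (j * x.n) (j * x.n) (by decide)
      (by omega) (by omega) (fun s' h => hF.rowOf (by rw [h.word 5 (by decide), hj4]) (by omega))
      (fun s' h => hF.rowOf (by rw [h.word 5 (by decide), hj4]) (by omega)) (by decide) (by decide)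
      le_rfl) ?_ (by omega)
    rintro s₅ hS5 ⟨h5, h5'⟩
    have w5 : s₅.word 5 0 = j := by rw [hS5.word 5 (by decide), hj4]
    have r5 : ∀ a ∉ [0], s₅.real a = s₄.real a := fun a ha => hS5.real a (by
      simpa [Prog.reals, copy, fill, forLoop] using ha)
    have hleg : 2 ≤ W := by omega
    have hjW : j ≤ W := by omega
    refine Runs.setReal (by simp [WExp.Legal, WExp.eval, w5, hjW])
      (by simp [RExp.Legal, WExp.Legal, RExp.eval, WExp.eval, w5, hleg, hjW]) ⟨?_, ?_⟩
      (by simp [WExp.cost, RExp.cost])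
    · intro k hk
      simp only [RExp.eval, WExp.eval, w5, Store.setReal_real]
      rcases Nat.lt_succ_iff_lt_or_eq.1 hk with hk | rfl
      · rw [if_neg (by omega), r5 1 (by decide), hI1 k hk]
      · rw [if_pos (by simp), r5 12 (by decide), r5 13 (by decide), r5 14 (by decide),
          r4 12 (by decide), r4 13 (by decide), r4 14 (by decide)]
        norm_num
    · intro k hk
      have e : ∀ v, (s₅.setReal 1 (WExp.eval x s₅ (.reg 5)) v).real 0 = s₅.real 0 := fun v => by
        funext t; rw [Store.setReal_real, if_neg (by simp)]
      rw [e]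
      rcases Nat.lt_succ_iff_lt_or_eq.1 hk with hk | rfl
      · rw [row_congr hk.ne h5', hI2 k hk]
      · exact h5.trans (by rw [r4 11 (by decide)])
  · rintro s₄ - ⟨h4, h4'⟩
    refine hd.succ hL1 f1 f1L (fun k hk => ?_) ?_ hd3 h4 h4'
    · rw [f0, row_congr hk.ne h1']
    · rw [f0]
      ext c
      exact h1 c c.2

/-! ### Programs for rounding a vector to a cut. -/

/-- Write the row sums of a matrix, given by an expression in terms of the counters `8` and `9`, to
the real array `a`. -/
def rowSums (a : ℕ) (e : RExp) : Prog :=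
  forLoop 8 .size (.seq (sumLoop 9 7 .size e) (.setReal a (.reg 8) (.reg 7)))

theorem runs_rowSums (hF : Fits x W L) {a : ℕ} {e : RExp} (g : ℕ → ℕ → ℝ) (ha : a ≠ 7)
    (he : ∀ k < x.n, ∀ c < x.n, ∀ s', Same [8, 9] [7, a] s s' → s'.word 8 0 = k →
      s'.word 9 0 = c → e.eval x s' = g k c ∧ e.Legal x W s')
    (hce : e.cost ≤ 10) {c' : ℕ} (hc : 27 * x.n ^ 2 + 30 * x.n + 9 ≤ c') :
    Runs x W (rowSums a e) s c' fun s' => ∀ k < x.n, s'.real a k = ∑ c ∈ range x.n, g k c := by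
  have hn := hF.n_le
  refine runs_forLoop x.n (x.n * 27 + 18) (fun j s' =>
    ∀ k < j, s'.real a k = ∑ c ∈ range x.n, g k c) (by simp [Prog.words, sumLoop, forLoop]) ?_
    (by omega) (fun k s' v h => h) (fun k hk => absurd hk (Nat.not_lt_zero _)) ?_ ?_
  · intro s' _; simp [WExp.eval, WExp.Legal]; omega
  · intro k hk s₁ hS1 hk1 hI
    have hS1' : Same [8, 9] [7, a] s s₁ :=
      hS1.mono (by simp [Prog.words, sumLoop, forLoop]) (by simp [Prog.reals, sumLoop, forLoop])
    refine Runs.seq (c := x.n * 27 + 13) (d := 5) (runs_sumLoop x.n (g k) (by omega) ?_ ?_ ?_) ?_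
      (by omega)
    · intro s' _; simp [WExp.eval, WExp.Legal]; omega
    · intro c hc s' hS' hc9
      exact he k hk c hc s' (hS1'.trans (hS'.mono (by simp) (by simp)))
        (by rw [hS'.word 8 (by decide), hk1]) hc9
    · simp only [WExp.cost]; nlinarith
    · intro s₂ hS2 h2
      have w2 : s₂.word 8 0 = k := by
        rw [hS2.word 8 (by simp [Prog.words, sumLoop, forLoop]), hk1]
      have r2 : s₂.real a = s₁.real a := hS2.real a (by simp [Prog.reals, sumLoop, forLoop, ha])
      refine Runs.setReal (by simp [WExp.Legal, WExp.eval, w2]; omega)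
        (by simp [RExp.Legal, WExp.Legal]) ?_ (by simp [WExp.cost, RExp.cost])
      intro l hl
      simp only [RExp.eval, WExp.eval, w2, Store.setReal_real]
      rcases Nat.lt_succ_iff_lt_or_eq.1 hl with hl | rfl
      · rw [if_neg (by omega), r2, hI l hl]
      · rw [if_pos (by simp), h2]
  · simp only [WExp.cost]; refine le_trans (le_of_eq ?_) hc; ring

/-- Mark the nonnegative entries of the real array `a` by `p` and the negative ones by `q`. -/
def markSigns (a d p q : ℕ) : Prog :=
  forLoop 8 .size (.ite (.realLE (.cast (.const 0)) (.cell a (.reg 8)))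
    (.setWord d (.reg 8) (.const p)) (.setWord d (.reg 8) (.const q)))

theorem runs_markSigns (hF : Fits x W L) {a d p q : ℕ} (hd : d ≠ 8) (hp : p ≤ 1) (hq : q ≤ 1)
    {c' : ℕ} (hc : 22 * x.n + 9 ≤ c') :
    Runs x W (markSigns a d p q) s c' fun s' =>
      ∀ i < x.n, s'.word d i = if 0 ≤ s.real a i then p else q := by
  have hn := hF.n_le
  refine runs_forLoop x.n 10 (fun j s' => ∀ i < j, s'.word d i = if 0 ≤ s.real a i then p else q)
    (by simp [Prog.words, hd.symm]) ?_ (by omega) ?_ (fun k hk => absurd hk (Nat.not_lt_zero _)) ?_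
    (by simp only [WExp.cost]; omega)
  · intro s' _; simp [WExp.eval, WExp.Legal]; omega
  · intro k s' v h i hi
    rw [Store.setWord_word, if_neg (by simp [hd])]; exact h i hi
  · intro k hk s₁ hS1 hk1 hI
    have r1 : s₁.real a = s.real a := hS1.real a (by simp [Prog.reals])
    have hkW : k ≤ W := by omega
    have key : ∀ r, r = (if 0 ≤ s.real a k then p else q) → ∀ i < k + 1,
        (s₁.setWord d k r).word d i = if 0 ≤ s.real a i then p else q := fun r hr i hi => by
      rw [Store.setWord_word]
      rcases Nat.lt_succ_iff_lt_or_eq.1 hi with hi | rfl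
      · rw [if_neg (by omega), hI i hi]
      · rw [if_pos ⟨rfl, rfl⟩, hr]
    refine Runs.ite (c := 4) (by simp [Test.Legal, RExp.Legal, WExp.Legal, WExp.eval, hk1, hkW])
      ?_ ?_ (by simp [Test.cost, RExp.cost, WExp.cost])
    · intro hh
      simp only [Test.Holds, RExp.eval, WExp.eval, Nat.cast_zero, hk1, r1] at hh
      refine Runs.setWord (by simp [WExp.Legal, WExp.eval, hk1, hkW])
        (by simp [WExp.Legal]; omega) ?_ (by simp [WExp.cost])
      simp only [WExp.eval, hk1]
      exact key p (by rw [if_pos hh])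
    · intro hh
      simp only [Test.Holds, RExp.eval, WExp.eval, Nat.cast_zero, hk1, r1] at hh
      refine Runs.setWord (by simp [WExp.Legal, WExp.eval, hk1, hkW])
        (by simp [WExp.Legal]; omega) ?_ (by simp [WExp.cost])
      simp only [WExp.eval, hk1]
      exact key q (by rw [if_neg hh])

/-- Mark the set of the nonnegative entries, or the set of the negative entries, of the real
array `a`, whichever has the larger sum of absolute values. -/
def signSet (a d : ℕ) : Prog :=
  .seq (.setReal 19 (.const 0) (.cast (.const 0))) <|
  .seq (.setReal 20 (.const 0) (.cast (.const 0))) <|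
  .seq (forLoop 8 .size (.ite (.realLE (.cast (.const 0)) (.cell a (.reg 8)))
    (.setReal 19 (.const 0) (.add (.reg 19) (.cell a (.reg 8))))
    (.setReal 20 (.const 0) (.sub (.reg 20) (.cell a (.reg 8)))))) <|
  .ite (.realLE (.reg 20) (.reg 19)) (markSigns a d 1 0) (markSigns a d 0 1)

theorem runs_signSet (hF : Fits x W L) {a d : ℕ} (ha : a ∉ [19, 20]) (hd : d ≠ 8) {c' : ℕ}
    (hc : 48 * x.n + 31 ≤ c') :
    Runs x W (signSet a d) s c' fun s' =>
      ((∑ i ∈ range x.n, if 0 ≤ s.real a i then 0 else -s.real a i) ≤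
          ∑ i ∈ range x.n, (if 0 ≤ s.real a i then s.real a i else 0) ∧
        ∀ i < x.n, s'.word d i = if 0 ≤ s.real a i then 1 else 0) ∨
      ((∑ i ∈ range x.n, if 0 ≤ s.real a i then s.real a i else 0) ≤
          ∑ i ∈ range x.n, (if 0 ≤ s.real a i then 0 else -s.real a i) ∧
        ∀ i < x.n, s'.word d i = if 0 ≤ s.real a i then 0 else 1) := by
  have hn := hF.n_le
  simp only [List.mem_cons, List.not_mem_nil, or_false, not_or] at ha
  refine Runs.seq (c := 4) (d := 48 * x.n + 27) (Q := fun s' => s' = s.setReal 19 0 0)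
    (Runs.setReal (by simp [WExp.Legal]) (by simp [RExp.Legal, WExp.Legal])
      (by simp [RExp.eval, WExp.eval]) (by simp [WExp.cost, RExp.cost])) ?_ (by omega)
  rintro s₁ - hs1
  refine Runs.seq (c := 4) (d := 48 * x.n + 23) (Q := fun s' => s' = s₁.setReal 20 0 0)
    (Runs.setReal (by simp [WExp.Legal]) (by simp [RExp.Legal, WExp.Legal])
      (by simp [RExp.eval, WExp.eval]) (by simp [WExp.cost, RExp.cost])) ?_ (by omega)
  rintro s₂ - hs2
  have r2 : s₂.real a = s.real a := by
    funext t
    rw [hs2, Store.setReal_real, if_neg (by simp [ha]), hs1, Store.setReal_real,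
      if_neg (by simp [ha])]
  refine Runs.seq (c := 26 * x.n + 9) (d := 22 * x.n + 14)
    (runs_forLoop x.n 14 (fun j s' =>
      s'.real 19 0 = (∑ i ∈ range j, if 0 ≤ s.real a i then s.real a i else 0) ∧
      s'.real 20 0 = ∑ i ∈ range j, if 0 ≤ s.real a i then 0 else -s.real a i)
      (by simp [Prog.words]) (fun s' _ => by simp [WExp.eval, WExp.Legal]; omega) (by omega)
      (fun k s' v h => h) (by simp [hs2, hs1, Store.setReal_real]) ?_
      (by simp only [WExp.cost]; omega)) ?_ (by omega)
  · rintro k hk s₃ hS3 hk3 ⟨hI1, hI2⟩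
    have r3 : s₃.real a = s.real a := by rw [hS3.real a (by simp [Prog.reals, ha]), r2]
    have hkW : k ≤ W := by omega
    refine Runs.ite (c := 8) (by simp [Test.Legal, RExp.Legal, WExp.Legal, WExp.eval, hk3, hkW])
      ?_ ?_ (by simp [Test.cost, RExp.cost, WExp.cost])
    · intro hh
      simp only [Test.Holds, RExp.eval, WExp.eval, Nat.cast_zero, hk3, r3] at hh
      refine Runs.setReal (by simp [WExp.Legal])
        (by simp [RExp.Legal, WExp.Legal, WExp.eval, hk3, hkW]) ?_ (by simp [WExp.cost, RExp.cost])
      simp [RExp.eval, WExp.eval, hk3, r3, Store.setReal_real, sum_range_succ, hI1, hI2, hh]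
    · intro hh
      simp only [Test.Holds, RExp.eval, WExp.eval, Nat.cast_zero, hk3, r3] at hh
      refine Runs.setReal (by simp [WExp.Legal])
        (by simp [RExp.Legal, WExp.Legal, WExp.eval, hk3, hkW]) ?_ (by simp [WExp.cost, RExp.cost])
      simp [RExp.eval, WExp.eval, hk3, r3, Store.setReal_real, sum_range_succ, hI1, hI2, hh]
      ring
  · rintro s₃ hS3 ⟨h3, h3'⟩
    have r3 : s₃.real a = s.real a := by rw [hS3.real a (by simp [Prog.reals, forLoop, ha]), r2]
    refine Runs.ite (c := 22 * x.n + 9) (by simp [Test.Legal, RExp.Legal, WExp.Legal])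
      ?_ ?_ (by simp [Test.cost, RExp.cost, WExp.cost]; omega)
    · intro hh
      simp only [Test.Holds, RExp.eval, WExp.eval, h3, h3'] at hh
      refine (runs_markSigns hF hd le_rfl zero_le_one le_rfl).mono le_rfl fun s' _ h => ?_
      rw [r3] at h
      exact Or.inl ⟨hh, h⟩
    · intro hh
      simp only [Test.Holds, RExp.eval, WExp.eval, h3, h3', not_le] at hh
      refine (runs_markSigns hF hd zero_le_one le_rfl le_rfl).mono le_rfl fun s' _ h => ?_
      rw [r3] at h
      exact Or.inr ⟨hh.le, h⟩

/-- Round the vector in the real array `4` to a pair of sets of indices. -/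
def cut : Prog :=
  .seq (rowSums 15 (.mul (.entry (.reg 8) (.reg 9)) (.cell 4 (.reg 9)))) <|
  .seq (rowSums 16 (.mul (.entry (.reg 9) (.reg 8)) (.cell 15 (.reg 9)))) <|
  .seq (rowSums 17 (.mul (.entry (.reg 8) (.reg 9)) (.cell 16 (.reg 9)))) <|
  .seq (signSet 17 1) <|
  .seq (rowSums 18 (.mul (.entry (.reg 9) (.reg 8)) (.cast (.cell 1 (.reg 9))))) (signSet 18 2)

theorem entry_fin (x : Input) (i k : Fin x.n) : x.entry i k = x.A i k := by
  simp [Input.entry]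

theorem sum_abs_le_of_signSet {n d : ℕ} {s : Store} {f : ℕ → ℝ}
    (h : ((∑ i ∈ range n, if 0 ≤ f i then 0 else -f i) ≤
          ∑ i ∈ range n, (if 0 ≤ f i then f i else 0) ∧
        ∀ i < n, s.word d i = if 0 ≤ f i then 1 else 0) ∨
      ((∑ i ∈ range n, if 0 ≤ f i then f i else 0) ≤
          ∑ i ∈ range n, (if 0 ≤ f i then 0 else -f i) ∧
        ∀ i < n, s.word d i = if 0 ≤ f i then 0 else 1)) :
    ∑ i : Fin n, |f i| ≤ 2 * |∑ i ∈ s.outputSet d n, f i| := by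
  refine sum_abs_le_two_mul_abs_sum (fun i : Fin n => f i) _ ?_
  rw [← Fin.sum_univ_eq_sum_range (fun i => if 0 ≤ f i then 0 else -f i),
    ← Fin.sum_univ_eq_sum_range (fun i => if 0 ≤ f i then f i else 0)] at h
  refine h.imp (fun h => ⟨h.1, fun i => ?_⟩) (fun h => ⟨h.1, fun i => ?_⟩)
  · rw [Store.outputSet, mem_filter, h.2 i i.2]; simp
  · rw [Store.outputSet, mem_filter, h.2 i i.2]; simp

theorem runs_cut (hF : Fits x W L) {c' : ℕ} (hc : 108 * x.n ^ 2 + 216 * x.n + 98 ≤ c') :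
    Runs x W cut s c' fun s' => ∃ y z f g : Fin x.n → ℝ,
      (∀ i, y i = ∑ k, x.A i k * s.real 4 k) ∧ (∀ k, z k = ∑ i, x.A i k * y i) ∧
      (∀ i, f i = ∑ k, x.A i k * z k) ∧
      ∑ i, |f i| ≤ 2 * |∑ i ∈ s'.outputSet 1 x.n, f i| ∧
      (∀ k, g k = ∑ i ∈ s'.outputSet 1 x.n, x.A i k) ∧
      ∑ k, |g k| ≤ 2 * |∑ k ∈ s'.outputSet 2 x.n, g k| := by
  have hn := hF.n_le
  set R := 27 * x.n ^ 2 + 30 * x.n + 9 with hR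
  have hbound : R + (R + (R + (48 * x.n + 31 + (R + (48 * x.n + 31))))) ≤ c' := by
    refine le_trans (le_of_eq ?_) hc; rw [hR]; ring
  refine Runs.seq (runs_rowSums hF (fun k c => x.entry k c * s.real 4 c) (by decide) ?_
    (by decide) le_rfl) ?_ hbound
  · intro k hk c hc s' hS h8 h9
    constructor
    · simp [RExp.eval, WExp.eval, h8, h9, hS.real 4 (by decide)]
    · simp [RExp.Legal, WExp.Legal, WExp.eval, h8, h9]; omega
  intro s₁ hS1 h1
  refine Runs.seq (runs_rowSums hF (fun k c => x.entry c k * s₁.real 15 c) (by decide) ?_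
    (by decide) le_rfl) ?_ le_rfl
  · intro k hk c hc s' hS h8 h9
    constructor
    · simp [RExp.eval, WExp.eval, h8, h9, hS.real 15 (by decide)]
    · simp [RExp.Legal, WExp.Legal, WExp.eval, h8, h9]; omega
  intro s₂ hS2 h2
  refine Runs.seq (runs_rowSums hF (fun k c => x.entry k c * s₂.real 16 c) (by decide) ?_
    (by decide) le_rfl) ?_ le_rfl
  · intro k hk c hc s' hS h8 h9
    constructor
    · simp [RExp.eval, WExp.eval, h8, h9, hS.real 16 (by decide)]
    · simp [RExp.Legal, WExp.Legal, WExp.eval, h8, h9]; omega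
  intro s₃ hS3 h3
  refine Runs.seq (c := 48 * x.n + 31) (runs_signSet hF (by decide) (by decide) le_rfl) ?_ le_rfl
  intro s₄ hS4 h4
  -- The marks are read back as real coefficients: being bits, they are legal words and turn the
  -- weighted column sums into sums over the set.
  have hbit : ∀ i < x.n, s₄.word 1 i ≤ 1 := fun i hi => by
    rcases h4 with h | h <;> rw [h.2 i hi] <;> split_ifs <;> simp
  refine Runs.seq (runs_rowSums hF (fun k c => x.entry c k * (s₄.word 1 c : ℝ)) (by decide) ?_
    (by decide) le_rfl) ?_ le_rfl
  · intro k hk c hc s' hS h8 h9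
    constructor
    · simp [RExp.eval, WExp.eval, h8, h9, hS.word 1 (by decide)]
    · have := hbit c hc
      simp [RExp.Legal, WExp.Legal, WExp.eval, h8, h9, hS.word 1 (by decide)]; omega
  intro s₅ hS5 h5
  refine (runs_signSet hF (by decide) (by decide) le_rfl).mono le_rfl ?_
  intro s₆ hS6 h6
  have hw : s₆.outputSet 1 x.n = s₄.outputSet 1 x.n := by
    rw [Store.outputSet, Store.outputSet, hS6.word 1 (by decide), hS5.word 1 (by decide)]
  refine ⟨fun i => s₁.real 15 i, fun k => s₂.real 16 k, fun i => s₃.real 17 i,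
    fun k => s₅.real 18 k, fun i => ?_, fun k => ?_, fun i => ?_, ?_, fun k => ?_, ?_⟩
  · beta_reduce
    rw [h1 i i.2, ← Fin.sum_univ_eq_sum_range (fun c => x.entry i c * s.real 4 c)]
    simp only [entry_fin]
  · beta_reduce
    rw [h2 k k.2, ← Fin.sum_univ_eq_sum_range (fun c => x.entry c k * s₁.real 15 c)]
    simp only [entry_fin]
  · beta_reduce
    rw [h3 i i.2, ← Fin.sum_univ_eq_sum_range (fun c => x.entry i c * s₂.real 16 c)]
    simp only [entry_fin]
  · rw [hw]; exact sum_abs_le_of_signSet h4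
  · beta_reduce
    rw [h5 k k.2, ← Fin.sum_univ_eq_sum_range (fun c => x.entry c k * (s₄.word 1 c : ℝ)), hw,
      Store.outputSet, sum_filter]
    refine sum_congr rfl fun i _ => ?_
    rw [entry_fin]
    have := hbit i i.2
    split_ifs with h
    · rw [h]; simp
    · have : s₄.word 1 i = 0 := by omega
      rw [this]; simp
  · exact sum_abs_le_of_signSet h6

end RealRAM

/-! ### The complete algorithm. -/

namespace RealRAM

open Finset
open scoped InnerProductSpace

variable {x : Input} {W L : ℕ} {s : Store}

/-- The test whether the word register `3` is still smaller than `60 * (C / ε) ^ 2`. -/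
def sizeTest : Test :=
  .not (.realLE (.mul (.cast (.const 60)) (.mul .bound .bound))
    (.mul (.mul .accuracy .accuracy) (.cast (.reg 3))))

/-- Choose the size of the sketch. -/
def chooseSize : Prog :=
  .seq (.setWord 3 (.const 0) (.const 1))
    (.while sizeTest (.setWord 3 (.const 0) (.add (.reg 3) (.const 1))))

/-- A real number cannot be converted to a word, so `L` is found by counting upwards. It is the
least admissible value, hence `h2`. -/
theorem runs_chooseSize (hL : 1 ≤ L) (hW : L + 60 ≤ W)
    (h1 : 60 * (x.C * x.C) ≤ x.ε * x.ε * L)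
    (h2 : ∀ l < L, 1 ≤ l → ¬ 60 * (x.C * x.C) ≤ x.ε * x.ε * l) {c' : ℕ} (hc : 21 * L + 19 ≤ c') :
    Runs x W chooseSize s c' fun s' => s'.word 3 0 = L := by
  have key : ∀ d l s', l + d = L → 1 ≤ l → s'.word 3 0 = l →
      Runs x W (.while sizeTest (.setWord 3 (.const 0) (.add (.reg 3) (.const 1)))) s'
        (21 * d + 15) fun s' => s'.word 3 0 = L := by
    intro d
    induction d with
    | zero =>
      intro l s' hl _ hs
      obtain rfl : l = L := by omega
      refine ⟨_, s', ?_, .whileFalse ?_ ?_, hs⟩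
      · simp [sizeTest, Test.cost, RExp.cost, WExp.cost]
      · simp [sizeTest, Test.Legal, RExp.Legal, WExp.Legal, WExp.eval, hs]; omega
      · simpa [sizeTest, Test.Holds, RExp.eval, WExp.eval, hs] using h1
    | succ d ih =>
      intro l s' hl hl1 hs
      obtain ⟨t, s₂, ht, he, hq⟩ := ih (l + 1) (s'.setWord 3 0 (l + 1)) (by omega) (by omega)
        (by simp [Store.setWord_word])
      have hset := Exec.setWord (x := x) (W := W) 3 (.const 0) (.add (.reg 3) (.const 1)) s'
        (by simp [WExp.Legal]) (by simp [WExp.Legal, WExp.eval, hs]; omega)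
      simp only [WExp.eval, hs] at hset
      refine ⟨_, s₂, ?_, .whileTrue ?_ ?_ hset he, hq⟩
      · simp only [sizeTest, Test.cost, RExp.cost, WExp.cost]; omega
      · simp [sizeTest, Test.Legal, RExp.Legal, WExp.Legal, WExp.eval, hs]; omega
      · simpa [sizeTest, Test.Holds, RExp.eval, WExp.eval, hs] using h2 l (by omega) hl1
  refine Runs.seq (c := 3) (d := 21 * (L - 1) + 15) (Q := fun s' => s'.word 3 0 = 1)
    (Runs.setWord (by simp [WExp.Legal]) (by simp [WExp.Legal]; omega)
      (by simp [WExp.eval, Store.setWord_word]) (by simp [WExp.cost])) ?_ (by omega)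
  intro s₁ _ h
  exact key (L - 1) 1 s₁ (by omega) le_rfl h

/-- The algorithm: build a sketch of the rows, then find an approximate top eigenvector of the
sketch, and either round it to a pair of sets or claim that all singular values are small. -/
def algorithm : Prog :=
  .seq chooseSize <| .seq (forLoop 4 .size insertRow) <|
  .seq (.setReal 1 (.reg 3) (.cast (.const 0))) <| .seq findBest <|
  .ite (.realLE (.mul (.cast (.const 9)) (.mul (.mul (.mul .accuracy .accuracy)
      (.mul (.cast .size) (.cast .size))) (.reg 6))) (.mul (.cast (.const 20)) (.reg 5)))
    cut (.setWord 0 (.const 0) (.const 1))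

theorem norm_toEuclideanLin_eq (x : Input) (y : EuclideanSpace ℝ (Fin x.n)) :
    ‖Matrix.toEuclideanLin x.A y‖ ^ 2 = weightedForm x.n 1 x.row y := by
  rw [norm_toEuclideanLin_sq, weightedForm,
    ← Fin.sum_univ_eq_sum_range (fun i => (1 : ℕ → ℝ) i * ⟪x.row i, y⟫_ℝ ^ 2)]
  refine sum_congr rfl fun i _ => ?_
  rw [Pi.one_apply, one_mul]
  congr 1
  simp only [Input.row, PiLp.inner_apply, entry_fin]
  exact sum_congr rfl fun k _ => by simp [mul_comm]

theorem weightedTrace_row_le (x : Input) (hC : ∀ i k, |x.A i k| ≤ x.C) :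
    weightedTrace x.n 1 x.row ≤ x.C * x.C * (x.n : ℝ) ^ 2 := by
  rw [weightedTrace, ← Fin.sum_univ_eq_sum_range (fun i => (1 : ℕ → ℝ) i * ⟪x.row i, x.row i⟫_ℝ)]
  calc _ ≤ ∑ i : Fin x.n, ∑ k : Fin x.n, x.C * x.C := by
        refine sum_le_sum fun i _ => ?_
        rw [Pi.one_apply, one_mul]
        simp only [Input.row, PiLp.inner_apply, entry_fin]
        refine sum_le_sum fun k _ => ?_
        have h1 := hC i k
        have h2 : x.A i k * x.A i k ≤ x.C * x.C := by
          rw [← abs_mul_abs_self]; exact mul_self_le_mul_self (abs_nonneg _) h1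
        simpa [sq] using h2
    _ = _ := by simp; ring

/-- The threshold for `num / den` is `9 / 20 * ε² n²`. Below it, the factor 2 of `IsBest.inner_le`
bounds the sketch by `9 / 10 * ε² n²`, and the sketching loss fits into the remaining tenth. -/
theorem runs_algorithm (hF : Fits x W L) (hε : 0 < x.ε) (hC : ∀ i k, |x.A i k| ≤ x.C)
    (hrow : ∀ i, ∑ k, x.A i k ^ 2 ≤ (x.n : ℝ)) (hcol : ∀ k, ∑ i, x.A i k ^ 2 ≤ (x.n : ℝ))
    (h1 : 60 * (x.C * x.C) ≤ x.ε * x.ε * L)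
    (h2 : ∀ l < L, 1 ≤ l → ¬ 60 * (x.C * x.C) ≤ x.ε * x.ε * l) {c' : ℕ}
    (hc : 5000 * (L ^ 3 * (L + 1) ^ 2 * x.n ^ 2) ≤ c') :
    Runs x W algorithm Store.init c' fun s =>
      (s.Certifies ∧ ∀ j : ℕ, (Matrix.toEuclideanLin x.A).singularValues j ≤ x.ε * x.n) ∨
      ¬ s.Certifies ∧ x.ε ^ 8 / 100 * (x.n : ℝ) ^ 2 ≤
        |∑ i ∈ s.outputSet 1 x.n, ∑ k ∈ s.outputSet 2 x.n, x.A i k| := by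
  have hn := hF.n_le
  have hL := hF.L_le
  have hn1 := hF.one_le_n
  have hL1 := hF.one_le_L
  set B := L ^ 2 * (L + 1) ^ 2 * x.n with hB
  have hbound : 21 * L + 19 + (x.n * (2000 * (L * B) + 12) + 9 + (5 + (1000 * B +
      (21 + (108 * x.n ^ 2 + 216 * x.n + 98))))) ≤ c' := by
    refine le_trans ?_ hc
    have e1 : L ^ 3 * (L + 1) ^ 2 * x.n ^ 2 = x.n * (L * B) := by rw [hB]; ring
    have g1 : 4 ≤ L ^ 2 * (L + 1) ^ 2 := le_trans (by norm_num)
      (Nat.mul_le_mul (Nat.pow_le_pow_left hL1 2) (Nat.pow_le_pow_left (by omega : 2 ≤ L + 1) 2))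
    have g2 : 4 * x.n ≤ B := Nat.mul_le_mul_right _ g1
    have g3 : B ≤ L * B := Nat.le_mul_of_pos_left _ hL1
    have g4 : L * B ≤ x.n * (L * B) := Nat.le_mul_of_pos_left _ hn1
    have g5 : L ≤ L * B := Nat.le_mul_of_pos_right _ (by omega)
    have g6 : x.n * (4 * x.n) ≤ x.n * (L * B) := Nat.mul_le_mul_left _ (g2.trans g3)
    have g7 : x.n * (4 * x.n) = 4 * x.n ^ 2 := by ring
    have g8 : x.n * (2000 * (L * B) + 12) = 2000 * (x.n * (L * B)) + 12 * x.n := by ring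
    rw [e1]
    omega
  refine Runs.seq (runs_chooseSize hL1 (by omega) h1 h2 le_rfl) ?_ hbound
  intro s₁ hS1 w1
  have z1 : s₁.word 0 = Store.init.word 0 := hS1.word 0 (by decide)
  have r1 : s₁.real = Store.init.real := by
    funext a; exact hS1.real a (by simp [Prog.reals, chooseSize])
  refine Runs.seq (c := x.n * (2000 * (L * B) + 12) + 9)
    (runs_forLoop x.n (2000 * (L * B)) (fun i s' => IsSketch L x.row i (s'.real 1)
      (row x.n (s'.real 0))) (by decide) (fun s' _ => by simp [WExp.eval, WExp.Legal]; omega)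
      (by omega) (fun k s' v h => h) (IsSketch.zero _ _ _ fun k _ => by rw [r1]; rfl) ?_
      (by simp only [WExp.cost]; exact le_of_eq (by ring))) ?_ le_rfl
  · intro i hi s' hS hi4 hI
    have w : s'.word 3 0 = L := by rw [hS.word 3 (by decide), w1]
    exact runs_insertRow hF w hi4 hi hI le_rfl
  intro s₂ hS2 h2
  have w2 : s₂.word 3 0 = L := by rw [hS2.word 3 (by decide), w1]
  have z2 : s₂.word 0 = Store.init.word 0 := by rw [hS2.word 0 (by decide), z1]
  -- `findBest` works with `L + 1` slots; slot `L` still holds what the last insertion left there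
  -- and is switched off by weight `0`.
  refine Runs.seq (c := 5) (Q := fun s' => s' = s₂.setReal 1 L 0)
    (Runs.setReal (by simp [WExp.Legal, WExp.eval, w2]; omega)
      (by simp [RExp.Legal, WExp.Legal])
      (by simp [RExp.eval, WExp.eval, w2]) (by simp [WExp.cost, RExp.cost])) ?_ le_rfl
  rintro s₃ - hs3
  have w3 : s₃.word 3 0 = L := by rw [hs3, Store.setReal_word, w2]
  have z3 : s₃.word 0 = Store.init.word 0 := by rw [hs3, Store.setReal_word, z2]
  have f0 : s₃.real 0 = s₂.real 0 := by
    funext t; rw [hs3, Store.setReal_real, if_neg (by simp)]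
  have f1L : s₃.real 1 L = 0 := by rw [hs3, Store.setReal_real, if_pos (by simp)]
  have f1 : ∀ k < L, s₃.real 1 k = s₂.real 1 k := fun k hk => by
    rw [hs3, Store.setReal_real, if_neg (by simp; omega)]
  have hform : ∀ y, weightedForm (L + 1) (s₃.real 1) (row x.n (s₃.real 0)) y =
      weightedForm L (s₂.real 1) (row x.n (s₂.real 0)) y := fun y => by
    rw [weightedForm, sum_range_succ, f1L, zero_mul, add_zero, f0]
    exact sum_congr rfl fun k hk => by rw [f1 k (mem_range.1 hk)]
  have hw : ∀ k < L + 1, 0 ≤ s₃.real 1 k := fun k hk => by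
    rcases Nat.lt_succ_iff_lt_or_eq.1 hk with hk | rfl
    · rw [f1 k hk]; exact h2.weight_nonneg k hk
    · rw [f1L]
  refine Runs.seq (c := 1000 * B) (runs_findBest hF w3 le_rfl) ?_ le_rfl
  intro s₄ hS4 hbest
  have z4 : s₄.word 0 0 = 0 := by rw [hS4.word 0 (by decide), z3]; rfl
  set num := s₄.real 5 0 with hnum
  set den := s₄.real 6 0 with hden
  set b := vec x.n (s₄.real 4) 0 with hb
  have hden0 := hbest.den_pos
  have hn0 : (0 : ℝ) < x.n := by exact_mod_cast hn1
  refine Runs.ite (c := 108 * x.n ^ 2 + 216 * x.n + 98) ?_ ?_ ?_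
    (by simp [Test.cost, RExp.cost, WExp.cost])
  · simp [Test.Legal, RExp.Legal, WExp.Legal]; omega
  · intro hh
    simp only [Test.Holds, RExp.eval, WExp.eval, ← hnum, ← hden] at hh
    push_cast at hh
    refine (runs_cut hF le_rfl).mono le_rfl ?_
    rintro s₅ hS5 ⟨y, z, f, g, hy, hz, hf, hS, hg, hT⟩
    right
    refine ⟨?_, ?_⟩
    · rw [Store.Certifies, hS5.word 0 (by decide), z4]; exact zero_ne_one
    have hpos : 0 < num := by
      have : 0 < 9 * (x.ε * x.ε * ((x.n : ℝ) * x.n) * den) := by positivity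
      linarith
    rcases hbest.cases with h | h
    · exact absurd h.2.1 hpos.ne'
    have e1 : ∑ k : Fin x.n, s₄.real 4 k ^ 2 = den := by
      rw [h.2.2.1, hb, inner_vec, ← Fin.sum_univ_eq_sum_range (fun c => s₄.real 4 (0 + c) *
        s₄.real 4 (0 + c))]
      exact sum_congr rfl fun k _ => by rw [zero_add, sq]
    refine le_abs_sum_cut hn1 hε hrow hcol hy hz hf hS hg hT (by rw [e1]; exact hden0) ?_
    -- The sketch never overestimates `‖A b‖²`, so a large value on the sketch is genuine.
    have e2 : num ≤ ∑ i, y i ^ 2 := by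
      rw [h.2.1, inner_weightedGram_self, hform]
      refine (h2.form_le b).trans (le_of_eq ?_)
      rw [← norm_toEuclideanLin_eq, norm_toEuclideanLin_sq]
      refine sum_congr rfl fun i _ => ?_
      rw [hy i]
      simp [hb]
    rw [e1]
    calc _ = 9 * (x.ε * x.ε * ((x.n : ℝ) * x.n) * den) := by ring
      _ ≤ 20 * num := hh
      _ ≤ _ := by linarith
  · intro hh
    simp only [Test.Holds, RExp.eval, WExp.eval, ← hnum, ← hden, not_le] at hh
    push_cast at hh
    refine Runs.setWord (by simp [WExp.Legal]) (by simp [WExp.Legal]; omega) (Or.inl ⟨?_, ?_⟩)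
      (by simp [WExp.cost])
    · simp [Store.Certifies, Store.setWord_word, WExp.eval]
    · refine LinearMap.singularValues_le_of_forall_norm_sq_le _ (by positivity) fun y => ?_
      obtain ⟨D, hD, hD1, hD2⟩ := h2.exists_loss
      have htr := weightedTrace_nonneg (v := row x.n (s₂.real 0)) h2.weight_nonneg
      have hrt := weightedTrace_row_le x hC
      have hLpos : (0 : ℝ) < L := by exact_mod_cast hL1
      -- Combine `L / 6 * D ≤ C² n²` with `60 C² ≤ ε² L`.
      have hDle : D ≤ x.ε * x.ε * (x.n : ℝ) ^ 2 / 10 := by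
        refine le_of_mul_le_mul_left ?_ hLpos
        have : 60 * (x.C * x.C) * (x.n : ℝ) ^ 2 ≤ x.ε * x.ε * L * (x.n : ℝ) ^ 2 :=
          mul_le_mul_of_nonneg_right h1 (by positivity)
        linarith
      have hin := hbest.inner_le hL1 hw y
      rw [inner_weightedGram_self, hform] at hin
      have hyy : 0 ≤ ⟪y, y⟫_ℝ := real_inner_self_nonneg
      have hq : weightedForm L (s₂.real 1) (row x.n (s₂.real 0)) y ≤
          9 / 10 * (x.ε * x.ε * (x.n : ℝ) ^ 2) * ⟪y, y⟫_ℝ := by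
        refine le_of_mul_le_mul_right (hin.trans ?_) hden0
        calc 2 * num * ⟪y, y⟫_ℝ ≤ (9 / 10 * (x.ε * x.ε * (x.n : ℝ) ^ 2) * den) * ⟪y, y⟫_ℝ :=
              mul_le_mul_of_nonneg_right (by linarith) hyy
          _ = _ := by ring
      have hDy := mul_le_mul_of_nonneg_right hDle hyy
      rw [norm_toEuclideanLin_eq, ← real_inner_self_eq_norm_sq]
      have := hD1 y
      calc _ ≤ _ := this
        _ ≤ x.ε * x.ε * (x.n : ℝ) ^ 2 * ⟪y, y⟫_ℝ := by linarith
        _ = _ := by ring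

/-- By minimality `L` is `1` or less than `60 (C / ε)² + 1`. The whole conjunction is the left
alternative; for `C < 0` the witness `0` is a placeholder. -/
theorem exists_size (C : ℝ) {ε : ℝ} (hε : 0 < ε) : ∃ L : ℕ, 1 ≤ L ∧
    60 * (C * C) ≤ ε * ε * L ∧ (∀ l < L, 1 ≤ l → ¬ 60 * (C * C) ≤ ε * ε * l) ∧
    (L : ℝ) ≤ 61 * max 1 (C / ε) ^ 2 ∨ C < 0 := by
  rcases lt_or_ge C 0 with hC | hC
  · exact ⟨0, Or.inr hC⟩
  have hex : ∃ l : ℕ, 1 ≤ l ∧ 60 * (C * C) ≤ ε * ε * l := by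
    obtain ⟨l, hl⟩ := exists_nat_ge (60 * (C * C) / (ε * ε))
    refine ⟨l + 1, by omega, ?_⟩
    rw [div_le_iff₀ (by positivity)] at hl
    push_cast
    nlinarith
  classical
  refine ⟨Nat.find hex, Or.inl ⟨(Nat.find_spec hex).1, (Nat.find_spec hex).2,
    fun l hl h1 h2 => Nat.find_min hex hl ⟨h1, h2⟩, ?_⟩⟩
  set L := Nat.find hex with hLdef
  have hM : (1 : ℝ) ≤ max 1 (C / ε) ^ 2 := one_le_pow₀ (le_max_left _ _)
  have hL1 : 1 ≤ L := (Nat.find_spec hex).1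
  rcases Nat.lt_or_ge L 2 with h | h
  · have : L = 1 := by omega
    rw [this]; push_cast; linarith
  · have hmin := Nat.find_min hex (show L - 1 < L by omega)
    rw [not_and, not_le] at hmin
    have h3 := hmin (by omega)
    rw [Nat.cast_sub hL1] at h3
    push_cast at h3
    have h4 : (C / ε) ^ 2 ≤ max 1 (C / ε) ^ 2 :=
      pow_le_pow_left₀ (by positivity) (le_max_right _ _) 2
    have h5 : (L : ℝ) - 1 < 60 * (C / ε) ^ 2 := by
      rw [div_pow, ← mul_div_assoc, lt_div_iff₀ (by positivity)]
      nlinarith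
    linarith

/-- The step bound itself is large enough to serve as the word bound, so one estimate settles both.
-/
theorem fits_of_one_le (hn : 1 ≤ x.n) (hL : 1 ≤ L) :
    Fits x (5000 * (L ^ 3 * (L + 1) ^ 2 * x.n ^ 2)) L := by
  refine ⟨hn, hL, ?_⟩
  have h1 : L * x.n ≤ L ^ 3 * (L + 1) ^ 2 * x.n ^ 2 := by
    calc L * x.n ≤ (L * x.n) * (L ^ 2 * (L + 1) ^ 2 * x.n) := Nat.le_mul_of_pos_right _ (by positivity)
      _ = _ := by ring
  have h2 : L ^ 2 ≤ L ^ 3 * (L + 1) ^ 2 * x.n ^ 2 := by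
    calc L ^ 2 ≤ L ^ 2 * (L * (L + 1) ^ 2 * x.n ^ 2) := Nat.le_mul_of_pos_right _ (by positivity)
      _ = _ := by ring
  have h3 : L ≤ L * x.n := Nat.le_mul_of_pos_right _ hn
  have h4 : x.n ≤ L * x.n := Nat.le_mul_of_pos_left _ hL
  have h5 : (L + 2) * (x.n + 2) = L * x.n + 2 * L + 2 * x.n + 4 := by ring
  omega

end RealRAM

theorem theorem2p2 :
    ∃ (p : RealRAM.Prog) (K : ℕ), ∀ (n : ℕ) (A : Matrix (Fin n) (Fin n) ℝ) (C ε : ℝ),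
      1 ≤ n → 0 < ε →
      (∀ i k, |A i k| ≤ C) →
      (∀ i, ∑ k, A i k ^ 2 ≤ (n : ℝ)) →
      (∀ k, ∑ i, A i k ^ 2 ≤ (n : ℝ)) →
      ∃ s : RealRAM.Store,
        RealRAM.HaltsWithin p ⟨n, A, C, ε⟩ (K * max 1 (C / ε) ^ K * (n : ℝ) ^ 2) s ∧
        (s.Certifies ∧
            (∀ j : Fin n, (Matrix.toEuclideanLin A).singularValues j ≤ ε * n) ∨
          ¬ s.Certifies ∧
            ε ^ 8 / 100 * (n : ℝ) ^ 2 ≤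
              |∑ i ∈ s.outputSet 1 n, ∑ k ∈ s.outputSet 2 n, A i k| ∧
            ∃ j : Fin n, ε ^ 8 / 100 * (n : ℝ) ≤
              (Matrix.toEuclideanLin A).singularValues j) := by
  -- From `L ≤ 61 M²` with `M = max 1 (C / ε)`: `5000 L³ (L + 1)² ≤ 5000 * 4 * L⁵ ≤ 20000 * 61⁵ *
  -- M¹⁰`. As exponent the constant is far larger than the `10` needed.
  refine ⟨RealRAM.algorithm, 20000 * 61 ^ 5, fun n A C ε hn hε hC hrow hcol => ?_⟩
  have hC0 : 0 ≤ C := (abs_nonneg _).trans (hC ⟨0, hn⟩ ⟨0, hn⟩)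
  obtain ⟨L, h⟩ := RealRAM.exists_size C hε
  obtain ⟨hL, h1, h2, hLM⟩ := h.resolve_right (not_lt.2 hC0)
  set x : RealRAM.Input := ⟨n, A, C, ε⟩ with hx
  obtain ⟨t, s, ht, he, hs⟩ := RealRAM.runs_algorithm (x := x) (RealRAM.fits_of_one_le hn hL) hε hC
    hrow hcol h1 h2 le_rfl
  have hB : ((5000 * (L ^ 3 * (L + 1) ^ 2 * n ^ 2) : ℕ) : ℝ) ≤
      ((20000 * 61 ^ 5 : ℕ) : ℝ) * max 1 (C / ε) ^ (20000 * 61 ^ 5) * (n : ℝ) ^ 2 := by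
    set M := max 1 (C / ε) with hM
    have hM1 : 1 ≤ M := le_max_left _ _
    have hL' : (1 : ℝ) ≤ L := by exact_mod_cast hL
    have e1 : (L : ℝ) ^ 3 * (L + 1) ^ 2 ≤ 4 * (61 * M ^ 2) ^ 5 := by
      calc (L : ℝ) ^ 3 * (L + 1) ^ 2 ≤ (L : ℝ) ^ 3 * (L + L) ^ 2 := by gcongr
        _ = 4 * (L : ℝ) ^ 5 := by ring
        _ ≤ _ := by gcongr
    have e2 : M ^ 10 ≤ M ^ (20000 * 61 ^ 5) := pow_le_pow_right₀ hM1 (by norm_num)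
    push_cast
    calc 5000 * ((L : ℝ) ^ 3 * (L + 1) ^ 2 * (n : ℝ) ^ 2)
        ≤ 5000 * (4 * (61 * M ^ 2) ^ 5 * (n : ℝ) ^ 2) := by gcongr
      _ = 20000 * 61 ^ 5 * M ^ 10 * (n : ℝ) ^ 2 := by ring
      _ ≤ _ := by gcongr <;> norm_num
  refine ⟨s, ⟨_, t, hB, le_trans (by exact_mod_cast ht) hB, he⟩, ?_⟩
  refine hs.imp (fun h => ⟨h.1, fun j => h.2 j⟩) fun h => ⟨h.1, h.2, ⟨0, hn⟩, ?_⟩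
  -- The cut is at most `n` times the singular value of index `0`; cancelling one factor `n` gives
  -- the bound.
  have hcut := h.2.trans (abs_sum_cut_le A _ _)
  have hn0 : (0 : ℝ) < n := by exact_mod_cast hn
  refine le_of_mul_le_mul_right ?_ hn0
  refine le_trans (le_of_eq ?_) hcut
  simp only [hx]
  ring
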